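/- Let $d\ge 1$ and let $\widehat f(\xi)=\int f(t)e^{-2i\pi\langle t,\xi\rangle}\,dt$ denote the Fourier transform, extended to $L^2$ in the usual way. For $E\subset\mathbb{R}^d$ of finite Lebesgue measure $|E|$, let its $1$-dimensional rearrangement be $E^\star=[-|E|/2,|E|/2]\subset\mathbb{R}$, and, for an integer $k\ge 1$, let its $k$-dimensional rearrangement be the open ball $E^{\star k}=B(0,r)\subset\mathbb{R}^k$ with $|B(0,r)|_k=|E|$. For a measurable $\varphi:\mathbb{R}^d\to\mathbb{C}$ that vanishes at infinity define $$|\varphi|^{\star}(x)=\int_0^{\infty}\chi_{\{y:|\varphi(y)|>\lambda\}^{\star}}(x)\,d\lambda\quad(x\in\mathbb{R}),\qquad |\varphi|^{\star k}(x)=\int_0^{\infty}\chi_{\{y:|\varphi(y)|>\lambda\}^{\star k}}(x)\,d\lambda\quad(x\in\mathbb{R}^k).$$ Write $(1-|v|^2/R^2)_+^\gamma$ for the function equal to $(1-|v|^2/R^2)^\gamma$ if $|v|<R$ and to $0$ otherwise. For $\alpha>-\frac12$ and $s>0$ let $$\psi(s)=\begin{cases}(1+s)^{\frac12(d-2\alpha-1)}&\text{if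 }\alpha<\frac{d-1}2,\\ 1+\ln(1+s)&\text{if }\alpha=\frac{d-1}2,\\ 1&\text{if }\alpha>\frac{d-1}2.\end{cases}$$ **(1)** Let $\alpha>-\frac12$ and $\beta\ge 0$. There is a constant $C=C(d,\alpha,\beta)$ such that, for all $S,\Omega>0$, every $\varphi\in L^1(\mathbb{R}^d)$ with $|\{\varphi\neq0\}|\le S$ and all $a,x\in\mathbb{R}^d$, the function $|\varphi|^\star$ is integrable, the integrals below converge absolutely, the one on the right-hand side is real, and $$\left|\int_{\mathbb{R}^d}\widehat\varphi(\xi)\,(1-|\xi-a|^2/\Omega^2)_+^\alpha\,e^{2i\pi\langle x,\xi\rangle}\,d\xi\right|\le C\,\psi(\Omega^dS)\int_{\mathbb{R}}(1-|\xi|^2/\Omega^{2d})_+^\beta\,\widehat{|\varphi|^\star}(\xi)\,d\xi .$$ **(2)** There is a constant $\kappa_d$ such that, for every measurable $\Sigma\subset\mathbb{R}^d$ of finite measure and every $\varphi\in L^2(\mathbb{R}^d)$, $|\varphi|^\star\in L^2(\mathbb{R})$ and $$\int_\Sigma|\widehat\varphi(\xi)|^2\,d\xi\le\kappa_d\int_{-|\Sigma|/2}^{|\Sigma|/2}\bigl|\widehat{|\varphi|^\star}(\xi)\bigr|^2\,d\xi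 .$$ **(3)** Let $k\ge1$ be an integer, $\alpha>-\frac12$, $\beta\ge0$ and $\beta\ge\frac k2-1$. There is a constant $C=C(d,k,\alpha,\beta)$ such that, for all $S,\Omega,\varphi,a,x$ as in (1), the function $|\varphi|^{\star k}$ is integrable, the integrals below converge absolutely, the one on the right-hand side is real, and $$\left|\int_{\mathbb{R}^d}\widehat\varphi(\xi)\,(1-|\xi-a|^2/\Omega^2)_+^\alpha\,e^{2i\pi\langle x,\xi\rangle}\,d\xi\right|\le C\,\psi(\Omega^dS)\int_{\mathbb{R}^k}(1-|\xi|^2/\Omega^{2d/k})_+^\beta\,\widehat{|\varphi|^{\star k}}(\xi)\,d\xi .$$ **(4)** For every integer $k\ge1$ there is a constant $\kappa_{d,k}$ such that, for every measurable $\Sigma\subset\mathbb{R}^d$ of finite measure and every $\varphi\in L^2(\mathbb{R}^d)$, $|\varphi|^{\star k}\in L^2(\mathbb{R}^k)$ and $$\int_\Sigma|\widehat\varphi(\xi)|^2\,d\xi\le\kappa_{d,k}\int_{\Sigma^{\star k}}\bigl|\widehat{|\varphi|^{\star k}}(\xi)\bigr|^2\,d\xi .$$ -/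

import Mathlib

open MeasureTheory Set
open scoped FourierTransform

noncomputable section

namespace SymmRearr

/-- `ℝⁿ` with its Euclidean structure and Lebesgue measure. -/
abbrev Eucl (n : ℕ) : Type := EuclideanSpace ℝ (Fin n)

/-- For `E ⊆ ℝᵈ` of finite measure, the centred closed interval of `ℝ` of length `|E|`. -/
def starInterval {d : ℕ} (E : Set (Eucl d)) : Set ℝ :=
  Icc (-(volume.real E / 2)) (volume.real E / 2)

/-- The radius `r` with `|B(0,1)|ₖ rᵏ = |E|`, for `E ⊆ ℝᵈ` of finite measure. -/
def starRadius {d : ℕ} (k : ℕ) (E : Set (Eucl d)) : ℝ :=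
  (volume.real E / volume.real (Metric.ball (0 : Eucl k) 1)) ^ (1 / (k : ℝ))

/-- For `E ⊆ ℝᵈ` of finite measure, the centred open ball of `ℝᵏ` whose `k`-dimensional volume
is `|E|`. -/
def starBall {d : ℕ} (k : ℕ) (E : Set (Eucl d)) : Set (Eucl k) :=
  Metric.ball 0 (starRadius k E)

/-- Layer-cake definition of the rearrangement of functions attached to a rearrangement
`star` of sets: `x ↦ ∫_0^∞ χ_{star {|φ| > t}}(x) dt`. -/
def layerCake {d : ℕ} {V : Type*} (star : Set (Eucl d) → Set V) (φ : Eucl d → ℂ) (x : V) : ℝ :=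
  ∫ t in Ioi (0 : ℝ), (star {y | t < ‖φ y‖}).indicator (fun _ => (1 : ℝ)) x

/-- The one-dimensional symmetric decreasing rearrangement of a function on `ℝᵈ`. -/
def rearrLine {d : ℕ} (φ : Eucl d → ℂ) : ℝ → ℝ :=
  layerCake starInterval φ

/-- The `k`-dimensional symmetric decreasing rearrangement of a function on `ℝᵈ`. -/
def rearrBall {d : ℕ} (k : ℕ) (φ : Eucl d → ℂ) : Eucl k → ℝ :=
  layerCake (starBall k) φ

open Classical in
/-- The Bochner-Riesz weight `(1 - |v|² / R²)₊^γ`, which is `0` off the open ball of radius `R`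
(also for `γ ≤ 0`; in particular it is the indicator function of that ball when `γ = 0`). -/
def rieszWeight {V : Type*} [Norm V] (γ R : ℝ) (v : V) : ℝ :=
  if ‖v‖ < R then (1 - ‖v‖ ^ 2 / R ^ 2) ^ γ else 0

open Classical in
/-- The growth factor `ψ`. -/
def growth (d : ℕ) (α s : ℝ) : ℝ :=
  if α < ((d : ℝ) - 1) / 2 then (1 + s) ^ (((d : ℝ) - 2 * α - 1) / 2)
  else if α = ((d : ℝ) - 1) / 2 then 1 + Real.log (1 + s)
  else 1

/-- The integrand `φ̂(ξ) (1 - |ξ - a|² / Ω²)₊^α e^{2 i π ⟨x, ξ⟩}`. -/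
def rieszIntegrand {d : ℕ} (φ : Eucl d → ℂ) (α Ω : ℝ) (a x ξ : Eucl d) : ℂ :=
  𝓕 φ ξ * (rieszWeight α Ω (ξ - a) : ℂ) *
    Complex.exp (2 * (Real.pi : ℂ) * Complex.I * ((inner ℝ x ξ : ℝ) : ℂ))

/-- The integrand `(1 - |ξ|² / R²)₊^β ĝ(ξ)` for a real-valued function `g`. -/
def rearrIntegrand {V : Type*} [NormedAddCommGroup V] [InnerProductSpace ℝ V]
    [FiniteDimensional ℝ V] [MeasurableSpace V] [BorelSpace V]
    (g : V → ℝ) (β R : ℝ) (ξ : V) : ℂ :=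
  (rieszWeight β R ξ : ℂ) * 𝓕 (fun t => (g t : ℂ)) ξ

end SymmRearr

end

/-! The line and `ℝᵏ` are treated together: everything is proved for rearrangement into centred
balls of a Euclidean space `V`, whose boundary spheres are null (`IsBallStar`, `layerCake_ae_eq`).

`L¹` inequalities. The multiplication formula replaces each Bochner-Riesz weight by its Fourier
transform, a Bessel kernel, and the layer-cake formula reduces both sides to the sets `{|φ| > t}`.
Write `u = Ω^d |E|` for such a set `E`. On the left, the decay of the kernel bounds its absolute
integral over `E` by `C ψ(u) min(u, 1)`, wherever `E` lies (`exists_setLIntegral_decay_le`). On the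
right, the integral of the kernel over the ball of volume `|E|` is at least `c min(u, 1)`
(`exists_le_integral_ball_rieszKernel`). This second bound is the heart of the matter, since the
kernel oscillates. It follows by integration by parts from the positivity of the primitive of `√x
J_ν(x)` for `ν ≥ 1/2` (`integral_besselNormal_nonneg`). That positivity is a Sturm comparison: in
`w'' + (1 - μ(μ+1)/x²) w = 0` the coefficient of `w` increases, so each negative arch is dominated
by the reflection of what precedes it.

`L²` inequalities. Let `u` be the rearrangement of `|φ|`, `A = |Σ|`, `R` the radius of the ball of
`V` of volume `A`, and `r = 1/(6R)`. Both sides are compared with `A (∫_{|t|<r} u)² + ∫_{|t|≥r} u²`.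
From above, cutting `φ` at the height of `u` on the sphere `|t| = r` splits it into an `L¹` part and
an `L²` part (`setIntegral_norm_sq_fourier_le`). From below, averaging `|û|²` over differences of
points of `B(0, R/2)` produces a nonnegative kernel bounded below near the diagonal; as `u` is
nonnegative and radially decreasing, pairs of nearby points already carry both terms
(`sq_integral_ball_le_fourier`, `integral_sq_compl_ball_le_fourier`). -/

namespace SymmRearr

/-! ### The Poisson integral and Bessel's equation. -/

/-- The Poisson integral `∫_{-1}^1 (1 - s²)^μ cos (x s) ds`, a multiple of `J_{μ+1/2}(x) / x^{μ+1/2}`. -/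
noncomputable def poissonInt (μ x : ℝ) : ℝ :=
  ∫ s in (-1 : ℝ)..1, (1 - s ^ 2) ^ μ * Real.cos (x * s)

/-- The derivative of `poissonInt μ`. -/
noncomputable def poissonInt' (μ x : ℝ) : ℝ :=
  ∫ s in (-1 : ℝ)..1, (1 - s ^ 2) ^ μ * (-s * Real.sin (x * s))

/-- The second derivative of `poissonInt μ`. -/
noncomputable def poissonInt'' (μ x : ℝ) : ℝ :=
  ∫ s in (-1 : ℝ)..1, (1 - s ^ 2) ^ μ * (-s ^ 2 * Real.cos (x * s))

/-- The substitution `s = 2x - 1` turns the weight into `4^μ` times the Beta integrand `x^μ (1 -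
x)^μ`. -/
lemma intervalIntegrable_one_sub_sq_rpow {μ : ℝ} (hμ : -1 < μ) :
    IntervalIntegrable (fun s : ℝ => (1 - s ^ 2) ^ μ) volume (-1) 1 := by
  have h0 : IntervalIntegrable (fun x : ℝ => x ^ μ * (1 - x) ^ μ) volume 0 1 := by
    have h := (Complex.betaIntegral_convergent (u := (μ + 1 : ℝ)) (v := (μ + 1 : ℝ))
      (by simp; linarith) (by simp; linarith)).norm
    refine h.congr_ae ?_
    rw [uIoc_of_le zero_le_one]
    -- The norm formula for complex powers needs a positive base, so the endpoint is discarded.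
    have : ∀ᵐ x : ℝ, x ≠ 1 := by simp [ae_iff]
    refine (ae_restrict_iff' measurableSet_Ioc).2 ?_
    filter_upwards [this] with x hx1 hx
    have h1 : 0 < 1 - x := by
      have := lt_of_le_of_ne hx.2 hx1
      linarith
    have e : (1 : ℂ) - x = ((1 - x : ℝ) : ℂ) := by push_cast; ring
    rw [norm_mul, e, Complex.norm_cpow_eq_rpow_re_of_pos hx.1, Complex.norm_cpow_eq_rpow_re_of_pos h1]
    simp
  have h2 := ((h0.comp_add_right (1 / 2)).comp_mul_left (c := 1 / 2)).const_mul (4 ^ μ)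
  norm_num at h2
  refine h2.congr_ae ?_
  rw [uIoc_of_le (by norm_num)]
  refine (ae_restrict_iff' measurableSet_Ioc).2 (Filter.Eventually.of_forall fun s hs => ?_)
  have h3 : (0 : ℝ) ≤ 1 / 2 * s + 1 / 2 := by linarith [hs.1]
  have h4 : (0 : ℝ) ≤ 1 - (1 / 2 * s + 1 / 2) := by linarith [hs.2]
  dsimp only
  rw [← Real.mul_rpow h3 h4, ← Real.mul_rpow (by norm_num) (mul_nonneg h3 h4)]
  congr 1
  ring

lemma intervalIntegrable_weight_mul {μ : ℝ} (hμ : -1 < μ) {f : ℝ → ℝ} (hf : Continuous f) :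
    IntervalIntegrable (fun s : ℝ => (1 - s ^ 2) ^ μ * f s) volume (-1) 1 :=
  (intervalIntegrable_one_sub_sq_rpow hμ).mul_continuousOn hf.continuousOn

lemma one_sub_sq_rpow_nonneg (μ : ℝ) {s : ℝ} (hs : s ∈ Ioc (-1 : ℝ) 1) : 0 ≤ (1 - s ^ 2) ^ μ :=
  Real.rpow_nonneg (by nlinarith [hs.1, hs.2]) _

/-- Differentiation under the integral sign; as `|f'| ≤ 1`, the weight itself dominates. -/
lemma hasDerivAt_weight_integral {μ : ℝ} (hμ : -1 < μ) {f f' : ℝ → ℝ → ℝ}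
    (hf : ∀ x, Continuous (f x)) (hf' : ∀ x, Continuous (f' x))
    (hd : ∀ x s, HasDerivAt (fun y => f y s) (f' x s) x)
    (hb : ∀ x, ∀ s ∈ Ioc (-1 : ℝ) 1, |f' x s| ≤ 1) (x : ℝ) :
    HasDerivAt (fun y => ∫ s in (-1 : ℝ)..1, (1 - s ^ 2) ^ μ * f y s)
      (∫ s in (-1 : ℝ)..1, (1 - s ^ 2) ^ μ * f' x s) x := by
  refine (intervalIntegral.hasDerivAt_integral_of_dominated_loc_of_deriv_le
    (F := fun y s => (1 - s ^ 2) ^ μ * f y s) (F' := fun y s => (1 - s ^ 2) ^ μ * f' y s)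
    (bound := fun s => (1 - s ^ 2) ^ μ) Filter.univ_mem
    (Filter.Eventually.of_forall fun y => ?_) (intervalIntegrable_weight_mul hμ (hf x)) ?_ ?_
    (intervalIntegrable_one_sub_sq_rpow hμ) ?_).2
  · rw [uIoc_of_le (by norm_num)]
    exact (intervalIntegrable_weight_mul hμ (hf y)).1.aestronglyMeasurable
  · rw [uIoc_of_le (by norm_num)]
    exact (intervalIntegrable_weight_mul hμ (hf' x)).1.aestronglyMeasurable
  · refine Filter.Eventually.of_forall fun s hs y _ => ?_
    rw [uIoc_of_le (by norm_num)] at hs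
    have h0 := one_sub_sq_rpow_nonneg μ hs
    rw [norm_mul, Real.norm_of_nonneg h0]
    exact mul_le_of_le_one_right h0 (hb y s hs)
  · exact Filter.Eventually.of_forall fun s _ y _ => (hd y s).const_mul _

lemma hasDerivAt_poissonInt {μ : ℝ} (hμ : -1 < μ) (x : ℝ) :
    HasDerivAt (poissonInt μ) (poissonInt' μ x) x := by
  refine hasDerivAt_weight_integral hμ (f := fun x s => Real.cos (x * s))
    (f' := fun x s => -s * Real.sin (x * s)) (fun x => by fun_prop) (fun x => by fun_prop)
    (fun x s => ?_) (fun x s hs => ?_) x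
  · have := ((hasDerivAt_id x).mul_const s).cos
    refine this.congr_deriv ?_
    simp; ring
  · rw [abs_mul, abs_neg]
    exact mul_le_one₀ (abs_le.2 ⟨hs.1.le, hs.2⟩) (abs_nonneg _) (Real.abs_sin_le_one _)

lemma hasDerivAt_poissonInt' {μ : ℝ} (hμ : -1 < μ) (x : ℝ) :
    HasDerivAt (poissonInt' μ) (poissonInt'' μ x) x := by
  refine hasDerivAt_weight_integral hμ (f := fun x s => -s * Real.sin (x * s))
    (f' := fun x s => -s ^ 2 * Real.cos (x * s)) (fun x => by fun_prop) (fun x => by fun_prop)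
    (fun x s => ?_) (fun x s hs => ?_) x
  · have := (((hasDerivAt_id x).mul_const s).sin).const_mul (-s)
    refine this.congr_deriv ?_
    simp; ring
  · rw [abs_mul, abs_neg, abs_of_nonneg (sq_nonneg s)]
    exact mul_le_one₀ (by nlinarith [hs.1, hs.2]) (abs_nonneg _) (Real.abs_cos_le_one _)

/-- Bessel's equation for `poissonInt μ`. -/
lemma poissonInt_ode {μ : ℝ} (hμ : -1 < μ) (x : ℝ) :
    x * (poissonInt'' μ x + poissonInt μ x) = -(2 * (μ + 1)) * poissonInt' μ x := by
  have hi : ∀ {f : ℝ → ℝ}, Continuous f →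
    IntervalIntegrable (fun s : ℝ => (1 - s ^ 2) ^ μ * f s) volume (-1) 1 :=
    fun hf => intervalIntegrable_weight_mul hμ hf
  have key : ∫ s in (-1 : ℝ)..1, (1 - s ^ 2) ^ μ *
      (2 * (μ + 1) * (-s * Real.sin (x * s)) + x * (-s ^ 2 * Real.cos (x * s) + Real.cos (x * s)))
      = 0 := by
    -- The integrand is the derivative in `s` of `(1 - s²)^(μ+1) sin (x s)`, which vanishes at `±1`
    -- because `μ + 1 > 0`.
    have := intervalIntegral.integral_eq_sub_of_hasDerivAt_of_le (a := -1) (b := 1)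
      (f := fun s => (1 - s ^ 2) ^ (μ + 1) * Real.sin (x * s))
      (f' := fun s => (1 - s ^ 2) ^ μ *
        (2 * (μ + 1) * (-s * Real.sin (x * s)) +
          x * (-s ^ 2 * Real.cos (x * s) + Real.cos (x * s))))
      (by norm_num) ?_ ?_ (hi (by fun_prop))
    · rw [this]
      norm_num [Real.zero_rpow (by linarith : μ + 1 ≠ 0)]
    · refine ContinuousOn.mul ?_ (by fun_prop)
      exact ContinuousOn.rpow_const (by fun_prop) fun s _ => Or.inr (by linarith)
    · intro s hs
      have h1 : 0 < 1 - s ^ 2 := by nlinarith [hs.1, hs.2]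
      have hd1 : HasDerivAt (fun s : ℝ => 1 - s ^ 2) (-(2 * s)) s := by
        simpa using ((hasDerivAt_id s).pow 2).const_sub 1
      have hd2 : HasDerivAt (fun s : ℝ => Real.sin (x * s)) (Real.cos (x * s) * x) s := by
        simpa using ((hasDerivAt_id s).const_mul x).sin
      refine ((hd1.rpow_const (p := μ + 1) (Or.inl h1.ne')).mul hd2).congr_deriv ?_
      rw [add_sub_cancel_right, Real.rpow_add h1, Real.rpow_one]
      ring
  have e : ∀ s : ℝ, (1 - s ^ 2) ^ μ *
      (2 * (μ + 1) * (-s * Real.sin (x * s)) + x * (-s ^ 2 * Real.cos (x * s) + Real.cos (x * s)))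
      = 2 * (μ + 1) * ((1 - s ^ 2) ^ μ * (-s * Real.sin (x * s))) +
        (x * ((1 - s ^ 2) ^ μ * (-s ^ 2 * Real.cos (x * s))) +
          x * ((1 - s ^ 2) ^ μ * Real.cos (x * s))) := fun s => by ring
  simp only [e] at key
  rw [intervalIntegral.integral_add ((hi (by fun_prop)).const_mul _)
      (((hi (by fun_prop)).const_mul _).add ((hi (by fun_prop)).const_mul _)),
    intervalIntegral.integral_add ((hi (by fun_prop)).const_mul _) ((hi (by fun_prop)).const_mul _),
    intervalIntegral.integral_const_mul, intervalIntegral.integral_const_mul,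
    intervalIntegral.integral_const_mul] at key
  simp only [poissonInt, poissonInt', poissonInt'']
  linarith

/-! ### Normal form of Bessel's equation, energy estimates and decay. -/

/-- `x^{μ+1} poissonInt μ x`, a multiple of `√x J_{μ+1/2}(x)`. -/
noncomputable def besselNormal (μ x : ℝ) : ℝ := x ^ (μ + 1) * poissonInt μ x

/-- The derivative of `besselNormal μ` on `(0, ∞)`. -/
noncomputable def besselNormal' (μ x : ℝ) : ℝ :=
  (μ + 1) * x ^ μ * poissonInt μ x + x ^ (μ + 1) * poissonInt' μ x

lemma hasDerivAt_besselNormal {μ : ℝ} (hμ : -1 < μ) {x : ℝ} (hx : 0 < x) :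
    HasDerivAt (besselNormal μ) (besselNormal' μ x) x := by
  have h := (Real.hasDerivAt_rpow_const (p := μ + 1) (Or.inl hx.ne')).mul (hasDerivAt_poissonInt hμ x)
  refine h.congr_deriv ?_
  simp [besselNormal']

/-- The factor `x^(μ+1)` is chosen to cancel the first-order term: `w'' + (1 - μ(μ+1)/x²) w = 0`.
The energy estimate and the Sturm comparison both rest on this form. -/
lemma hasDerivAt_besselNormal' {μ : ℝ} (hμ : -1 < μ) {x : ℝ} (hx : 0 < x) :
    HasDerivAt (besselNormal' μ) (-(1 - μ * (μ + 1) / x ^ 2) * besselNormal μ x) x := by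
  have h1 := ((Real.hasDerivAt_rpow_const (p := μ) (Or.inl hx.ne')).const_mul (μ + 1)).mul
    (hasDerivAt_poissonInt hμ x)
  have h2 := (Real.hasDerivAt_rpow_const (p := μ + 1) (Or.inl hx.ne')).mul
    (hasDerivAt_poissonInt' hμ x)
  refine (h1.add h2).congr_deriv ?_
  have ode := poissonInt_ode hμ x
  have e1 : x ^ (μ + 1) = x ^ μ * x := by rw [Real.rpow_add hx, Real.rpow_one]
  have e2 : x ^ (μ - 1) = x ^ μ / x := by rw [Real.rpow_sub hx, Real.rpow_one]
  rw [add_sub_cancel_right, besselNormal, e1, e2]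
  have e3 : poissonInt'' μ x = -(2 * (μ + 1)) * poissonInt' μ x / x - poissonInt μ x := by
    field_simp; linarith
  rw [e3]
  field_simp
  ring

lemma continuous_poissonInt {μ : ℝ} (hμ : -1 < μ) : Continuous (poissonInt μ) :=
  continuous_iff_continuousAt.2 fun x => (hasDerivAt_poissonInt hμ x).continuousAt

lemma continuous_besselNormal {μ : ℝ} (hμ : -1 < μ) : Continuous (besselNormal μ) :=
  (Real.continuous_rpow_const (by linarith)).mul (continuous_poissonInt hμ)

lemma poissonInt_zero_pos {μ : ℝ} (hμ : -1 < μ) : 0 < poissonInt μ 0 := by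
  simp only [poissonInt, zero_mul, Real.cos_zero, mul_one]
  refine intervalIntegral.intervalIntegral_pos_of_pos_on (intervalIntegrable_one_sub_sq_rpow hμ)
    (fun s hs => Real.rpow_pos_of_pos (by nlinarith [hs.1, hs.2]) _) (by norm_num)

lemma abs_poissonInt_le {μ : ℝ} (hμ : -1 < μ) (x : ℝ) : |poissonInt μ x| ≤ poissonInt μ 0 := by
  have := intervalIntegral.norm_integral_le_of_norm_le (a := -1) (b := 1) (μ := volume)
    (f := fun s => (1 - s ^ 2) ^ μ * Real.cos (x * s)) (g := fun s => (1 - s ^ 2) ^ μ)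
    (by norm_num) (Filter.Eventually.of_forall fun s hs => ?_)
    (intervalIntegrable_one_sub_sq_rpow hμ)
  · simpa [poissonInt] using this
  · have h0 := one_sub_sq_rpow_nonneg μ hs
    rw [norm_mul, Real.norm_of_nonneg h0]
    exact mul_le_of_le_one_right h0 (Real.abs_cos_le_one _)

lemma half_poissonInt_zero_le {μ : ℝ} (hμ : -1 < μ) {x : ℝ} (hx : x ∈ Icc (0 : ℝ) 1) :
    poissonInt μ 0 / 2 ≤ poissonInt μ x := by
  have := intervalIntegral.integral_mono_on (a := -1) (b := 1) (by norm_num)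
    ((intervalIntegrable_one_sub_sq_rpow hμ).mul_const (1 / 2))
    (intervalIntegrable_weight_mul hμ (f := fun s => Real.cos (x * s)) (by fun_prop))
    (fun s hs => ?_)
  · rw [intervalIntegral.integral_mul_const] at this
    simp only [poissonInt, zero_mul, Real.cos_zero, mul_one] at this ⊢
    linarith
  · refine mul_le_mul_of_nonneg_left ?_ (Real.rpow_nonneg (by nlinarith [hs.1, hs.2]) _)
    have h1 := Real.one_sub_sq_div_two_le_cos (x := x * s)
    have h2 : s ^ 2 ≤ 1 := by nlinarith [hs.1, hs.2]
    have h3 : x ^ 2 ≤ 1 := by nlinarith [hx.1, hx.2]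
    have h4 : (x * s) ^ 2 ≤ 1 := by rw [mul_pow]; exact mul_le_one₀ h3 (sq_nonneg s) h2
    linarith

lemma besselNormal_zero {μ : ℝ} (hμ : -1 < μ) : besselNormal μ 0 = 0 := by
  simp [besselNormal, Real.zero_rpow (by linarith : μ + 1 ≠ 0)]

lemma besselNormal_pos {μ : ℝ} (hμ : -1 < μ) {x : ℝ} (hx : x ∈ Ioc (0 : ℝ) 1) :
    0 < besselNormal μ x := by
  have := half_poissonInt_zero_le hμ ⟨hx.1.le, hx.2⟩
  have := poissonInt_zero_pos hμ
  exact mul_pos (Real.rpow_pos_of_pos hx.1 _) (by linarith)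

/-- The energy of `besselNormal μ`. -/
noncomputable def besselEnergy (μ x : ℝ) : ℝ := besselNormal μ x ^ 2 + besselNormal' μ x ^ 2

/-- The equation `w'' = -w` would conserve the energy, so only the potential `μ(μ+1)/x²`
contributes. -/
lemma hasDerivAt_besselEnergy {μ : ℝ} (hμ : -1 < μ) {x : ℝ} (hx : 0 < x) :
    HasDerivAt (besselEnergy μ)
      (2 * besselNormal μ x * besselNormal' μ x * (μ * (μ + 1) / x ^ 2)) x := by
  have h := ((hasDerivAt_besselNormal hμ hx).pow 2).add ((hasDerivAt_besselNormal' hμ hx).pow 2)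
  refine h.congr_deriv ?_
  simp; ring

lemma abs_deriv_besselEnergy_le (μ x : ℝ) :
    |2 * besselNormal μ x * besselNormal' μ x * (μ * (μ + 1) / x ^ 2)| ≤
      |μ * (μ + 1)| / x ^ 2 * besselEnergy μ x := by
  rw [abs_mul, abs_div, abs_of_nonneg (sq_nonneg x), mul_comm]
  refine mul_le_mul_of_nonneg_left ?_ (by positivity)
  rw [besselEnergy, abs_le]
  constructor <;> nlinarith [sq_nonneg (besselNormal μ x + besselNormal' μ x),
    sq_nonneg (besselNormal μ x - besselNormal' μ x)]

lemma hasDerivAt_exp_div (c : ℝ) {x : ℝ} (hx : 0 < x) :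
    HasDerivAt (fun y => Real.exp (c / y)) (-(c / x ^ 2) * Real.exp (c / x)) x := by
  have := ((hasDerivAt_inv hx.ne').const_mul c).exp
  simp only [← div_eq_mul_inv] at this
  refine this.congr_deriv ?_
  field_simp

/-- From `|E'| ≤ c E / x²` with `c = |μ(μ+1)|`, Grönwall's argument makes `E exp(c/x)` decreasing,
which bounds the energy on `[1, ∞)`. The companion with `-c` bounds it from below. -/
lemma antitoneOn_besselEnergy {μ : ℝ} (hμ : -1 < μ) :
    AntitoneOn (fun x => besselEnergy μ x * Real.exp (|μ * (μ + 1)| / x)) (Ioi 0) := by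
  have hd : ∀ x ∈ Ioi (0 : ℝ), HasDerivAt
      (fun x => besselEnergy μ x * Real.exp (|μ * (μ + 1)| / x)) _ x :=
    fun x hx => (hasDerivAt_besselEnergy hμ hx).mul (hasDerivAt_exp_div (|μ * (μ + 1)|) hx)
  refine antitoneOn_of_deriv_nonpos (convex_Ioi 0)
    (fun x hx => (hd x hx).continuousAt.continuousWithinAt)
    (fun x hx => (hd x (by simpa using hx)).differentiableAt.differentiableWithinAt) fun x hx => ?_
  rw [interior_Ioi] at hx
  rw [(hd x hx).deriv]
  have h := (abs_le.1 (abs_deriv_besselEnergy_le μ x)).2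
  have he := Real.exp_pos (|μ * (μ + 1)| / x)
  nlinarith

lemma monotoneOn_besselEnergy {μ : ℝ} (hμ : -1 < μ) :
    MonotoneOn (fun x => besselEnergy μ x * Real.exp ((-|μ * (μ + 1)|) / x)) (Ioi 0) := by
  have hd : ∀ x ∈ Ioi (0 : ℝ), HasDerivAt
      (fun x => besselEnergy μ x * Real.exp ((-|μ * (μ + 1)|) / x)) _ x :=
    fun x hx => (hasDerivAt_besselEnergy hμ hx).mul (hasDerivAt_exp_div (-|μ * (μ + 1)|) hx)
  refine monotoneOn_of_deriv_nonneg (convex_Ioi 0)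
    (fun x hx => (hd x hx).continuousAt.continuousWithinAt)
    (fun x hx => (hd x (by simpa using hx)).differentiableAt.differentiableWithinAt) fun x hx => ?_
  rw [interior_Ioi] at hx
  rw [(hd x hx).deriv]
  have h := (abs_le.1 (abs_deriv_besselEnergy_le μ x)).1
  have he := Real.exp_pos ((-|μ * (μ + 1)|) / x)
  have e : -(-|μ * (μ + 1)| / x ^ 2) = |μ * (μ + 1)| / x ^ 2 := by ring
  rw [e]
  nlinarith

/-- Positivity propagates to the right from `min x 1`, where `besselNormal μ` itself is positive. -/
lemma besselEnergy_pos {μ : ℝ} (hμ : -1 < μ) {x : ℝ} (hx : 0 < x) : 0 < besselEnergy μ x := by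
  have hm : 0 < min x 1 := lt_min hx one_pos
  have h := monotoneOn_besselEnergy hμ hm hx (min_le_left x 1)
  have h1 : 0 < besselEnergy μ (min x 1) := by
    have := besselNormal_pos hμ (x := min x 1) ⟨hm, min_le_right _ _⟩
    have := sq_nonneg (besselNormal' μ (min x 1))
    unfold besselEnergy
    positivity
  have h2 : 0 < besselEnergy μ x * Real.exp ((-|μ * (μ + 1)|) / x) :=
    lt_of_lt_of_le (mul_pos h1 (Real.exp_pos _)) h
  exact pos_of_mul_pos_left h2 (Real.exp_pos _).le

/-- Zeros of `besselNormal μ` are simple. -/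
lemma besselNormal'_ne_zero {μ : ℝ} (hμ : -1 < μ) {x : ℝ} (hx : 0 < x) (h : besselNormal μ x = 0) :
    besselNormal' μ x ≠ 0 := by
  intro h'
  have := besselEnergy_pos hμ hx
  simp [besselEnergy, h, h'] at this

lemma exists_abs_besselNormal_le {μ : ℝ} (hμ : -1 < μ) :
    ∃ C, ∀ x, 1 ≤ x → |besselNormal μ x| ≤ C := by
  refine ⟨Real.sqrt (besselEnergy μ 1 * Real.exp (|μ * (μ + 1)| / 1)), fun x hx => ?_⟩
  have hx0 : 0 < x := by linarith
  have h := antitoneOn_besselEnergy hμ (mem_Ioi.2 one_pos) (mem_Ioi.2 hx0) hx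
  refine Real.abs_le_sqrt (le_trans ?_ h)
  have h1 : 1 ≤ Real.exp (|μ * (μ + 1)| / x) := Real.one_le_exp (by positivity)
  have h2 : 0 ≤ besselEnergy μ x := (besselEnergy_pos hμ hx0).le
  calc _ ≤ besselEnergy μ x := by unfold besselEnergy; nlinarith [sq_nonneg (besselNormal' μ x)]
    _ ≤ _ := le_mul_of_one_le_right h2 h1

/-- Decay of the Poisson integral. -/
lemma exists_abs_poissonInt_le {μ : ℝ} (hμ : -1 < μ) :
    ∃ C, 0 ≤ C ∧ ∀ x, 0 ≤ x → |poissonInt μ x| ≤ C * (1 + x) ^ (-(μ + 1)) := by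
  obtain ⟨C, hC⟩ := exists_abs_besselNormal_le hμ
  have hC0 : 0 ≤ C := (abs_nonneg _).trans (hC 1 le_rfl)
  have h2 : (0 : ℝ) < 2 ^ (μ + 1) := by positivity
  have hM := poissonInt_zero_pos hμ
  refine ⟨(C + poissonInt μ 0) * 2 ^ (μ + 1), by positivity, fun x hx => ?_⟩
  -- Used with `y = 1` when `x ≤ 1` and with `y = x` when `x ≥ 1`; this is the origin of the factor
  -- `2^(μ+1)`.
  have key : ∀ D : ℝ, 0 ≤ D → ∀ y, 0 < y → 1 + x ≤ 2 * y →
      D * y ^ (-(μ + 1)) ≤ D * 2 ^ (μ + 1) * (1 + x) ^ (-(μ + 1)) := by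
    intro D hD y hy h
    rw [mul_assoc]
    refine mul_le_mul_of_nonneg_left ?_ hD
    have h3 : (2 * y) ^ (-(μ + 1)) ≤ (1 + x) ^ (-(μ + 1)) :=
      Real.rpow_le_rpow_of_nonpos (by linarith) h (by linarith)
    rw [Real.mul_rpow (by norm_num) hy.le] at h3
    calc y ^ (-(μ + 1)) = 2 ^ (μ + 1) * (2 ^ (-(μ + 1)) * y ^ (-(μ + 1))) := by
          rw [← mul_assoc, ← Real.rpow_add (by norm_num)]; simp
      _ ≤ _ := mul_le_mul_of_nonneg_left h3 h2.le
  have h0 : 0 ≤ (1 + x) ^ (-(μ + 1)) := Real.rpow_nonneg (by linarith) _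
  rcases le_total x 1 with h1 | h1
  · have := key _ hM.le 1 one_pos (by linarith)
    rw [Real.one_rpow, mul_one] at this
    refine (abs_poissonInt_le hμ x).trans (this.trans ?_)
    gcongr
    linarith
  · have hx0 : 0 < x := by linarith
    have e : poissonInt μ x = besselNormal μ x * x ^ (-(μ + 1)) := by
      rw [besselNormal, mul_right_comm, ← Real.rpow_add hx0]; simp
    rw [e, abs_mul, abs_of_pos (Real.rpow_pos_of_pos hx0 _)]
    calc _ ≤ C * x ^ (-(μ + 1)) :=
          mul_le_mul_of_nonneg_right (hC x h1) (Real.rpow_nonneg hx0.le _)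
      _ ≤ _ := key C hC0 x hx0 (by linarith)
      _ ≤ _ := by gcongr; linarith

/-! ### Sturm comparison and positivity of integrals of Bessel functions. -/

open Filter Topology in
/-- Sturm comparison of `besselNormal μ` with its reflection about a zero. -/
lemma neg_besselNormal_add_le_of_pos {μ : ℝ} (hμ : 0 ≤ μ) {a T : ℝ} (hT : T ≤ a)
    (ha : besselNormal μ a = 0) (hneg : ∀ s ∈ Ioo 0 T, besselNormal μ (a + s) < 0)
    (hpos : ∀ s ∈ Ioo 0 T, 0 < besselNormal μ (a - s)) :
    ∀ s ∈ Ioo 0 T, -besselNormal μ (a + s) ≤ besselNormal μ (a - s) := by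
  intro s₀ hs₀
  have hμ1 : -1 < μ := by linarith
  have ha0 : 0 < a := by linarith [hs₀.1, hs₀.2]
  have hne := besselNormal'_ne_zero hμ1 ha0 ha
  have hp : ∀ s ∈ Ico 0 T, HasDerivAt (fun s => besselNormal μ (a - s)) (-besselNormal' μ (a - s)) s := by
    intro s hs
    have := (hasDerivAt_besselNormal hμ1 (x := a - s) (by linarith [hs.2])).comp_const_sub a s
    simpa using this
  have hv : ∀ s ∈ Ico 0 T, HasDerivAt (fun s => besselNormal μ (a + s)) (besselNormal' μ (a + s)) s := by
    intro s hs
    have := (hasDerivAt_besselNormal hμ1 (x := a + s) (by linarith [hs.1])).comp_const_add a s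
    simpa using this
  have hp' : ∀ s ∈ Ico 0 T, HasDerivAt (fun s => besselNormal' μ (a - s))
      ((1 - μ * (μ + 1) / (a - s) ^ 2) * besselNormal μ (a - s)) s := by
    intro s hs
    have := (hasDerivAt_besselNormal' hμ1 (x := a - s) (by linarith [hs.2])).comp_const_sub a s
    refine this.congr_deriv ?_
    ring
  have hv' : ∀ s ∈ Ico 0 T, HasDerivAt (fun s => besselNormal' μ (a + s))
      (-(1 - μ * (μ + 1) / (a + s) ^ 2) * besselNormal μ (a + s)) s := by
    intro s hs
    have := (hasDerivAt_besselNormal' hμ1 (x := a + s) (by linarith [hs.1])).comp_const_add a s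
    simpa using this
  -- the Wronskian of the two reflections
  set W : ℝ → ℝ := fun s => -(besselNormal μ (a - s) * besselNormal' μ (a + s)) -
    besselNormal' μ (a - s) * besselNormal μ (a + s) with hW
  have hWd : ∀ s ∈ Ico 0 T, HasDerivAt W
      (μ * (μ + 1) * (1 / (a - s) ^ 2 - 1 / (a + s) ^ 2) *
        (besselNormal μ (a - s) * besselNormal μ (a + s))) s := by
    intro s hs
    refine ((((hp s hs).mul (hv' s hs)).neg).sub ((hp' s hs).mul (hv s hs))).congr_deriv ?_
    ring
  -- The potential is larger on the side nearer to the origin, and the two reflections have opposite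
  -- signs, so `W' ≤ 0`.
  have hWanti : AntitoneOn W (Ico 0 T) := by
    refine antitoneOn_of_deriv_nonpos (convex_Ico 0 T)
      (fun s hs => (hWd s hs).continuousAt.continuousWithinAt) (fun s hs => ?_) fun s hs => ?_
    · rw [interior_Ico] at hs
      exact (hWd s ⟨hs.1.le, hs.2⟩).differentiableAt.differentiableWithinAt
    · rw [interior_Ico] at hs
      rw [(hWd s ⟨hs.1.le, hs.2⟩).deriv]
      have h1 : 0 < a - s := by linarith [hs.2]
      have h2 : 1 / (a + s) ^ 2 ≤ 1 / (a - s) ^ 2 := by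
        apply one_div_le_one_div_of_le (by positivity)
        exact pow_le_pow_left₀ h1.le (by linarith [hs.1]) 2
      have h3 := mul_neg_of_pos_of_neg (hpos s hs) (hneg s hs)
      exact mul_nonpos_of_nonneg_of_nonpos (mul_nonneg (by positivity) (by linarith)) h3.le
  have hW0 : W 0 = 0 := by simp [hW, ha]
  -- `Q' = W / w(a - s)² ≤ 0`, and `Q` tends to `1` at `0` because the two reflections leave the
  -- simple zero with opposite slopes.
  set Q : ℝ → ℝ := fun s => -besselNormal μ (a + s) / besselNormal μ (a - s) with hQ
  have hQd : ∀ s ∈ Ioo 0 T, HasDerivAt Q (W s / besselNormal μ (a - s) ^ 2) s := by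
    intro s hs
    have hs' : s ∈ Ico 0 T := ⟨hs.1.le, hs.2⟩
    refine ((hv s hs').neg.div (hp s hs') (hpos s hs).ne').congr_deriv ?_
    simp only [hW, Pi.neg_apply]
    ring
  have hQanti : AntitoneOn Q (Ioo 0 T) := by
    refine antitoneOn_of_deriv_nonpos (convex_Ioo 0 T)
      (fun s hs => (hQd s hs).continuousAt.continuousWithinAt) (fun s hs => ?_) fun s hs => ?_
    · rw [interior_Ioo] at hs
      exact (hQd s hs).differentiableAt.differentiableWithinAt
    · rw [interior_Ioo] at hs
      rw [(hQd s hs).deriv]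
      have := hWanti (left_mem_Ico.2 (by linarith [hs.1, hs.2] : (0 : ℝ) < T)) ⟨hs.1.le, hs.2⟩ hs.1.le
      rw [hW0] at this
      exact div_nonpos_of_nonpos_of_nonneg this (sq_nonneg _)
  have hT0 : 0 < T := hs₀.1.trans hs₀.2
  have hlim : Tendsto Q (𝓝[>] 0) (𝓝 1) := by
    have h1 := (hv 0 ⟨le_rfl, hT0⟩).tendsto_slope_zero_right
    have h2 := (hp 0 ⟨le_rfl, hT0⟩).tendsto_slope_zero_right
    simp only [add_zero, sub_zero, ha, zero_add] at h1 h2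
    have h3 := h1.neg.div h2 (neg_ne_zero.2 hne)
    rw [div_self (neg_ne_zero.2 hne)] at h3
    refine h3.congr' ?_
    filter_upwards [self_mem_nhdsWithin] with s hs
    have hs' : s ≠ 0 := ne_of_gt hs
    simp only [smul_eq_mul, hQ, Pi.div_apply]
    field_simp
  have hle : Q s₀ ≤ 1 := by
    refine ge_of_tendsto hlim ?_
    filter_upwards [Ioo_mem_nhdsGT hs₀.1] with s hs
    exact hQanti ⟨hs.1, hs.2.trans hs₀.2⟩ hs₀ hs.2.le
  exact (div_le_one (hpos s₀ hs₀)).1 hle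

open Filter Topology in
-- Zeros are simple, so `w > 0` just to the left of `a`. At the first `s₁` with `w(a - s₁) ≤ 0`,
-- comparison on `(0, s₁)` and continuity would give `0 < -w(a + s₁) ≤ w(a - s₁) ≤ 0`.
lemma besselNormal_sub_pos {μ : ℝ} (hμ : 0 ≤ μ) {a L : ℝ} (hL : L ≤ a)
    (ha : besselNormal μ a = 0) (hneg : ∀ s ∈ Ioo 0 L, besselNormal μ (a + s) < 0) :
    ∀ s ∈ Ioo 0 L, 0 < besselNormal μ (a - s) := by
  have hμ1 : -1 < μ := by linarith
  have hc := continuous_besselNormal hμ1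
  by_contra! hcon
  obtain ⟨s₀, hs₀, hs₀'⟩ := hcon
  have hL0 : 0 < L := hs₀.1.trans hs₀.2
  have ha0 : 0 < a := by linarith
  have hd := hasDerivAt_besselNormal hμ1 ha0
  have hne := besselNormal'_ne_zero hμ1 ha0 ha
  have hd' : besselNormal' μ a < 0 := by
    refine lt_of_le_of_ne ?_ hne
    have h1 := hd.tendsto_slope_zero_right
    refine le_of_tendsto h1 ?_
    filter_upwards [Ioo_mem_nhdsGT hL0] with s hs
    rw [ha, sub_zero]
    exact mul_nonpos_of_nonneg_of_nonpos (inv_nonneg.2 hs.1.le) (hneg s hs).le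
  have hnear : ∀ᶠ s in 𝓝[>] (0 : ℝ), 0 < besselNormal μ (a - s) := by
    have h1 : HasDerivAt (fun s => besselNormal μ (a - s)) (-besselNormal' μ a) 0 := by
      have := (hasDerivAt_besselNormal hμ1 (x := a - 0) (by simpa using ha0)).comp_const_sub a 0
      simpa using this
    have h2 := h1.tendsto_slope_zero_right
    filter_upwards [h2.eventually (lt_mem_nhds (neg_pos.2 hd')), self_mem_nhdsWithin] with s hs hs'
    simp only [zero_add, sub_zero, ha, smul_eq_mul] at hs
    exact pos_of_mul_pos_right hs (inv_nonneg.2 (le_of_lt hs'))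
  obtain ⟨δ, hδ, hδ'⟩ := (mem_nhdsGT_iff_exists_Ioo_subset).1 hnear
  have hδ0 : (0 : ℝ) < δ := hδ
  have hs₀δ : δ ≤ s₀ := by
    by_contra! h
    exact absurd (hδ' ⟨hs₀.1, h⟩) (not_lt.2 hs₀')
  have hK : IsCompact (Icc δ s₀ ∩ {s | besselNormal μ (a - s) ≤ 0}) :=
    isCompact_Icc.inter_right (isClosed_le (by fun_prop) continuous_const)
  obtain ⟨s₁, hs₁, hmin⟩ := hK.exists_isLeast ⟨s₀, ⟨hs₀δ, le_rfl⟩, hs₀'⟩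
  have hs₁L : s₁ < L := hs₁.1.2.trans_lt hs₀.2
  have hs₁0 : 0 < s₁ := hδ0.trans_le hs₁.1.1
  have hpos : ∀ s ∈ Ioo 0 s₁, 0 < besselNormal μ (a - s) := by
    intro s hs
    rcases lt_or_ge s δ with h | h
    · exact hδ' ⟨hs.1, h⟩
    · by_contra! h'
      exact absurd (hmin ⟨⟨h, hs.2.le.trans hs₁.1.2⟩, h'⟩) (not_le.2 hs.2)
  have hle := neg_besselNormal_add_le_of_pos hμ (hs₁L.le.trans hL) ha
    (fun s hs => hneg s ⟨hs.1, hs.2.trans hs₁L⟩) hpos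
  have h1 : -besselNormal μ (a + s₁) ≤ besselNormal μ (a - s₁) := by
    have hcl : s₁ ∈ closure (Ioo 0 s₁) := by
      rw [closure_Ioo hs₁0.ne]; exact ⟨hs₁0.le, le_rfl⟩
    exact closure_minimal (s := Ioo 0 s₁)
      (t := {s | -besselNormal μ (a + s) ≤ besselNormal μ (a - s)}) hle
      (isClosed_le (by fun_prop) (by fun_prop)) hcl
  have h2 := hneg s₁ ⟨hs₁0, hs₁L⟩
  have h3 : besselNormal μ (a - s₁) ≤ 0 := hs₁.2
  linarith

lemma neg_besselNormal_add_le {μ : ℝ} (hμ : 0 ≤ μ) {a L : ℝ} (hL0 : 0 < L) (hL : L ≤ a)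
    (ha : besselNormal μ a = 0) (hneg : ∀ s ∈ Ioo 0 L, besselNormal μ (a + s) < 0) :
    ∀ s ∈ Icc 0 L, -besselNormal μ (a + s) ≤ besselNormal μ (a - s) := by
  have hc := continuous_besselNormal (μ := μ) (by linarith)
  have h := neg_besselNormal_add_le_of_pos hμ hL ha hneg (besselNormal_sub_pos hμ hL ha hneg)
  intro s hs
  rw [← closure_Ioo hL0.ne] at hs
  exact closure_minimal (s := Ioo 0 L)
    (t := {s | -besselNormal μ (a + s) ≤ besselNormal μ (a - s)}) h
    (isClosed_le (by fun_prop) (by fun_prop)) hs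

open Filter Topology in
/-- The primitive of `√x J_ν(x)` vanishing at `0` is nonnegative on `[0, ∞)` for `ν ≥ 1/2`. -/
lemma integral_besselNormal_nonneg {μ : ℝ} (hμ : 0 ≤ μ) {x : ℝ} (hx : 0 ≤ x) :
    0 ≤ ∫ t in (0 : ℝ)..x, besselNormal μ t := by
  have hμ1 : -1 < μ := by linarith
  have hc := continuous_besselNormal hμ1
  set U : ℝ → ℝ := fun x => ∫ t in (0 : ℝ)..x, besselNormal μ t with hU
  have hUd : ∀ x, HasDerivAt U (besselNormal μ x) x := fun x =>
    intervalIntegral.integral_hasDerivAt_right (hc.intervalIntegrable _ _)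
      (hc.stronglyMeasurableAtFilter _ _) hc.continuousAt
  have hUc : Continuous U := continuous_iff_continuousAt.2 fun x => (hUd x).continuousAt
  have hU0 : U 0 = 0 := by simp [hU]
  change 0 ≤ U x
  by_contra! hneg
  -- The point `y` below is the first minimum point of `U` on `[0, x]`. The contradiction will be an
  -- earlier point where `U` is no larger than `U y`.
  obtain ⟨z, hz, hzmin⟩ := (isCompact_Icc (a := (0 : ℝ)) (b := x)).exists_isMinOn
    ⟨0, le_rfl, hx⟩ hUc.continuousOn
  have hK : IsCompact (Icc 0 x ∩ {y | U y = U z}) :=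
    isCompact_Icc.inter_right (isClosed_eq hUc continuous_const)
  obtain ⟨y, hy, hymin⟩ := hK.exists_isLeast ⟨z, hz, rfl⟩
  have hyx : ∀ t ∈ Icc 0 x, U y ≤ U t := fun t ht => by
    rw [show U y = U z from hy.2]; exact hzmin ht
  have hUy : U y < 0 := (hyx x ⟨hx, le_rfl⟩).trans_lt hneg
  have hy0 : 0 < y := lt_of_le_of_ne hy.1.1 (fun h => by rw [← h, hU0] at hUy; exact lt_irrefl _ hUy)
  have hfirst : ∀ t ∈ Ico 0 y, U y < U t := by
    intro t ht
    have htx : t ∈ Icc 0 x := ⟨ht.1, ht.2.le.trans hy.1.2⟩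
    refine lt_of_le_of_ne (hyx t htx) fun h => ?_
    exact absurd (hymin ⟨htx, by rw [mem_ofPred_eq, ← h]; exact hy.2⟩) (not_le.2 ht.2)
  -- `besselNormal μ` has a strict sign immediately to the left of `y`
  have hsign : (∀ᶠ t in 𝓝[<] y, besselNormal μ t < 0) ∨ ∀ᶠ t in 𝓝[<] y, 0 < besselNormal μ t := by
    rcases lt_trichotomy (besselNormal μ y) 0 with h | h | h
    · exact Or.inl (nhdsWithin_le_nhds (hc.continuousAt.eventually (gt_mem_nhds h)))
    · have hne := besselNormal'_ne_zero hμ1 hy0 h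
      have h1 := (hasDerivAt_iff_tendsto_slope_left_right.1 (hasDerivAt_besselNormal hμ1 hy0)).1
      rcases lt_or_gt_of_ne hne with h2 | h2
      · right
        filter_upwards [h1.eventually (gt_mem_nhds h2), self_mem_nhdsWithin] with t ht hty
        rw [slope_def_field, h, sub_zero, div_neg_iff] at ht
        rcases ht with ht | ht
        · exact ht.1
        · linarith [mem_Iio.1 hty]
      · left
        filter_upwards [h1.eventually (lt_mem_nhds h2), self_mem_nhdsWithin] with t ht hty
        rw [slope_def_field, h, sub_zero, div_pos_iff] at ht
        rcases ht with ht | ht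
        · linarith [mem_Iio.1 hty]
        · exact ht.1
    · exact Or.inr (nhdsWithin_le_nhds (hc.continuousAt.eventually (lt_mem_nhds h)))
  -- If `w` were positive just before `y`, then `U` would increase up to its minimum point.
  have hleft : ∀ᶠ t in 𝓝[<] y, besselNormal μ t < 0 := by
    refine hsign.resolve_right fun h => ?_
    obtain ⟨l, hl, hl'⟩ := (mem_nhdsLT_iff_exists_Ioo_subset).1 h
    have hl : l < y := hl
    set t := max l 0
    have ht : t < y := max_lt hl hy0
    have h1 := hfirst t ⟨le_max_right _ _, ht⟩
    have h2 : 0 ≤ ∫ s in t..y, besselNormal μ s := by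
      refine intervalIntegral.integral_nonneg_of_ae_restrict ht.le ?_
      rw [← Measure.restrict_congr_set Ioo_ae_eq_Icc]
      refine (ae_restrict_iff' measurableSet_Ioo).2 (Eventually.of_forall fun s hs => ?_)
      exact (le_of_lt (hl' ⟨(le_max_left _ _).trans_lt hs.1, hs.2⟩) : 0 ≤ besselNormal μ s)
    have h3 : U t + ∫ s in t..y, besselNormal μ s = U y :=
      intervalIntegral.integral_add_adjacent_intervals (hc.intervalIntegrable _ _)
        (hc.intervalIntegrable _ _)
    linarith
  obtain ⟨l, hl, hl'⟩ := (mem_nhdsLT_iff_exists_Ioo_subset).1 hleft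
  have hl : l < y := hl
  set t₁ := (max l 0 + y) / 2 with ht₁
  have hmax : max l 0 < y := max_lt hl hy0
  have ht₁0 : 0 < t₁ := by have := le_max_right l 0; rw [ht₁]; linarith
  have ht₁y : t₁ < y := by rw [ht₁]; linarith
  have ht₁l : l < t₁ := by have := le_max_left l 0; rw [ht₁]; linarith
  -- The point `a` starts the negative arch that reaches `y`: it is the last point before `y` with
  -- `w ≥ 0`.
  have hB : IsCompact (Icc 0 t₁ ∩ {t | 0 ≤ besselNormal μ t}) :=
    isCompact_Icc.inter_right (isClosed_le continuous_const hc)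
  obtain ⟨a, ha, hamax⟩ := hB.exists_isGreatest
    ⟨0, ⟨le_rfl, ht₁0.le⟩, (besselNormal_zero hμ1).ge⟩
  have hay : a < y := ha.1.2.trans_lt ht₁y
  have hneg' : ∀ t ∈ Ioo a y, besselNormal μ t < 0 := by
    intro t ht
    rcases le_or_gt t t₁ with h | h
    · by_contra! h'
      exact absurd (hamax ⟨⟨ha.1.1.trans ht.1.le, h⟩, h'⟩) (not_le.2 ht.1)
    · exact hl' ⟨ht₁l.trans h, ht.2⟩
  have ha_zero : besselNormal μ a = 0 := by
    refine le_antisymm ?_ ha.2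
    have hcl : a ∈ closure (Ioo a y) := by rw [closure_Ioo hay.ne]; exact ⟨le_rfl, hay.le⟩
    exact closure_minimal (s := Ioo a y) (t := {t | besselNormal μ t ≤ 0})
      (fun t ht => (hneg' t ht).le) (isClosed_le hc continuous_const) hcl
  have ha0 : 0 < a := by
    refine lt_of_le_of_ne ha.1.1 fun h => ?_
    have h1 : 0 < min 1 (y / 2) := lt_min one_pos (by linarith)
    have h2 := besselNormal_pos hμ1 (x := min 1 (y / 2)) ⟨h1, min_le_left _ _⟩
    have h3 := hneg' (min 1 (y / 2)) ⟨by rw [← h]; exact h1, (min_le_right _ _).trans_lt (by linarith)⟩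
    linarith
  -- The reflection stays in `[0, a]`: otherwise comparison at `s = a` gives `-w(2a) ≤ w(0) = 0`,
  -- whereas `w(2a) < 0`.
  have hLa : y - a ≤ a := by
    by_contra! hlt
    have h1 := neg_besselNormal_add_le hμ ha0 le_rfl ha_zero
      (fun s hs => hneg' (a + s) ⟨by linarith [hs.1], by linarith [hs.2]⟩) a ⟨ha0.le, le_rfl⟩
    rw [sub_self, besselNormal_zero hμ1] at h1
    have h2 := hneg' (a + a) ⟨by linarith, by linarith⟩
    linarith
  have hcmp := neg_besselNormal_add_le hμ (sub_pos.2 hay) hLa ha_zero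
    (fun s hs => hneg' (a + s) ⟨by linarith [hs.1], by linarith [hs.2]⟩)
  -- The loss of `U` on `[a, y]` is at most its gain on the reflected interval `[2a - y, a]`, so `U
  -- (2a - y) ≤ U y`.
  have hint : -(∫ s in (0 : ℝ)..(y - a), besselNormal μ (a + s)) ≤
      ∫ s in (0 : ℝ)..(y - a), besselNormal μ (a - s) := by
    rw [← intervalIntegral.integral_neg]
    exact intervalIntegral.integral_mono_on (sub_pos.2 hay).le
      ((by fun_prop : Continuous _).intervalIntegrable _ _)
      ((by fun_prop : Continuous _).intervalIntegrable _ _) hcmp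
  rw [intervalIntegral.integral_comp_add_left, intervalIntegral.integral_comp_sub_left] at hint
  simp only [add_zero, sub_zero, add_sub_cancel] at hint
  have h1 : U (a - (y - a)) + ∫ s in (a - (y - a))..a, besselNormal μ s = U a :=
    intervalIntegral.integral_add_adjacent_intervals (hc.intervalIntegrable _ _)
      (hc.intervalIntegrable _ _)
  have h2 : U a + ∫ s in a..y, besselNormal μ s = U y :=
    intervalIntegral.integral_add_adjacent_intervals (hc.intervalIntegrable _ _)
      (hc.intervalIntegrable _ _)
  have h3 := hfirst (a - (y - a)) ⟨by linarith, by linarith⟩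
  linarith

/-- Lower bound for `∫_0^x t^{k-1} poissonInt μ t dt`, uniform in `x`. -/
lemma exists_le_integral_pow_mul_poissonInt {μ : ℝ} (hμ : 0 ≤ μ) {k : ℕ} (hk : 1 ≤ k)
    (hkμ : (k : ℝ) - 2 < μ) :
    ∃ c, 0 < c ∧ ∀ x, 0 ≤ x →
      c * min (x ^ k) 1 ≤ ∫ t in (0 : ℝ)..x, t ^ (k - 1) * poissonInt μ t := by
  have hμ1 : -1 < μ := by linarith
  have hc := continuous_besselNormal hμ1
  have hcA := continuous_poissonInt hμ1
  have hM := poissonInt_zero_pos hμ1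
  have hH : Continuous (fun t : ℝ => t ^ (k - 1) * poissonInt μ t) := by fun_prop
  set U : ℝ → ℝ := fun x => ∫ t in (0 : ℝ)..x, besselNormal μ t with hU
  have hUd : ∀ x, HasDerivAt U (besselNormal μ x) x := fun x =>
    intervalIntegral.integral_hasDerivAt_right (hc.intervalIntegrable _ _)
      (hc.stronglyMeasurableAtFilter _ _) hc.continuousAt
  have hUc : Continuous U := continuous_iff_continuousAt.2 fun x => (hUd x).continuousAt
  set e : ℝ := μ + 2 - k with he
  have he0 : 0 < e := by linarith
  -- Since `t^(k-1) = t^(-e) t^(μ+1)`, this constant equals `∫₀¹ (t^(-e) - 1) w(t) dt`, which is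
  -- positive because `e > 0`.
  set c₁ : ℝ := (∫ t in (0 : ℝ)..1, t ^ (k - 1) * poissonInt μ t) - U 1 with hc₁
  have hpow : ∀ t : ℝ, 0 < t → t ^ (k - 1) = t ^ (-e) * t ^ (μ + 1) := by
    intro t ht
    rw [← Real.rpow_add ht, ← Real.rpow_natCast]
    congr 1
    rw [Nat.cast_sub hk, he]
    push_cast
    ring
  have hc₁0 : 0 < c₁ := by
    rw [hc₁, hU, ← intervalIntegral.integral_sub (hH.intervalIntegrable _ _)
      (hc.intervalIntegrable _ _)]
    refine intervalIntegral.intervalIntegral_pos_of_pos_on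
      ((hH.sub hc).intervalIntegrable _ _) (fun t ht => ?_) one_pos
    have h1 := half_poissonInt_zero_le hμ1 (x := t) ⟨ht.1.le, ht.2.le⟩
    rw [besselNormal, ← sub_mul, hpow t ht.1]
    refine mul_pos ?_ (by linarith)
    have h2 : 0 < t ^ (μ + 1) := Real.rpow_pos_of_pos ht.1 _
    have h3 : 1 < t ^ (-e) := Real.one_lt_rpow_of_pos_of_lt_one_of_neg ht.1 ht.2 (by linarith)
    nlinarith
  have hk0 : (0 : ℝ) < k := by exact_mod_cast hk
  refine ⟨min (poissonInt μ 0 / 2 / k) c₁, lt_min (by positivity) hc₁0, fun x hx => ?_⟩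
  rcases le_total x 1 with h1 | h1
  · rw [min_eq_left (pow_le_one₀ hx h1)]
    have : ∫ t in (0 : ℝ)..x, t ^ (k - 1) * (poissonInt μ 0 / 2) ≤
        ∫ t in (0 : ℝ)..x, t ^ (k - 1) * poissonInt μ t := by
      refine intervalIntegral.integral_mono_on hx ((by fun_prop : Continuous _).intervalIntegrable _ _)
        (hH.intervalIntegrable _ _) fun t ht => ?_
      exact mul_le_mul_of_nonneg_left (half_poissonInt_zero_le hμ1 ⟨ht.1, ht.2.trans h1⟩)
        (pow_nonneg ht.1 _)
    refine le_trans ?_ this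
    rw [intervalIntegral.integral_mul_const, integral_pow, Nat.sub_add_cancel hk,
      zero_pow (by omega), sub_zero]
    have hcast : ((k - 1 : ℕ) : ℝ) + 1 = k := by rw [Nat.cast_sub hk]; push_cast; ring
    rw [hcast]
    calc _ ≤ poissonInt μ 0 / 2 / k * x ^ k :=
          mul_le_mul_of_nonneg_right (min_le_left _ _) (pow_nonneg hx _)
      _ = _ := by ring
  · rw [min_eq_right (one_le_pow₀ h1), mul_one]
    refine (min_le_right _ _).trans ?_
    rw [← intervalIntegral.integral_add_adjacent_intervals (hH.intervalIntegrable 0 1)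
      (hH.intervalIntegrable 1 x)]
    have hmem : ∀ t ∈ uIcc 1 x, 0 < t := fun t ht => by
      rw [uIcc_of_le h1] at ht; linarith [ht.1]
    -- The integration by parts avoids the singularity of `t^(-e)` at `0`. As `U ≥ 0`, every
    -- resulting term except `-U 1` is nonnegative.
    have hparts := intervalIntegral.integral_mul_deriv_eq_deriv_mul (a := 1) (b := x)
      (u := fun t => t ^ (-e)) (u' := fun t => -e * t ^ (-e - 1)) (v := U) (v' := besselNormal μ)
      (fun t ht => Real.hasDerivAt_rpow_const (Or.inl (hmem t ht).ne')) (fun t _ => hUd t)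
      (ContinuousOn.intervalIntegrable (continuousOn_const.mul
        (continuousOn_id.rpow_const fun t ht => Or.inl (hmem t ht).ne')))
      (hc.intervalIntegrable _ _)
    have heq : ∫ t in (1 : ℝ)..x, t ^ (k - 1) * poissonInt μ t =
        ∫ t in (1 : ℝ)..x, t ^ (-e) * besselNormal μ t := by
      refine intervalIntegral.integral_congr fun t ht => ?_
      simp only [besselNormal]
      rw [hpow t (hmem t ht), mul_assoc]
    have h2 : 0 ≤ x ^ (-e) * U x :=
      mul_nonneg (Real.rpow_nonneg hx _) (integral_besselNormal_nonneg hμ hx)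
    have h3 : ∫ t in (1 : ℝ)..x, -e * t ^ (-e - 1) * U t ≤ 0 := by
      have h4 : 0 ≤ ∫ t in (1 : ℝ)..x, -(-e * t ^ (-e - 1) * U t) := by
        refine intervalIntegral.integral_nonneg h1 fun t ht => ?_
        have ht0 : 0 ≤ t := by linarith [ht.1]
        have := mul_nonneg (mul_nonneg he0.le (Real.rpow_nonneg ht0 (-e - 1)))
          (integral_besselNormal_nonneg hμ ht0)
        simp only [hU]
        linarith
      rw [intervalIntegral.integral_neg] at h4
      linarith
    rw [heq, hparts, Real.one_rpow, one_mul]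
    linarith

/-! ### The Bochner-Riesz kernel. -/

section Kernel

variable {V : Type*} [NormedAddCommGroup V] [InnerProductSpace ℝ V] [FiniteDimensional ℝ V]
  [MeasurableSpace V] [BorelSpace V]

lemma rieszWeight_nonneg {W : Type*} [NormedAddCommGroup W] (γ : ℝ) {R : ℝ} (hR : 0 < R) (v : W) : 0 ≤ rieszWeight γ R v := by
  unfold rieszWeight
  split_ifs with h
  · refine Real.rpow_nonneg ?_ _
    rw [sub_nonneg, div_le_one (by positivity)]
    exact pow_le_pow_left₀ (norm_nonneg _) h.le 2
  · exact le_rfl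

lemma rieszWeight_neg {W : Type*} [NormedAddCommGroup W] (γ R : ℝ) (v : W) : rieszWeight γ R (-v) = rieszWeight γ R v := by
  simp [rieszWeight]

lemma rieszWeight_eq_one_smul {W : Type*} [NormedAddCommGroup W] [NormedSpace ℝ W] (γ : ℝ) {R : ℝ}
    (hR : 0 < R) (v : W) :
    rieszWeight γ R v = rieszWeight γ 1 (R⁻¹ • v) := by
  have h : ‖R⁻¹ • v‖ = ‖v‖ / R := by
    rw [norm_smul, norm_inv, Real.norm_of_nonneg hR.le]; ring
  simp only [rieszWeight, h, div_lt_one hR, div_pow, one_pow, div_one]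

lemma rieszWeight_one_integrable {γ : ℝ} (hγ : -1 < γ) [Nontrivial V] :
    Integrable (fun v : V => rieszWeight γ 1 v) volume := by
  have h := integrable_fun_norm_addHaar (E := V) volume (f := fun r : ℝ => rieszWeight γ 1 r)
  have e : ∀ v : V, rieszWeight γ 1 ‖v‖ = rieszWeight γ 1 v := fun v => by simp [rieszWeight]
  simp only [e] at h
  rw [h]
  set m := Module.finrank ℝ V - 1
  have h1 : IntegrableOn (fun s : ℝ => s ^ m * (1 - s ^ 2) ^ γ) (Ioo 0 1) := by
    have := intervalIntegrable_weight_mul hγ (f := fun s => s ^ m) (by fun_prop)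
    refine (this.1.mono_set (t := Ioc (-1) 1) (s := Ioo 0 1) fun x hx =>
      ⟨by linarith [hx.1], hx.2.le⟩).congr_fun (fun s _ => mul_comm _ _) measurableSet_Ioo
  have h2 : IntegrableOn (fun y : ℝ => y ^ m • rieszWeight γ 1 y) (Ioo 0 1) := by
    refine h1.congr_fun (fun s hs => ?_) measurableSet_Ioo
    have : |s| < 1 := abs_lt.2 ⟨by linarith [hs.1], hs.2⟩
    simp [rieszWeight, this]
  have h3 : IntegrableOn (fun y : ℝ => y ^ m • rieszWeight γ 1 y) (Ici 1) := by
    refine (integrableOn_zero (μ := volume) (s := Ici (1 : ℝ))).congr_fun (fun s hs => ?_)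
      measurableSet_Ici
    have hs : (1 : ℝ) ≤ s := hs
    have : ¬ |s| < 1 := by rw [not_lt]; exact hs.trans (le_abs_self s)
    simp [rieszWeight, this]
  refine (h2.union h3).mono_set fun y hy => ?_
  rcases lt_or_ge y 1 with h | h
  · exact Or.inl ⟨hy, h⟩
  · exact Or.inr h

lemma rieszWeight_integrable {γ : ℝ} (hγ : -1 < γ) {R : ℝ} (hR : 0 < R) [Nontrivial V] :
    Integrable (fun v : V => rieszWeight γ R v) volume := by
  simp only [rieszWeight_eq_one_smul γ hR]
  exact (integrable_comp_smul_iff volume _ (inv_ne_zero hR.ne')).2 (rieszWeight_one_integrable hγ)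

/-- The Fourier transform of the Bochner-Riesz weight. -/
noncomputable def rieszKernel (γ R : ℝ) (t : V) : ℝ :=
  ∫ ξ : V, rieszWeight γ R ξ * Real.cos (2 * Real.pi * inner ℝ t ξ)

lemma integrable_rieszWeight_mul_cexp {γ : ℝ} (hγ : -1 < γ) {R : ℝ} (hR : 0 < R) [Nontrivial V]
    (t : V) : Integrable (fun ξ : V => (rieszWeight γ R ξ : ℂ) *
      Complex.exp (((2 * Real.pi * inner ℝ t ξ : ℝ) : ℂ) * Complex.I)) volume := by
  refine Integrable.mul_bdd (c := 1) (rieszWeight_integrable hγ hR).ofReal ?_ ?_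
  · exact (by fun_prop : Continuous _).aestronglyMeasurable
  · exact Filter.Eventually.of_forall fun ξ => (Complex.norm_exp_ofReal_mul_I _).le

/-- The weight is even, so the sine part integrates to zero. -/
lemma integral_rieszWeight_mul_cexp {γ : ℝ} (hγ : -1 < γ) {R : ℝ} (hR : 0 < R) [Nontrivial V]
    (t : V) : ∫ ξ : V, (rieszWeight γ R ξ : ℂ) *
      Complex.exp (((2 * Real.pi * inner ℝ t ξ : ℝ) : ℂ) * Complex.I) = rieszKernel γ R t := by
  have hi := integrable_rieszWeight_mul_cexp hγ hR t
  have hre : ∀ ξ : V, ((rieszWeight γ R ξ : ℂ) *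
      Complex.exp (((2 * Real.pi * inner ℝ t ξ : ℝ) : ℂ) * Complex.I)).re =
      rieszWeight γ R ξ * Real.cos (2 * Real.pi * inner ℝ t ξ) := fun ξ => by
    rw [Complex.re_ofReal_mul, Complex.exp_ofReal_mul_I_re]
  have him : ∀ ξ : V, ((rieszWeight γ R ξ : ℂ) *
      Complex.exp (((2 * Real.pi * inner ℝ t ξ : ℝ) : ℂ) * Complex.I)).im =
      rieszWeight γ R ξ * Real.sin (2 * Real.pi * inner ℝ t ξ) := fun ξ => by
    rw [Complex.im_ofReal_mul, Complex.exp_ofReal_mul_I_im]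
  apply Complex.ext
  · rw [← RCLike.re_eq_complex_re, ← integral_re hi]
    simp only [RCLike.re_eq_complex_re, hre, Complex.ofReal_re, rieszKernel]
  · rw [← RCLike.im_eq_complex_im, ← integral_im hi]
    simp only [RCLike.im_eq_complex_im, him, Complex.ofReal_im]
    have h := integral_neg_eq_self
      (fun ξ : V => rieszWeight γ R ξ * Real.sin (2 * Real.pi * inner ℝ t ξ)) volume
    simp only [rieszWeight_neg, inner_neg_right, mul_neg, Real.sin_neg] at h
    rw [integral_neg] at h
    linarith

lemma rieszKernel_eq_one {γ R : ℝ} (hR : 0 < R) (t : V) :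
    rieszKernel γ R t = R ^ Module.finrank ℝ V * rieszKernel γ 1 (R • t) := by
  have h := Measure.integral_comp_inv_smul_of_nonneg (volume : Measure V)
    (fun ξ : V => rieszWeight γ 1 ξ * Real.cos (2 * Real.pi * inner ℝ (R • t) ξ)) hR.le
  simp only [rieszKernel, smul_eq_mul] at h ⊢
  rw [← h]
  refine integral_congr_ae (Filter.Eventually.of_forall fun ξ => ?_)
  simp only
  rw [rieszWeight_eq_one_smul γ hR, inner_smul_left, inner_smul_right]
  simp only [conj_trivial]
  rw [mul_inv_cancel_left₀ hR.ne']

/-- Cartesian coordinates whose first axis is parallel to a given vector. -/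
lemma exists_slicing {n : ℕ} (hV : Module.finrank ℝ V = n + 1) (t : V) :
    ∃ e : (ℝ × Eucl n) ≃ᵐ V, MeasurePreserving e volume volume ∧
      (∀ p, ‖e p‖ ^ 2 = p.1 ^ 2 + ‖p.2‖ ^ 2) ∧ ∀ p, inner ℝ t (e p) = ‖t‖ * p.1 := by
  obtain ⟨b, hb⟩ : ∃ b : OrthonormalBasis (Fin (n + 1)) ℝ V, ‖t‖ • b 0 = t := by
    rcases eq_or_ne t 0 with rfl | ht
    · exact ⟨(stdOrthonormalBasis ℝ V).reindex (finCongr hV), by simp⟩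
    · have ho : Orthonormal ℝ (Set.domRestrict ({0} : Set (Fin (n + 1)))
          (fun _ => ‖t‖⁻¹ • t)) := by
        refine ⟨fun i => ?_, fun i j hij => absurd (Subsingleton.elim i j) hij⟩
        simp [norm_smul, ht]
      obtain ⟨b, hb⟩ := ho.exists_orthonormalBasis_extension_of_card_eq (by simpa using hV)
      refine ⟨b, ?_⟩
      rw [hb 0 rfl, smul_smul, mul_inv_cancel₀ (norm_ne_zero_iff.2 ht), one_smul]
  let e₁ : (ℝ × Eucl n) ≃ᵐ (ℝ × (Fin n → ℝ)) :=
    (MeasurableEquiv.refl ℝ).prodCongr (MeasurableEquiv.toLp 2 (Fin n → ℝ)).symm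
  have h₁ : MeasurePreserving e₁ volume volume :=
    (MeasurePreserving.id _).prod (PiLp.volume_preserving_ofLp (Fin n))
  let e₂ : (ℝ × (Fin n → ℝ)) ≃ᵐ (Fin (n + 1) → ℝ) :=
    (MeasurableEquiv.piFinSuccAbove (fun _ => ℝ) 0).symm
  have h₂ : MeasurePreserving e₂ volume volume :=
    (volume_preserving_piFinSuccAbove (fun _ => ℝ) 0).symm
  let e₃ : (Fin (n + 1) → ℝ) ≃ᵐ Eucl (n + 1) := MeasurableEquiv.toLp 2 _
  have h₃ : MeasurePreserving e₃ volume volume := PiLp.volume_preserving_toLp _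
  let e₄ : Eucl (n + 1) ≃ᵐ V := b.measurableEquiv.symm
  have h₄ : MeasurePreserving e₄ volume volume := b.measurePreserving_measurableEquiv.symm
  refine ⟨e₁.trans (e₂.trans (e₃.trans e₄)), h₄.comp (h₃.comp (h₂.comp h₁)), fun p => ?_,
    fun p => ?_⟩
  · have : ‖(e₁.trans (e₂.trans (e₃.trans e₄))) p‖ = ‖e₃ (e₂ (e₁ p))‖ :=
      b.repr.symm.norm_map _
    rw [this, EuclideanSpace.real_norm_sq_eq, EuclideanSpace.real_norm_sq_eq, Fin.sum_univ_succ]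
    congr 1
  · have : (e₁.trans (e₂.trans (e₃.trans e₄))) p = b.repr.symm (e₃ (e₂ (e₁ p))) := rfl
    rw [this]
    conv_lhs => rw [← hb]
    rw [inner_smul_left, ← b.repr_apply_apply, LinearIsometryEquiv.apply_symm_apply]
    rfl

/-- The total mass of the Bochner-Riesz weight of radius `1` on `ℝⁿ`. -/
noncomputable def rieszMass (n : ℕ) (γ : ℝ) : ℝ := ∫ v : Eucl n, rieszWeight γ 1 v

lemma rieszMass_pos (n : ℕ) {γ : ℝ} (hγ : -1 < γ) : 0 < rieszMass n γ := by
  have hint : Integrable (fun v : Eucl n => rieszWeight γ 1 v) volume := by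
    cases n with
    | zero => exact Integrable.of_finite
    | succ n => exact rieszWeight_one_integrable hγ
  rw [rieszMass, integral_pos_iff_support_of_nonneg (fun v => rieszWeight_nonneg γ one_pos v) hint]
  refine lt_of_lt_of_le (Metric.measure_ball_pos volume (0 : Eucl n) one_pos)
    (measure_mono fun v hv => ?_)
  have hv : ‖v‖ < 1 := by simpa using hv
  rw [Function.mem_support, rieszWeight, if_pos hv]
  refine (Real.rpow_pos_of_pos ?_ _).ne'
  have := norm_nonneg v
  rw [one_pow, div_one]
  nlinarith

/-- At height `s` the weight is `(1 - s²)^γ` times the weight of radius `√(1 - s²)` on `ℝⁿ`, and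
rescaling contributes `(1 - s²)^(n/2)`. Hence the parameter `γ + n/2` of the Poisson integral. -/
lemma integral_slice_rieszWeight {W : Type*} [NormedAddCommGroup W] [MeasurableSpace W] (n : ℕ)
    (γ : ℝ) {e : (ℝ × Eucl n) ≃ᵐ W}
    (he : ∀ p, ‖e p‖ ^ 2 = p.1 ^ 2 + ‖p.2‖ ^ 2) (s : ℝ) :
    ∫ v : Eucl n, rieszWeight γ 1 (e (s, v)) =
      (Ioo (-1 : ℝ) 1).indicator (fun s => (1 - s ^ 2) ^ (γ + n / 2)) s * rieszMass n γ := by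
  have hlt : ∀ v : Eucl n, ‖e (s, v)‖ < 1 ↔ s ^ 2 + ‖v‖ ^ 2 < 1 := fun v => by
    rw [← he (s, v), sq_lt_one_iff₀ (norm_nonneg _)]
  by_cases hs : s ∈ Ioo (-1 : ℝ) 1
  · have ha : 0 < 1 - s ^ 2 := by nlinarith [hs.1, hs.2]
    set a := Real.sqrt (1 - s ^ 2) with haa
    have ha0 : 0 < a := Real.sqrt_pos.2 ha
    have hasq : a ^ 2 = 1 - s ^ 2 := Real.sq_sqrt ha.le
    have key : ∀ v : Eucl n,
        rieszWeight γ 1 (e (s, v)) = (1 - s ^ 2) ^ γ * rieszWeight γ 1 (a⁻¹ • v) := by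
      intro v
      rw [← rieszWeight_eq_one_smul γ ha0]
      simp only [rieszWeight, hlt, he]
      have h1 : s ^ 2 + ‖v‖ ^ 2 < 1 ↔ ‖v‖ < a := by
        rw [haa, Real.lt_sqrt (norm_nonneg _)]
        constructor <;> intro h <;> linarith
      rw [if_congr h1 rfl rfl]
      split_ifs with h
      · have h2 : 0 ≤ 1 - ‖v‖ ^ 2 / a ^ 2 := by
          rw [sub_nonneg, div_le_one (by positivity)]
          exact pow_le_pow_left₀ (norm_nonneg _) h.le 2
        rw [← Real.mul_rpow ha.le h2, ← hasq]
        congr 1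
        field_simp
        linarith
      · simp
    simp only [key]
    rw [integral_const_mul, Measure.integral_comp_inv_smul_of_nonneg _ _ ha0.le,
      indicator_of_mem hs, Real.rpow_add ha, rieszMass, smul_eq_mul, mul_assoc]
    congr 2
    rw [finrank_euclideanSpace_fin, haa, Real.sqrt_eq_rpow, ← Real.rpow_natCast,
      ← Real.rpow_mul ha.le]
    congr 1
    ring
  · rw [indicator_of_notMem hs, zero_mul]
    refine integral_eq_zero_of_ae (Filter.Eventually.of_forall fun v => ?_)
    have : ¬ ‖e (s, v)‖ < 1 := by
      rw [hlt, not_lt]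
      have h1 : 1 ≤ s ^ 2 := by
        by_contra! h
        exact hs (abs_lt.1 ((sq_lt_one_iff_abs_lt_one s).1 h))
      nlinarith [norm_nonneg v]
    simp [rieszWeight, this]

lemma rieszKernel_one {n : ℕ} (hV : Module.finrank ℝ V = n + 1) {γ : ℝ} (hγ : -1 < γ) (t : V) :
    rieszKernel γ 1 t = rieszMass n γ * poissonInt (γ + n / 2) (2 * Real.pi * ‖t‖) := by
  have : Nontrivial V := Module.nontrivial_of_finrank_pos (R := ℝ) (by omega)
  obtain ⟨e, hmp, hnorm, hinner⟩ := exists_slicing hV t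
  have hint : Integrable (fun ξ : V => rieszWeight γ 1 ξ * Real.cos (2 * Real.pi * inner ℝ t ξ))
      volume := by
    refine Integrable.mul_bdd (c := 1) (rieszWeight_one_integrable hγ)
      (by fun_prop : Continuous _).aestronglyMeasurable ?_
    exact Filter.Eventually.of_forall fun ξ => Real.abs_cos_le_one _
  have hint' : Integrable (fun p => rieszWeight γ 1 (e p) * Real.cos (2 * Real.pi * inner ℝ t (e p)))
      volume := (hmp.integrable_comp_emb e.measurableEmbedding).2 hint
  rw [rieszKernel, ← hmp.integral_comp', Measure.volume_eq_prod, integral_prod _ hint']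
  simp only [hinner, integral_mul_const, integral_slice_rieszWeight n γ hnorm]
  rw [poissonInt, intervalIntegral.integral_of_le (by norm_num), integral_Ioc_eq_integral_Ioo,
    ← integral_indicator measurableSet_Ioo, ← integral_const_mul]
  refine integral_congr_ae (Filter.Eventually.of_forall fun s => ?_)
  simp only [indicator]
  split_ifs <;> ring_nf

/-- The Bochner-Riesz kernel as a Bessel function. -/
lemma rieszKernel_eq {n : ℕ} (hV : Module.finrank ℝ V = n + 1) {γ : ℝ} (hγ : -1 < γ) {R : ℝ}
    (hR : 0 < R) (t : V) :
    rieszKernel γ R t =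
      R ^ (n + 1) * rieszMass n γ * poissonInt (γ + n / 2) (2 * Real.pi * R * ‖t‖) := by
  rw [rieszKernel_eq_one hR, rieszKernel_one hV hγ, hV, norm_smul, Real.norm_of_nonneg hR.le]
  ring_nf

lemma continuous_rieszKernel {n : ℕ} (hV : Module.finrank ℝ V = n + 1) {γ : ℝ} (hγ : -1 < γ) {R : ℝ}
    (hR : 0 < R) : Continuous (rieszKernel γ R : V → ℝ) := by
  have : (rieszKernel γ R : V → ℝ) = fun t =>
      R ^ (n + 1) * rieszMass n γ * poissonInt (γ + n / 2) (2 * Real.pi * R * ‖t‖) :=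
    funext (rieszKernel_eq hV hγ hR)
  rw [this]
  have hn : (0 : ℝ) ≤ n / 2 := by positivity
  have := continuous_poissonInt (μ := γ + n / 2) (by linarith)
  fun_prop

/-- Decay of the Bochner-Riesz kernel. -/
lemma exists_abs_rieszKernel_le {n : ℕ} (hV : Module.finrank ℝ V = n + 1) {γ : ℝ} (hγ : -1 < γ) :
    ∃ C, 0 ≤ C ∧ ∀ R, 0 < R → ∀ t : V,
      |rieszKernel γ R t| ≤ C * (R ^ (n + 1) * (1 + R * ‖t‖) ^ (-(γ + n / 2 + 1))) := by
  have hn : (0 : ℝ) ≤ n / 2 := by positivity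
  obtain ⟨C, hC0, hC⟩ := exists_abs_poissonInt_le (μ := γ + n / 2) (by linarith)
  have hm := rieszMass_pos n hγ
  refine ⟨rieszMass n γ * C, by positivity, fun R hR t => ?_⟩
  rw [rieszKernel_eq hV hγ hR, abs_mul, abs_of_pos (by positivity)]
  have h0 : 0 ≤ R * ‖t‖ := by positivity
  have h1 : (1 + 2 * Real.pi * R * ‖t‖) ^ (-(γ + n / 2 + 1)) ≤
      (1 + R * ‖t‖) ^ (-(γ + n / 2 + 1)) := by
    refine Real.rpow_le_rpow_of_nonpos (by linarith) ?_ (by linarith)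
    nlinarith [Real.pi_gt_three]
  calc _ ≤ R ^ (n + 1) * rieszMass n γ *
        (C * (1 + 2 * Real.pi * R * ‖t‖) ^ (-(γ + n / 2 + 1))) :=
        mul_le_mul_of_nonneg_left (hC _ (by positivity)) (by positivity)
    _ ≤ R ^ (n + 1) * rieszMass n γ * (C * (1 + R * ‖t‖) ^ (-(γ + n / 2 + 1))) := by gcongr
    _ = _ := by ring

lemma integral_ball_fun_norm [Nontrivial V] (f : ℝ → ℝ) {r : ℝ} (hr : 0 ≤ r) :
    ∫ t in Metric.ball (0 : V) r, f ‖t‖ =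
      Module.finrank ℝ V * volume.real (Metric.ball (0 : V) 1) *
        ∫ y in (0 : ℝ)..r, y ^ (Module.finrank ℝ V - 1) * f y := by
  rw [← integral_indicator measurableSet_ball]
  have e : (Metric.ball (0 : V) r).indicator (fun t => f ‖t‖) = fun t =>
      (Iio r).indicator f ‖t‖ := by
    ext t; simp [indicator]
  rw [e, integral_fun_norm_addHaar volume ((Iio r).indicator f), nsmul_eq_mul, smul_eq_mul,
    ← mul_assoc, intervalIntegral.integral_of_le hr, integral_Ioc_eq_integral_Ioo]
  congr 1
  rw [← Ioi_inter_Iio, ← setIntegral_indicator measurableSet_Iio]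
  refine setIntegral_congr_fun measurableSet_Ioi fun y _ => ?_
  simp [indicator]

/-- Lower bound for the integral of the Bochner-Riesz kernel over balls. -/
lemma exists_le_integral_ball_rieszKernel {n : ℕ} (hV : Module.finrank ℝ V = n + 1) {β : ℝ}
    (hβ : 0 ≤ β) (hβ' : ((n : ℝ) + 1) / 2 - 1 ≤ β) :
    ∃ c, 0 < c ∧ ∀ R, 0 < R → ∀ r, 0 ≤ r →
      c * min ((R * r) ^ (n + 1)) 1 ≤ ∫ t in Metric.ball (0 : V) r, rieszKernel β R t := by
  have : Nontrivial V := Module.nontrivial_of_finrank_pos (R := ℝ) (by omega)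
  have hn : (0 : ℝ) ≤ n / 2 := by positivity
  -- With `μ = β + n/2` and `k = n + 1` the condition `k - 2 < μ` reads `β > n/2 - 1`, which `hβ'`
  -- gives with `1/2` to spare.
  obtain ⟨c, hc0, hc⟩ := exists_le_integral_pow_mul_poissonInt (μ := β + n / 2) (k := n + 1)
    (by linarith) (by omega) (by push_cast; linarith)
  have hm := rieszMass_pos n (γ := β) (by linarith)
  have hvol : 0 < volume.real (Metric.ball (0 : V) 1) :=
    ENNReal.toReal_pos (Metric.measure_ball_pos volume _ one_pos).ne' measure_ball_lt_top.ne
  have hpi := Real.pi_gt_three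
  -- The area of the unit sphere times the mass of a slice, divided by the power of `2π` from the
  -- substitution `x = 2πRy`; the powers of `R` cancel.
  set D : ℝ := ((n : ℝ) + 1) * volume.real (Metric.ball (0 : V) 1) * rieszMass n β /
    (2 * Real.pi) ^ (n + 1) with hD
  have hD0 : 0 < D := by positivity
  refine ⟨D * c, by positivity, fun R hR r hr => ?_⟩
  have e1 : ∫ t in Metric.ball (0 : V) r, rieszKernel β R t =
      D * ∫ x in (0 : ℝ)..(2 * Real.pi * R * r), x ^ n * poissonInt (β + n / 2) x := by
    simp only [rieszKernel_eq hV (by linarith : -1 < β) hR]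
    rw [integral_ball_fun_norm (fun y => R ^ (n + 1) * rieszMass n β *
      poissonInt (β + n / 2) (2 * Real.pi * R * y)) hr, hV, Nat.add_sub_cancel]
    have h := intervalIntegral.integral_comp_mul_left (a := 0) (b := r)
      (fun x => x ^ n * poissonInt (β + n / 2) x) (c := 2 * Real.pi * R) (by positivity)
    rw [mul_zero, smul_eq_mul, eq_inv_mul_iff_mul_eq₀ (by positivity)] at h
    rw [← h, ← intervalIntegral.integral_const_mul, ← intervalIntegral.integral_const_mul,
      ← intervalIntegral.integral_const_mul]
    refine intervalIntegral.integral_congr fun y _ => ?_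
    simp only [hD, mul_pow, pow_succ]
    push_cast
    field_simp
  rw [e1, mul_assoc]
  refine mul_le_mul_of_nonneg_left (le_trans ?_ (hc _ (by positivity))) hD0.le
  refine mul_le_mul_of_nonneg_left (min_le_min_right _ ?_) hc0.le
  have : 0 ≤ R * r := by positivity
  exact pow_le_pow_left₀ this (by nlinarith) _

end Kernel

/-! ### Rearrangement into balls and equimeasurability. -/

section Rearrangement

variable {d : ℕ} (V : Type*) [NormedAddCommGroup V] [InnerProductSpace ℝ V] [FiniteDimensional ℝ V]
  [MeasurableSpace V] [BorelSpace V]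

/-- The distribution function of `|φ|`. -/
noncomputable def distr (φ : Eucl d → ℂ) (t : ℝ) : ℝ := volume.real {y | t < ‖φ y‖}

/-- The radius of the ball of `V` of volume `a`. -/
noncomputable def ballRadius (a : ℝ) : ℝ :=
  (a / volume.real (Metric.ball (0 : V) 1)) ^ (1 / (Module.finrank ℝ V : ℝ))

/-- The centred open ball of `V` with the volume of `E`. -/
noncomputable def ballStar (E : Set (Eucl d)) : Set V := Metric.ball 0 (ballRadius V (volume.real E))

variable {V} in
/-- `star` sends each set to a centred ball of the same volume, up to the boundary of the ball. -/
def IsBallStar (star : Set (Eucl d) → Set V) : Prop :=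
  ∀ E, ballStar V E ⊆ star E ∧ star E ⊆ Metric.closedBall 0 (ballRadius V (volume.real E))

lemma distr_nonneg (φ : Eucl d → ℂ) (t : ℝ) : 0 ≤ distr φ t := measureReal_nonneg

/-- Monotonicity is used for the `ENNReal`-valued measure: `distr` itself need not be antitone,
since `toReal` sends infinite measure to `0`. -/
lemma measurable_distr (φ : Eucl d → ℂ) : Measurable (distr φ) := by
  have : Antitone fun t : ℝ => volume {y | t < ‖φ y‖} := fun s t hst =>
    measure_mono fun y hy => lt_of_le_of_lt hst hy
  exact this.measurable.ennreal_toReal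

lemma volume_real_ball_one_pos : 0 < volume.real (Metric.ball (0 : V) 1) :=
  ENNReal.toReal_pos (Metric.measure_ball_pos volume _ one_pos).ne' measure_ball_lt_top.ne

lemma ballRadius_nonneg (a : ℝ) (ha : 0 ≤ a) : 0 ≤ ballRadius V a :=
  Real.rpow_nonneg (div_nonneg ha measureReal_nonneg) _

lemma ballRadius_mono {a b : ℝ} (ha : 0 ≤ a) (h : a ≤ b) : ballRadius V a ≤ ballRadius V b := by
  refine Real.rpow_le_rpow (div_nonneg ha measureReal_nonneg) ?_ (by positivity)
  gcongr

lemma continuous_ballRadius : Continuous (ballRadius V) :=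
  (Real.continuous_rpow_const (by positivity)).comp (continuous_id.div_const _)

lemma ballRadius_zero [Nontrivial V] : ballRadius V 0 = 0 := by
  have : 0 < Module.finrank ℝ V := Module.finrank_pos
  rw [ballRadius, zero_div, Real.zero_rpow]
  positivity

lemma ballRadius_pow [Nontrivial V] {a : ℝ} (ha : 0 ≤ a) :
    ballRadius V a ^ Module.finrank ℝ V = a / volume.real (Metric.ball (0 : V) 1) := by
  have : 0 < Module.finrank ℝ V := Module.finrank_pos
  rw [ballRadius, one_div, Real.rpow_inv_natCast_pow (div_nonneg ha measureReal_nonneg) this.ne']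

lemma volume_ball_ballRadius [Nontrivial V] {a : ℝ} (ha : 0 ≤ a) :
    volume (Metric.ball (0 : V) (ballRadius V a)) = ENNReal.ofReal a := by
  have h := volume_real_ball_one_pos V
  rw [Measure.addHaar_ball _ _ (ballRadius_nonneg V a ha), ballRadius_pow V ha,
    ← ENNReal.ofReal_toReal (measure_ball_lt_top (μ := volume) (x := (0 : V)) (r := 1)).ne,
    ← ENNReal.ofReal_mul (div_nonneg ha h.le)]
  congr 1
  exact div_mul_cancel₀ a h.ne'

variable {V}

lemma measurableSet_ballStar_graph (φ : Eucl d → ℂ) :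
    MeasurableSet {p : V × ℝ | p.1 ∈ ballStar V {y | p.2 < ‖φ y‖}} := by
  have h : Measurable fun p : V × ℝ => ballRadius V (distr φ p.2) :=
    (continuous_ballRadius V).measurable.comp ((measurable_distr φ).comp measurable_snd)
  have : {p : V × ℝ | p.1 ∈ ballStar V {y | p.2 < ‖φ y‖}} =
      {p : V × ℝ | ‖p.1‖ < ballRadius V (distr φ p.2)} := by
    ext p; simp [ballStar, distr]
  rw [this]
  exact measurableSet_lt measurable_fst.norm h

/-- Boundaries of balls do not matter for the rearrangement, up to a null set. -/
lemma layerCake_ae_eq [Nontrivial V] {star : Set (Eucl d) → Set V} (hs : IsBallStar star)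
    (φ : Eucl d → ℂ) : layerCake star φ =ᵐ[volume] layerCake (ballStar V) φ := by
  have hmeas : MeasurableSet {p : V × ℝ | ‖p.1‖ = ballRadius V (distr φ p.2)} :=
    measurableSet_eq_fun measurable_fst.norm
      ((continuous_ballRadius V).measurable.comp ((measurable_distr φ).comp measurable_snd))
  -- At each level the exceptional set is a sphere, hence null; by Fubini almost every `x` meets it
  -- in a null set of levels.
  have hnull : (volume.prod (volume : Measure ℝ)) {p : V × ℝ | ‖p.1‖ = ballRadius V (distr φ p.2)} = 0 := by
    rw [Measure.prod_apply_symm hmeas, lintegral_eq_zero_iff (measurable_measure_prodMk_right hmeas)]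
    refine Filter.Eventually.of_forall fun t => ?_
    have : (fun x : V => (x, t)) ⁻¹' {p : V × ℝ | ‖p.1‖ = ballRadius V (distr φ p.2)} =
        Metric.sphere 0 (ballRadius V (distr φ t)) := by
      ext x; simp
    change volume ((fun x : V => (x, t)) ⁻¹' _) = 0
    rw [this]
    exact Measure.addHaar_sphere _ _ _
  filter_upwards [Measure.measure_ae_null_of_prod_null hnull] with x hx
  refine setIntegral_congr_ae measurableSet_Ioi ?_
  filter_upwards [compl_mem_ae_iff.2 hx] with t ht _
  have hne : ‖x‖ ≠ ballRadius V (distr φ t) := ht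
  have : x ∈ star {y | t < ‖φ y‖} ↔ x ∈ ballStar V {y | t < ‖φ y‖} := by
    refine ⟨fun h => ?_, fun h => (hs _).1 h⟩
    have h1 := (hs _).2 h
    rw [mem_closedBall_zero_iff] at h1
    rw [ballStar, mem_ball_zero_iff]
    exact lt_of_le_of_ne h1 hne
  by_cases h : x ∈ star {y | t < ‖φ y‖}
  · rw [indicator_of_mem h, indicator_of_mem (this.1 h)]
  · rw [indicator_of_notMem h, indicator_of_notMem (mt this.2 h)]

lemma layerCake_nonneg {X : Type*} (star : Set (Eucl d) → Set X) (φ : Eucl d → ℂ) (x : X) :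
    0 ≤ layerCake star φ x :=
  integral_nonneg fun _ => indicator_nonneg (fun _ _ => zero_le_one) _

lemma layerCake_eq_measureReal {X : Type*} (star : Set (Eucl d) → Set X) (φ : Eucl d → ℂ) (x : X)
    (hm : MeasurableSet {t : ℝ | x ∈ star {y | t < ‖φ y‖}}) :
    layerCake star φ x = volume.real (Ioi 0 ∩ {t : ℝ | x ∈ star {y | t < ‖φ y‖}}) := by
  have e : (fun t : ℝ => (star {y | t < ‖φ y‖}).indicator (fun _ => (1 : ℝ)) x) =
      {t : ℝ | x ∈ star {y | t < ‖φ y‖}}.indicator fun _ => 1 := by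
    ext t; simp [indicator]
  rw [layerCake, e, setIntegral_indicator hm]
  simp

lemma layerCake_ballStar_eq (φ : Eucl d → ℂ) (x : V) :
    layerCake (ballStar V) φ x = volume.real (Ioi 0 ∩ {t : ℝ | ‖x‖ < ballRadius V (distr φ t)}) := by
  have h : {t : ℝ | x ∈ ballStar V {y | t < ‖φ y‖}} = {t : ℝ | ‖x‖ < ballRadius V (distr φ t)} := by
    ext t; simp [ballStar, distr]
  rw [layerCake_eq_measureReal, h]
  rw [h]
  exact measurableSet_lt measurable_const
    ((continuous_ballRadius V).measurable.comp (measurable_distr φ))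

lemma measurable_layerCake_ballStar (φ : Eucl d → ℂ) :
    Measurable (layerCake (ballStar V) φ) := by
  have h : StronglyMeasurable fun p : V × ℝ =>
      (ballStar V {y | p.2 < ‖φ y‖}).indicator (fun _ => (1 : ℝ)) p.1 := by
    have : (fun p : V × ℝ => (ballStar V {y | p.2 < ‖φ y‖}).indicator (fun _ => (1 : ℝ)) p.1) =
        {p : V × ℝ | p.1 ∈ ballStar V {y | p.2 < ‖φ y‖}}.indicator fun _ => 1 := by
      ext p; simp [indicator]
    rw [this]
    exact stronglyMeasurable_const.indicator (measurableSet_ballStar_graph φ)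
  exact (h.integral_prod_right (ν := volume.restrict (Ioi 0))).measurable

lemma distr_anti {φ : Eucl d → ℂ} (hfin : ∀ t, 0 < t → volume {y | t < ‖φ y‖} < ⊤) {s t : ℝ}
    (hs : 0 < s) (hst : s ≤ t) : distr φ t ≤ distr φ s :=
  ENNReal.toReal_mono (hfin s hs).ne (measure_mono fun _ hy => lt_of_le_of_lt hst hy)

open Filter Topology in
-- Continuity of the measure from above, along the levels `n + 1`, which are positive so that the
-- superlevel sets have finite measure.
lemma exists_ballRadius_distr_lt [Nontrivial V] {φ : Eucl d → ℂ} (hφ : AEMeasurable φ volume)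
    (hfin : ∀ t, 0 < t → volume {y | t < ‖φ y‖} < ⊤) {ε : ℝ} (hε : 0 < ε) :
    ∃ T, 0 < T ∧ ballRadius V (distr φ T) < ε := by
  have h := tendsto_measure_iInter_atTop (μ := volume)
    (s := fun n : ℕ => {y | (n : ℝ) + 1 < ‖φ y‖})
    (fun n => nullMeasurableSet_lt aemeasurable_const hφ.norm)
    (fun m n hmn y (hy : (n : ℝ) + 1 < ‖φ y‖) =>
      lt_of_le_of_lt (add_le_add_left (Nat.cast_le.2 hmn) 1) hy) ⟨0, (hfin _ (by positivity)).ne⟩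
  have hempty : ⋂ n : ℕ, {y | (n : ℝ) + 1 < ‖φ y‖} = ∅ := by
    refine eq_empty_of_forall_notMem fun y hy => ?_
    obtain ⟨n, hn⟩ := exists_nat_gt ‖φ y‖
    have : (n : ℝ) + 1 < ‖φ y‖ := mem_iInter.1 hy n
    linarith
  rw [hempty, measure_empty] at h
  have h2 := (ENNReal.tendsto_toReal ENNReal.zero_ne_top).comp h
  have h3 := ((continuous_ballRadius V).tendsto 0).comp h2
  rw [ballRadius_zero] at h3
  obtain ⟨n, hn⟩ := (h3.eventually (gt_mem_nhds hε)).exists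
  exact ⟨n + 1, by positivity, hn⟩

open Filter Topology in
-- Right-continuity of the distribution function: `{|φ| > s}` is the increasing union of the sets
-- `{|φ| > s + 1/(n+1)}`.
lemma exists_gt_lt_ballRadius_distr {φ : Eucl d → ℂ}
    (hfin : ∀ t, 0 < t → volume {y | t < ‖φ y‖} < ⊤) {s : ℝ} (hs : 0 < s) {ρ : ℝ}
    (hρ : ρ < ballRadius V (distr φ s)) : ∃ t, s < t ∧ ρ < ballRadius V (distr φ t) := by
  have h := tendsto_measure_iUnion_atTop (μ := volume)
    (s := fun n : ℕ => {y | s + 1 / ((n : ℝ) + 1) < ‖φ y‖})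
    (fun m n hmn y (hy : s + 1 / ((m : ℝ) + 1) < ‖φ y‖) =>
      lt_of_le_of_lt (add_le_add_right (Nat.one_div_le_one_div hmn) s) hy)
  have hU : ⋃ n : ℕ, {y | s + 1 / ((n : ℝ) + 1) < ‖φ y‖} = {y | s < ‖φ y‖} := by
    ext y
    simp only [mem_iUnion, mem_ofPred_eq]
    refine ⟨fun ⟨n, hn⟩ => lt_trans (lt_add_of_pos_right _ (by positivity)) hn, fun hy => ?_⟩
    obtain ⟨n, hn⟩ := exists_nat_one_div_lt (sub_pos.2 hy)
    exact ⟨n, by linarith⟩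
  rw [hU] at h
  have h2 := (ENNReal.tendsto_toReal (hfin s hs).ne).comp h
  have h3 := ((continuous_ballRadius V).tendsto _).comp h2
  obtain ⟨n, hn⟩ := (h3.eventually (lt_mem_nhds hρ)).exists
  exact ⟨s + 1 / ((n : ℝ) + 1), lt_add_of_pos_right _ (by positivity), hn⟩

/-- Superlevel sets of the rearrangement. -/
lemma lt_layerCake_ballStar_iff [Nontrivial V] {φ : Eucl d → ℂ} (hφ : AEMeasurable φ volume)
    (hfin : ∀ t, 0 < t → volume {y | t < ‖φ y‖} < ⊤) {x : V} (hx : x ≠ 0) {s : ℝ} (hs : 0 < s) :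
    s < layerCake (ballStar V) φ x ↔ ‖x‖ < ballRadius V (distr φ s) := by
  -- The levels counted at `x` form an interval starting at `0`, open on the right by
  -- right-continuity, and bounded because the radii tend to `0` while `x ≠ 0`. At `x = 0` it may be
  -- unbounded, and `volume.real` then returns the default value `0`.
  have hanti : ∀ a b : ℝ, 0 < a → a ≤ b → ballRadius V (distr φ b) ≤ ballRadius V (distr φ a) :=
    fun a b ha hab => ballRadius_mono V (distr_nonneg φ b) (distr_anti hfin ha hab)
  rw [layerCake_ballStar_eq]
  constructor
  · intro h
    by_contra! hle
    have hsub : Ioi 0 ∩ {t : ℝ | ‖x‖ < ballRadius V (distr φ t)} ⊆ Ioc 0 s := by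
      rintro t ⟨ht0, ht⟩
      refine ⟨ht0, ?_⟩
      by_contra! hst
      exact absurd (lt_of_lt_of_le ht ((hanti s t hs hst.le).trans hle)) (lt_irrefl _)
    have := measureReal_mono (μ := volume) hsub (by simp)
    rw [Real.volume_real_Ioc_of_le hs.le] at this
    linarith
  · intro h
    obtain ⟨t, hst, ht⟩ := exists_gt_lt_ballRadius_distr hfin hs h
    obtain ⟨T, hT0, hT⟩ := exists_ballRadius_distr_lt (V := V) hφ hfin (norm_pos_iff.2 hx)
    have hsub : Ioc 0 t ⊆ Ioi 0 ∩ {t : ℝ | ‖x‖ < ballRadius V (distr φ t)} := fun a ha =>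
      ⟨ha.1, lt_of_lt_of_le ht (hanti a t ha.1 ha.2)⟩
    have hsub' : Ioi 0 ∩ {t : ℝ | ‖x‖ < ballRadius V (distr φ t)} ⊆ Ioc 0 T := by
      rintro a ⟨ha0, ha⟩
      refine ⟨ha0, ?_⟩
      by_contra! hTa
      exact absurd (lt_of_lt_of_le (lt_trans hT ha) (hanti T a hT0 hTa.le)) (lt_irrefl _)
    have := measureReal_mono (μ := volume) hsub
      (ne_top_of_le_ne_top (by simp) (measure_mono hsub'))
    rw [Real.volume_real_Ioc_of_le (hs.trans hst).le] at this
    linarith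

lemma layerCake_ballStar_anti [Nontrivial V] {φ : Eucl d → ℂ} (hφ : AEMeasurable φ volume)
    (hfin : ∀ t, 0 < t → volume {y | t < ‖φ y‖} < ⊤) {x y : V} (hy : y ≠ 0) (h : ‖y‖ ≤ ‖x‖) :
    layerCake (ballStar V) φ x ≤ layerCake (ballStar V) φ y := by
  have hx : x ≠ 0 := norm_pos_iff.1 ((norm_pos_iff.2 hy).trans_le h)
  by_contra! hlt
  obtain ⟨s, hs1, hs2⟩ := exists_between hlt
  have hs0 : 0 < s := (layerCake_nonneg _ φ y).trans_lt hs1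
  have := (lt_layerCake_ballStar_iff hφ hfin hx hs0).1 hs2
  exact absurd ((lt_layerCake_ballStar_iff hφ hfin hy hs0).2 (h.trans_lt this)) (not_lt.2 hs1.le)

/-- The rearrangement is equimeasurable with `|φ|`. -/
lemma volume_lt_layerCake_ballStar [Nontrivial V] {φ : Eucl d → ℂ} (hφ : AEMeasurable φ volume)
    (hfin : ∀ t, 0 < t → volume {y | t < ‖φ y‖} < ⊤) {s : ℝ} (hs : 0 < s) :
    volume {x : V | s < layerCake (ballStar V) φ x} = volume {y | s < ‖φ y‖} := by
  have h : {x : V | s < layerCake (ballStar V) φ x} =ᵐ[volume]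
      Metric.ball (0 : V) (ballRadius V (distr φ s)) := by
    have h0 : ∀ᵐ x : V, x ≠ 0 := by simp [ae_iff]
    filter_upwards [h0] with x hx
    rw [eq_iff_iff]
    change s < _ ↔ x ∈ Metric.ball (0 : V) _
    rw [lt_layerCake_ballStar_iff hφ hfin hx hs, mem_ball_zero_iff]
  rw [measure_congr h, volume_ball_ballRadius V (distr_nonneg φ s), distr,
    Measure.real, ENNReal.ofReal_toReal (hfin s hs).ne]

/-- Equimeasurable nonnegative functions have the same moments. -/
lemma lintegral_rpow_eq_of_equimeasurable {X Y : Type*} [MeasurableSpace X] [MeasurableSpace Y]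
    {μ : Measure X} {ν : Measure Y} {f : X → ℝ} {g : Y → ℝ} (hf0 : ∀ x, 0 ≤ f x) (hg0 : ∀ y, 0 ≤ g y)
    (hf : AEMeasurable f μ) (hg : AEMeasurable g ν)
    (h : ∀ t, 0 < t → μ {x | t < f x} = ν {y | t < g y}) {p : ℝ} (hp : 0 < p) :
    ∫⁻ x, ENNReal.ofReal (f x ^ p) ∂μ = ∫⁻ y, ENNReal.ofReal (g y ^ p) ∂ν := by
  rw [lintegral_rpow_eq_lintegral_meas_lt_mul μ (Filter.Eventually.of_forall hf0) hf hp,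
    lintegral_rpow_eq_lintegral_meas_lt_mul ν (Filter.Eventually.of_forall hg0) hg hp]
  congr 1
  exact setLIntegral_congr_fun measurableSet_Ioi fun t ht => by rw [h t ht]

end Rearrangement

/-! ### The growth factor, and the kernel integrated over sets of given measure. -/

lemma one_le_growth (d : ℕ) (α : ℝ) {s : ℝ} (hs : 0 ≤ s) : 1 ≤ growth d α s := by
  unfold growth
  split_ifs with h1 h2
  · exact Real.one_le_rpow (by linarith) (by linarith)
  · have := Real.log_nonneg (by linarith : 1 ≤ 1 + s)
    linarith
  · exact le_rfl

lemma growth_mono (d : ℕ) (α : ℝ) {s t : ℝ} (hs : 0 ≤ s) (h : s ≤ t) :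
    growth d α s ≤ growth d α t := by
  unfold growth
  split_ifs with h1 h2
  · exact Real.rpow_le_rpow (by linarith) (by linarith) (by linarith)
  · have := Real.log_le_log (by linarith : 0 < 1 + s) (by linarith : 1 + s ≤ 1 + t)
    linarith
  · exact le_rfl

/-- The integral is bounded, logarithmic or of order `(1 + r)^q` according as `q = D/2 - α` is
negative, zero or positive, which is the trichotomy of `growth` in dimension `D + 1`. The intended
radius is `r = u^(1/(D+1)) ≤ 1 + u`. -/
lemma exists_rpow_le_growth (D : ℕ) (α : ℝ) :
    ∃ C, 0 < C ∧ ∀ u r : ℝ, 0 ≤ r → r ≤ 1 + u → 0 ≤ u →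
      (1 + r) ^ ((D : ℝ) / 2 - α) ≤ C * growth (D + 1) α u ∧
      ∫ s in (0 : ℝ)..r, (1 + s) ^ ((D : ℝ) / 2 - α - 1) ≤ C * growth (D + 1) α u := by
  set q : ℝ := (D : ℝ) / 2 - α with hq
  have hint : ∀ r : ℝ, 0 ≤ r → q ≠ 0 → ∫ s in (0 : ℝ)..r, (1 + s) ^ (q - 1) = ((1 + r) ^ q - 1) / q := by
    intro r hr hq0
    rw [intervalIntegral.integral_comp_add_left (fun s => s ^ (q - 1)),
      integral_rpow (Or.inr ⟨fun h => hq0 (by linarith), ?_⟩)]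
    · simp
    · rw [uIcc_of_le (by linarith)]
      intro h
      linarith [h.1]
  rcases lt_trichotomy q 0 with h | h | h
  · refine ⟨1 + 1 / (-q), by have := neg_pos.2 h; positivity, fun u r hr hru hu => ?_⟩
    have h1 := one_le_growth (D + 1) α hu
    have h2 : (1 + r) ^ q ≤ 1 := Real.rpow_le_one_of_one_le_of_nonpos (by linarith) h.le
    have h3 : 0 ≤ (1 + r) ^ q := Real.rpow_nonneg (by linarith) _
    have h4 : 0 < 1 / (-q) := by have := neg_pos.2 h; positivity
    constructor
    · nlinarith
    · rw [hint r hr h.ne]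
      have : ((1 + r) ^ q - 1) / q = (1 - (1 + r) ^ q) * (1 / (-q)) := by
        field_simp; ring
      rw [this]
      nlinarith
  · refine ⟨1, one_pos, fun u r hr hru hu => ?_⟩
    have hα : α = ((D + 1 : ℕ) - 1 : ℝ) / 2 := by push_cast; linarith
    have hg : growth (D + 1) α u = 1 + Real.log (1 + u) := by
      rw [growth, if_neg (by rw [← hα]; exact lt_irrefl _), if_pos hα]
    have h0 := Real.log_nonneg (by linarith : 1 ≤ 1 + u)
    rw [h, hg, Real.rpow_zero, one_mul]
    refine ⟨by linarith, ?_⟩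
    have e : ∫ s in (0 : ℝ)..r, (1 + s) ^ ((0 : ℝ) - 1) = Real.log (1 + r) := by
      rw [intervalIntegral.integral_comp_add_left (fun s => s ^ ((0 : ℝ) - 1))]
      simp only [zero_sub, Real.rpow_neg_one, add_zero]
      rw [integral_inv_of_pos one_pos (by linarith), div_one]
    rw [e]
    calc Real.log (1 + r) ≤ Real.log (2 * (1 + u)) := Real.log_le_log (by linarith) (by linarith)
      _ = Real.log 2 + Real.log (1 + u) := Real.log_mul (by norm_num) (by linarith)
      _ ≤ _ := by have := Real.log_two_lt_d9; linarith
  · refine ⟨2 ^ q * (1 + 1 / q), by positivity, fun u r hr hru hu => ?_⟩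
    have hα : α < ((D + 1 : ℕ) - 1 : ℝ) / 2 := by push_cast; linarith
    have hg : growth (D + 1) α u = (1 + u) ^ q := by
      rw [growth, if_pos hα]; congr 1; push_cast; rw [hq]; ring
    have h1 : (1 + r) ^ q ≤ 2 ^ q * (1 + u) ^ q := by
      rw [← Real.mul_rpow (by norm_num) (by linarith)]
      exact Real.rpow_le_rpow (by linarith) (by linarith) h.le
    have h2 : 0 ≤ (1 + r) ^ q := Real.rpow_nonneg (by linarith) _
    have h3 : 0 < 1 / q := by positivity
    rw [hg]
    constructor
    · nlinarith
    · rw [hint r hr h.ne', div_eq_mul_one_div]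
      nlinarith

lemma rpow_inv_le_one_add {u : ℝ} (hu : 0 ≤ u) (D : ℕ) : u ^ (1 / ((D : ℝ) + 1)) ≤ 1 + u := by
  have h1 : 1 / ((D : ℝ) + 1) ≤ 1 := by
    rw [div_le_one (by positivity)]
    have : (0 : ℝ) ≤ D := by positivity
    linarith
  calc u ^ (1 / ((D : ℝ) + 1)) ≤ (1 + u) ^ (1 / ((D : ℝ) + 1)) :=
        Real.rpow_le_rpow hu (by linarith) (by positivity)
    _ ≤ (1 + u) ^ (1 : ℝ) := Real.rpow_le_rpow_of_exponent_le (by linarith) h1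
    _ = _ := Real.rpow_one _

section SetEstimate

variable {D : ℕ}

/-- Integral over a ball of a radial function with the decay of the Bochner-Riesz kernel. -/
lemma lintegral_ball_decay_le (α : ℝ) {Ω ρ : ℝ} (hΩ : 0 < Ω) (hρ : 0 ≤ ρ) :
    ∫⁻ t in Metric.ball (0 : Eucl (D + 1)) ρ,
      ENNReal.ofReal (Ω ^ (D + 1) * (1 + Ω * ‖t‖) ^ (-(α + D / 2 + 1))) ≤
    ENNReal.ofReal (((D : ℝ) + 1) * volume.real (Metric.ball (0 : Eucl (D + 1)) 1) *
      ∫ s in (0 : ℝ)..(Ω * ρ), (1 + s) ^ ((D : ℝ) / 2 - α - 1)) := by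
  have hc : Continuous fun t : Eucl (D + 1) =>
      Ω ^ (D + 1) * (1 + Ω * ‖t‖) ^ (-(α + D / 2 + 1)) := by
    refine continuous_const.mul (Continuous.rpow_const (by fun_prop) fun t => Or.inl ?_)
    have : 0 ≤ Ω * ‖t‖ := by positivity
    linarith
  rw [← ofReal_integral_eq_lintegral_ofReal]
  rotate_left
  · exact (hc.continuousOn.integrableOn_compact (isCompact_closedBall 0 ρ)).mono_set
      Metric.ball_subset_closedBall
  · exact Filter.Eventually.of_forall fun t => by positivity
  refine ENNReal.ofReal_le_ofReal ?_
  rw [integral_ball_fun_norm (fun y => Ω ^ (D + 1) * (1 + Ω * y) ^ (-(α + D / 2 + 1))) hρ,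
    finrank_euclideanSpace_fin, Nat.add_sub_cancel, Nat.cast_add_one]
  refine mul_le_mul_of_nonneg_left ?_ (by positivity)
  have hsub := intervalIntegral.integral_comp_mul_left (a := 0) (b := ρ)
      (fun s => (1 + s) ^ ((D : ℝ) / 2 - α - 1)) (c := Ω) hΩ.ne'
  rw [mul_zero, smul_eq_mul, eq_inv_mul_iff_mul_eq₀ hΩ.ne'] at hsub
  rw [← hsub, ← intervalIntegral.integral_const_mul]
  have hpos : ∀ y ∈ Icc 0 ρ, 0 < 1 + Ω * y := fun y hy => by
    have := mul_nonneg hΩ.le hy.1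
    linarith
  refine intervalIntegral.integral_mono_on hρ ?_ ?_ fun y hy => ?_
  · refine ContinuousOn.intervalIntegrable (ContinuousOn.mul (by fun_prop)
      (continuousOn_const.mul (ContinuousOn.rpow_const (by fun_prop) fun y hy => Or.inl ?_)))
    rw [uIcc_of_le hρ] at hy
    exact (hpos y hy).ne'
  · refine ContinuousOn.intervalIntegrable
      (continuousOn_const.mul (ContinuousOn.rpow_const (by fun_prop) fun y hy => Or.inl ?_))
    rw [uIcc_of_le hρ] at hy
    exact (hpos y hy).ne'
  · have h1 := hpos y hy
    have e : (1 + Ω * y) ^ ((D : ℝ) / 2 - α - 1) =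
        (1 + Ω * y) ^ D * (1 + Ω * y) ^ (-(α + D / 2 + 1)) := by
      rw [← Real.rpow_natCast, ← Real.rpow_add h1]; congr 1; ring
    rw [e]
    have h2 : (Ω * y) ^ D ≤ (1 + Ω * y) ^ D :=
      pow_le_pow_left₀ (mul_nonneg hΩ.le hy.1) (by linarith) _
    have h3 : 0 ≤ Ω * (1 + Ω * y) ^ (-(α + D / 2 + 1)) := mul_nonneg hΩ.le (Real.rpow_nonneg h1.le _)
    calc _ = (Ω * y) ^ D * (Ω * (1 + Ω * y) ^ (-(α + D / 2 + 1))) := by rw [mul_pow, pow_succ]; ring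
      _ ≤ (1 + Ω * y) ^ D * (Ω * (1 + Ω * y) ^ (-(α + D / 2 + 1))) :=
        mul_le_mul_of_nonneg_right h2 h3
      _ = _ := by ring

/-- Bathtub estimate for radial functions with the decay of the Bochner-Riesz kernel. -/
lemma exists_setLIntegral_decay_le (D : ℕ) {α : ℝ} (hα : -1 / 2 < α) :
    ∃ C, 0 < C ∧ ∀ Ω, 0 < Ω → ∀ (x : Eucl (D + 1)) (E : Set (Eucl (D + 1))), volume E < ⊤ →
      ∫⁻ y in E, ENNReal.ofReal (Ω ^ (D + 1) * (1 + Ω * ‖x - y‖) ^ (-(α + D / 2 + 1))) ≤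
      ENNReal.ofReal (C * growth (D + 1) α (Ω ^ (D + 1) * volume.real E) *
        min (Ω ^ (D + 1) * volume.real E) 1) := by
  obtain ⟨C, hC, hCb⟩ := exists_rpow_le_growth D α
  set ω := volume.real (Metric.ball (0 : Eucl (D + 1)) 1) with hω
  have hω0 : 0 ≤ ω := measureReal_nonneg
  have hD0 : (0 : ℝ) ≤ D / 2 := by positivity
  have hp : 0 < α + D / 2 + 1 := by linarith
  refine ⟨1 + ((D : ℝ) + 1) * ω * C + C, by positivity, fun Ω hΩ x E hE => ?_⟩
  set u := Ω ^ (D + 1) * volume.real E with hu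
  have hu0 : 0 ≤ u := by positivity
  have hg := one_le_growth (D + 1) α hu0
  set f : Eucl (D + 1) → ℝ := fun t => Ω ^ (D + 1) * (1 + Ω * ‖t‖) ^ (-(α + D / 2 + 1)) with hf
  have hle : ∀ {ρ : ℝ}, 0 ≤ ρ → ∀ t : Eucl (D + 1), ρ ≤ ‖t‖ →
      f t ≤ Ω ^ (D + 1) * (1 + Ω * ρ) ^ (-(α + D / 2 + 1)) := by
    intro ρ hρ t ht
    refine mul_le_mul_of_nonneg_left (Real.rpow_le_rpow_of_nonpos ?_ ?_ (by linarith)) (by positivity)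
    · have := mul_nonneg hΩ.le hρ
      linarith
    · gcongr
  have hEr : volume E = ENNReal.ofReal (volume.real E) := (ENNReal.ofReal_toReal hE.ne).symm
  have hconst : ∀ {c : ℝ}, 0 ≤ c → ENNReal.ofReal c * volume E = ENNReal.ofReal (c * volume.real E) :=
    fun hc => by rw [hEr, ENNReal.ofReal_mul hc]
  -- For `u ≤ 1` the supremum `Ω^(D+1)` of the integrand suffices. For `u ≥ 1` the space is cut at
  -- the distance `ρ` with `(Ωρ)^(D+1) = u`: inside, the whole ball is integrated; outside, the
  -- value at distance `ρ` multiplies `|E|`.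
  rcases le_total u 1 with h1 | h1
  · calc ∫⁻ y in E, ENNReal.ofReal (f (x - y)) ≤ ∫⁻ _ in E, ENNReal.ofReal (Ω ^ (D + 1)) := by
          refine lintegral_mono fun y => ENNReal.ofReal_le_ofReal ?_
          have := hle le_rfl (x - y) (norm_nonneg _)
          simpa using this
      _ = ENNReal.ofReal u := by
          rw [setLIntegral_const, hconst (by positivity)]
      _ ≤ _ := by
          refine ENNReal.ofReal_le_ofReal ?_
          rw [min_eq_left h1]
          refine le_mul_of_one_le_left hu0 ?_
          have : 0 ≤ ((D : ℝ) + 1) * ω * C + C := by positivity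
          nlinarith
  · set r := u ^ (1 / ((D : ℝ) + 1)) with hr
    have hr0 : 0 ≤ r := Real.rpow_nonneg hu0 _
    have hrpow : r ^ (D + 1) = u := by
      have := Real.rpow_inv_natCast_pow hu0 (Nat.succ_ne_zero D)
      rw [hr, one_div]
      push_cast at this
      exact this
    set ρ := r / Ω with hρ
    have hρ0 : 0 ≤ ρ := by positivity
    have hΩρ : Ω * ρ = r := by rw [hρ]; field_simp
    obtain ⟨hb1, hb2⟩ := hCb u r hr0 (rpow_inv_le_one_add hu0 D) hu0
    have hsplit : E ⊆ (fun y => x - y) ⁻¹' Metric.ball 0 ρ ∪ E ∩ {y | ρ ≤ ‖x - y‖} := by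
      intro y hy
      rcases lt_or_ge ‖x - y‖ ρ with h | h
      · left; simpa using h
      · exact Or.inr ⟨hy, h⟩
    have hball : ∫⁻ y in (fun y => x - y) ⁻¹' Metric.ball 0 ρ, ENNReal.ofReal (f (x - y)) =
        ∫⁻ t in Metric.ball 0 ρ, ENNReal.ofReal (f t) :=
      (Measure.measurePreserving_sub_left volume x).setLIntegral_comp_preimage_emb
        (MeasurableEquiv.subLeft x).measurableEmbedding (fun t => ENNReal.ofReal (f t)) _
    have htail : ∫⁻ y in E ∩ {y | ρ ≤ ‖x - y‖}, ENNReal.ofReal (f (x - y)) ≤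
        ENNReal.ofReal ((1 + r) ^ ((D : ℝ) / 2 - α)) := by
      have hms : MeasurableSet {y : Eucl (D + 1) | ρ ≤ ‖x - y‖} :=
        (isClosed_le continuous_const (by fun_prop)).measurableSet
      calc _ ≤ ∫⁻ _ in E ∩ {y | ρ ≤ ‖x - y‖},
            ENNReal.ofReal (Ω ^ (D + 1) * (1 + r) ^ (-(α + D / 2 + 1))) := by
            -- `E` is not assumed measurable, so the measure is restricted to `E` first and then to
            -- the measurable set `{ρ ≤ ‖x - y‖}`, where the pointwise bound applies.
            rw [inter_comm, ← Measure.restrict_restrict hms]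
            refine setLIntegral_mono' hms fun y hy => ENNReal.ofReal_le_ofReal ?_
            rw [← hΩρ]
            exact hle hρ0 _ hy
        _ ≤ ENNReal.ofReal (Ω ^ (D + 1) * (1 + r) ^ (-(α + D / 2 + 1))) * volume E := by
            rw [setLIntegral_const]
            gcongr
            exact inter_subset_left
        _ = ENNReal.ofReal (u * (1 + r) ^ (-(α + D / 2 + 1))) := by
            rw [hconst (mul_nonneg (by positivity) (Real.rpow_nonneg (by linarith) _)), hu]
            congr 1; ring
        _ ≤ _ := by
            refine ENNReal.ofReal_le_ofReal ?_
            have h2 : u ≤ (1 + r) ^ (D + 1) := by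
              rw [← hrpow]; exact pow_le_pow_left₀ hr0 (by linarith) _
            calc _ ≤ (1 + r) ^ (D + 1) * (1 + r) ^ (-(α + D / 2 + 1)) :=
                  mul_le_mul_of_nonneg_right h2 (Real.rpow_nonneg (by linarith) _)
              _ = _ := by
                  rw [← Real.rpow_natCast, ← Real.rpow_add (by linarith)]
                  congr 1; push_cast; ring
    calc ∫⁻ y in E, ENNReal.ofReal (f (x - y)) ≤
          ∫⁻ y in (fun y => x - y) ⁻¹' Metric.ball 0 ρ ∪ E ∩ {y | ρ ≤ ‖x - y‖},
            ENNReal.ofReal (f (x - y)) := lintegral_mono_set hsplit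
      _ ≤ _ := lintegral_union_le _ _ _
      _ ≤ ENNReal.ofReal (((D : ℝ) + 1) * ω * ∫ s in (0 : ℝ)..r, (1 + s) ^ ((D : ℝ) / 2 - α - 1)) +
          ENNReal.ofReal ((1 + r) ^ ((D : ℝ) / 2 - α)) := by
          rw [hball, ← hΩρ] at *
          exact add_le_add (lintegral_ball_decay_le α hΩ hρ0) htail
      _ = ENNReal.ofReal (((D : ℝ) + 1) * ω * (∫ s in (0 : ℝ)..r, (1 + s) ^ ((D : ℝ) / 2 - α - 1)) +
          (1 + r) ^ ((D : ℝ) / 2 - α)) := by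
          refine (ENNReal.ofReal_add (mul_nonneg (by positivity) ?_)
            (Real.rpow_nonneg (by linarith) _)).symm
          exact intervalIntegral.integral_nonneg hr0 fun s hs =>
            Real.rpow_nonneg (by linarith [hs.1]) _
      _ ≤ _ := by
          refine ENNReal.ofReal_le_ofReal ?_
          rw [min_eq_right h1, mul_one]
          have h3 : ((D : ℝ) + 1) * ω * (∫ s in (0 : ℝ)..r, (1 + s) ^ ((D : ℝ) / 2 - α - 1)) ≤
              ((D : ℝ) + 1) * ω * (C * growth (D + 1) α u) :=
            mul_le_mul_of_nonneg_left hb2 (by positivity)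
          nlinarith

end SetEstimate

/-! ### The multiplication formula and the transform of the weights. -/

section FourierIntegral

variable {V : Type*} [NormedAddCommGroup V] [InnerProductSpace ℝ V] [FiniteDimensional ℝ V]
  [MeasurableSpace V] [BorelSpace V]

lemma integral_fourier_mul_eq {f g : V → ℂ} (hf : Integrable f volume) (hg : Integrable g volume) :
    ∫ ξ, 𝓕 f ξ * g ξ = ∫ x, f x * 𝓕 g x := by
  simpa using! VectorFourier.integral_fourierIntegral_smul_eq_flip (L := innerₗ V)
    Real.continuous_fourierChar continuous_inner hf hg

lemma continuous_fourier {f : V → ℂ} (hf : Integrable f volume) : Continuous (𝓕 f) :=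
  VectorFourier.fourierIntegral_continuous Real.continuous_fourierChar
    (L := innerₗ V) continuous_inner hf

lemma norm_fourier_le (f : V → ℂ) (ξ : V) : ‖𝓕 f ξ‖ ≤ ∫ x, ‖f x‖ :=
  VectorFourier.norm_fourierIntegral_le_integral_norm _ _ _ _ _

lemma integrable_fourier_mul {f g : V → ℂ} (hf : Integrable f volume) (hg : Integrable g volume) :
    Integrable (fun ξ => 𝓕 f ξ * g ξ) volume :=
  hg.bdd_mul (continuous_fourier hf).aestronglyMeasurable
    (Filter.Eventually.of_forall (norm_fourier_le f))

lemma fourier_rieszWeight [Nontrivial V] {γ : ℝ} (hγ : -1 < γ) {R : ℝ} (hR : 0 < R) (t : V) :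
    𝓕 (fun ξ : V => (rieszWeight γ R ξ : ℂ)) t = rieszKernel γ R t := by
  rw [← integral_rieszWeight_mul_cexp hγ hR, Real.fourier_eq',
    ← integral_neg_eq_self (μ := (volume : Measure V))]
  refine integral_congr_ae (Filter.Eventually.of_forall fun ξ => ?_)
  simp only [rieszWeight_neg, smul_eq_mul, inner_neg_left, real_inner_comm ξ t]
  rw [mul_comm]
  congr 3
  push_cast
  ring

lemma cexp_two_pi_I_mul (r : ℝ) :
    Complex.exp (2 * (Real.pi : ℂ) * Complex.I * (r : ℂ)) =
      Complex.exp (((2 * Real.pi * r : ℝ) : ℂ) * Complex.I) := by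
  congr 1; push_cast; ring

lemma integrable_modulated_rieszWeight [Nontrivial V] {γ : ℝ} (hγ : -1 < γ) {R : ℝ} (hR : 0 < R)
    (a x : V) : Integrable (fun ξ : V => (rieszWeight γ R (ξ - a) : ℂ) *
      Complex.exp (2 * (Real.pi : ℂ) * Complex.I * ((inner ℝ x ξ : ℝ) : ℂ))) volume := by
  simp only [cexp_two_pi_I_mul]
  refine Integrable.mul_bdd (c := 1) ((rieszWeight_integrable hγ hR).comp_sub_right a).ofReal ?_ ?_
  · exact (by fun_prop : Continuous _).aestronglyMeasurable
  · exact Filter.Eventually.of_forall fun ξ => (Complex.norm_exp_ofReal_mul_I _).le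

/-- Moving the weight to `a` multiplies its transform by a phase, and modulating by `x` translates
it, so `a` disappears from the modulus. This gives uniformity in `a`. -/
lemma norm_fourier_modulated_rieszWeight [Nontrivial V] {γ : ℝ} (hγ : -1 < γ) {R : ℝ} (hR : 0 < R)
    (a x t : V) : ‖𝓕 (fun ξ : V => (rieszWeight γ R (ξ - a) : ℂ) *
      Complex.exp (2 * (Real.pi : ℂ) * Complex.I * ((inner ℝ x ξ : ℝ) : ℂ))) t‖ =
      |rieszKernel γ R (x - t)| := by
  simp only [cexp_two_pi_I_mul]
  have h : 𝓕 (fun ξ : V => (rieszWeight γ R (ξ - a) : ℂ) *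
      Complex.exp (((2 * Real.pi * inner ℝ x ξ : ℝ) : ℂ) * Complex.I)) t =
      Complex.exp (((2 * Real.pi * inner ℝ (x - t) a : ℝ) : ℂ) * Complex.I) *
        (rieszKernel γ R (x - t) : ℂ) := by
    rw [← integral_rieszWeight_mul_cexp hγ hR, Real.fourier_eq', ← integral_const_mul,
      ← integral_add_right_eq_self _ a]
    refine integral_congr_ae (Filter.Eventually.of_forall fun ξ => ?_)
    simp only [add_sub_cancel_right, smul_eq_mul]
    rw [mul_left_comm, mul_left_comm (Complex.exp _) (rieszWeight γ R ξ : ℂ), ← Complex.exp_add,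
      ← Complex.exp_add]
    congr 2
    rw [inner_add_left, inner_add_right, inner_sub_left, inner_sub_left, real_inner_comm t ξ,
      real_inner_comm t a]
    push_cast
    ring
  rw [h, norm_mul, Complex.norm_exp_ofReal_mul_I, one_mul, Complex.norm_real, Real.norm_eq_abs]

end FourierIntegral

/-! ### Layer-cake formulas. -/

section Integrable

variable {d : ℕ} {V : Type*} [NormedAddCommGroup V] [InnerProductSpace ℝ V] [FiniteDimensional ℝ V]
  [MeasurableSpace V] [BorelSpace V]

lemma lintegral_distr {φ : Eucl d → ℂ} (hφ : Integrable φ volume) :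
    ∫⁻ t in Ioi (0 : ℝ), ENNReal.ofReal (distr φ t) = ∫⁻ y, ENNReal.ofReal ‖φ y‖ := by
  rw [lintegral_eq_lintegral_meas_lt _ (Filter.Eventually.of_forall fun y => norm_nonneg _)
    hφ.aemeasurable.norm]
  refine setLIntegral_congr_fun measurableSet_Ioi fun t ht => ?_
  rw [distr, Measure.real, ENNReal.ofReal_toReal (hφ.measure_norm_gt_lt_top ht).ne]

lemma integrableOn_distr {φ : Eucl d → ℂ} (hφ : Integrable φ volume) :
    IntegrableOn (distr φ) (Ioi 0) := by
  refine ⟨(measurable_distr φ).aestronglyMeasurable, ?_⟩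
  rw [hasFiniteIntegral_iff_ofReal (Filter.Eventually.of_forall (distr_nonneg φ)),
    lintegral_distr hφ]
  exact (hasFiniteIntegral_iff_norm φ).1 hφ.2

lemma integrable_layerCake_ballStar [Nontrivial V] {φ : Eucl d → ℂ} (hφ : Integrable φ volume) :
    Integrable (layerCake (ballStar V) φ) volume := by
  refine ⟨(measurable_layerCake_ballStar φ).aestronglyMeasurable, ?_⟩
  rw [hasFiniteIntegral_iff_ofReal (Filter.Eventually.of_forall (layerCake_nonneg _ φ))]
  have h := lintegral_rpow_eq_of_equimeasurable (layerCake_nonneg (ballStar V) φ)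
    (fun y => norm_nonneg (φ y)) (μ := volume) (ν := volume)
    (measurable_layerCake_ballStar φ).aemeasurable hφ.aemeasurable.norm
    (fun t ht => volume_lt_layerCake_ballStar hφ.aemeasurable
      (fun s hs => hφ.measure_norm_gt_lt_top hs) ht) one_pos
  simp only [Real.rpow_one] at h
  rw [h]
  exact (hasFiniteIntegral_iff_norm φ).1 hφ.2

/-- The integral is `∫ distr φ = ‖φ‖₁`. This allows the integrals in space and in level to be
exchanged. -/
lemma integrable_ballStar_indicator [Nontrivial V] {φ : Eucl d → ℂ} (hφ : Integrable φ volume) :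
    Integrable (fun p : V × ℝ => (ballStar V {y | p.2 < ‖φ y‖}).indicator (fun _ => (1 : ℝ)) p.1)
      (volume.prod (volume.restrict (Ioi 0))) := by
  have hG := measurableSet_ballStar_graph (V := V) φ
  have e : (fun p : V × ℝ => (ballStar V {y | p.2 < ‖φ y‖}).indicator (fun _ => (1 : ℝ)) p.1) =
      {p : V × ℝ | p.1 ∈ ballStar V {y | p.2 < ‖φ y‖}}.indicator fun _ => 1 := by
    ext p; simp [indicator]
  rw [e, integrable_indicator_iff hG]
  refine integrableOn_const ?_
  rw [Measure.prod_apply_symm hG]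
  have : ∀ t : ℝ, volume ((fun x : V => (x, t)) ⁻¹'
      {p : V × ℝ | p.1 ∈ ballStar V {y | p.2 < ‖φ y‖}}) = ENNReal.ofReal (distr φ t) :=
    fun t => volume_ball_ballRadius V (distr_nonneg φ t)
  simp only [this]
  rw [lintegral_distr hφ]
  exact ((hasFiniteIntegral_iff_norm φ).1 hφ.2).ne

/-- Layer-cake formula for integrals against the rearrangement. -/
lemma integral_layerCake_mul [Nontrivial V] {φ : Eucl d → ℂ} (hφ : Integrable φ volume)
    {K : V → ℝ} (hK : Continuous K) {M : ℝ} (hM : ∀ t, |K t| ≤ M) :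
    IntegrableOn (fun t => ∫ x in Metric.ball (0 : V) (ballRadius V (distr φ t)), K x) (Ioi 0) ∧
    ∫ x, layerCake (ballStar V) φ x * K x =
      ∫ t in Ioi (0 : ℝ), ∫ x in Metric.ball (0 : V) (ballRadius V (distr φ t)), K x := by
  have hint : Integrable (fun p : V × ℝ =>
      (ballStar V {y | p.2 < ‖φ y‖}).indicator (fun _ => (1 : ℝ)) p.1 * K p.1)
      (volume.prod (volume.restrict (Ioi 0))) :=
    (integrable_ballStar_indicator hφ).mul_bdd (c := M)
      (hK.comp continuous_fst).aestronglyMeasurable (Filter.Eventually.of_forall fun p => hM p.1)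
  have hin : ∀ t : ℝ, ∫ x in Metric.ball (0 : V) (ballRadius V (distr φ t)), K x =
      ∫ x, (ballStar V {y | t < ‖φ y‖}).indicator (fun _ => (1 : ℝ)) x * K x := by
    intro t
    rw [← integral_indicator measurableSet_ball]
    refine integral_congr_ae (Filter.Eventually.of_forall fun x => ?_)
    simp only [indicator, ballStar, distr]
    split_ifs <;> simp
  simp only [hin]
  refine ⟨hint.integral_prod_right, ?_⟩
  rw [← integral_integral_swap hint]
  simp only [integral_mul_const, layerCake]

/-- The layer-cake formula for `|φ|` with respect to the measure of density `k`. -/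
lemma lintegral_norm_mul_eq {φ : Eucl d → ℂ} (hφ : AEMeasurable φ volume) {k : Eucl d → ENNReal}
    (hk : Measurable k) :
    ∫⁻ y, ENNReal.ofReal ‖φ y‖ * k y =
      ∫⁻ t in Ioi (0 : ℝ), ∫⁻ y in {y | t < ‖φ y‖}, k y := by
  have h := lintegral_eq_lintegral_meas_lt (volume.withDensity k) (f := fun y => ‖φ y‖)
    (Filter.Eventually.of_forall fun y => norm_nonneg _)
    (hφ.norm.mono_ac (withDensity_absolutelyContinuous _ _))
  simp only [withDensity_apply'] at h
  rw [← h, lintegral_withDensity_eq_lintegral_mul₀ hk.aemeasurable hφ.norm.ennreal_ofReal]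
  simp only [Pi.mul_apply, mul_comm]

end Integrable

/-! ### The Bochner-Riesz inequality. -/

/-- Upper bound for the Bochner-Riesz means of `φ` in terms of its distribution function. -/
lemma exists_norm_integral_rieszIntegrand_le (D : ℕ) {α : ℝ} (hα : -1 / 2 < α) :
    ∃ C, 0 < C ∧ ∀ S Ω : ℝ, 0 < S → 0 < Ω → ∀ φ : Eucl (D + 1) → ℂ, Integrable φ volume →
      volume (Function.support φ) ≤ ENNReal.ofReal S → ∀ a x : Eucl (D + 1),
        Integrable (rieszIntegrand φ α Ω a x) volume ∧
        ‖∫ ξ, rieszIntegrand φ α Ω a x ξ‖ ≤ C * growth (D + 1) α (Ω ^ (D + 1) * S) *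
          ∫ t in Ioi (0 : ℝ), min (Ω ^ (D + 1) * distr φ t) 1 := by
  have hα1 : -1 < α := by linarith
  have hfr : Module.finrank ℝ (Eucl (D + 1)) = D + 1 := by simp
  obtain ⟨C₀, hC₀, hK⟩ := exists_abs_rieszKernel_le (V := Eucl (D + 1)) hfr hα1
  obtain ⟨C₁, hC₁, hE⟩ := exists_setLIntegral_decay_le D hα
  refine ⟨(C₀ + 1) * C₁, by positivity, fun S Ω hS hΩ φ hφ hsupp a x => ?_⟩
  set g : Eucl (D + 1) → ℂ := fun ξ => (rieszWeight α Ω (ξ - a) : ℂ) *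
    Complex.exp (2 * (Real.pi : ℂ) * Complex.I * ((inner ℝ x ξ : ℝ) : ℂ)) with hg
  have hgi : Integrable g volume := integrable_modulated_rieszWeight hα1 hΩ a x
  have hri : rieszIntegrand φ α Ω a x = fun ξ => 𝓕 φ ξ * g ξ := by
    ext ξ; simp only [rieszIntegrand, hg, mul_assoc]
  rw [hri]
  refine ⟨integrable_fourier_mul hφ hgi, ?_⟩
  rw [integral_fourier_mul_eq hφ hgi]
  set P : ℝ := growth (D + 1) α (Ω ^ (D + 1) * S) with hP
  have hP1 : 1 ≤ P := one_le_growth _ _ (by positivity)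
  set m : ℝ → ℝ := fun t => min (Ω ^ (D + 1) * distr φ t) 1 with hm
  have hm0 : ∀ t, 0 ≤ m t := fun t =>
    le_min (mul_nonneg (by positivity) (distr_nonneg φ t)) zero_le_one
  have hmint : IntegrableOn m (Ioi 0) := by
    refine Integrable.mono' ((integrableOn_distr hφ).const_mul (Ω ^ (D + 1))) ?_ ?_
    · exact (((measurable_distr φ).const_mul _).min measurable_const).aestronglyMeasurable
    · refine Filter.Eventually.of_forall fun t => ?_
      rw [Real.norm_of_nonneg (hm0 t)]
      exact min_le_left _ _
  -- Superlevel sets lie in the support, so one value of `growth`, taken at `S`, serves all levels.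
  have hdS : ∀ t, 0 < t → distr φ t ≤ S := by
    intro t ht
    refine ENNReal.toReal_le_of_le_ofReal hS.le ((measure_mono fun y hy => ?_).trans hsupp)
    have hy : t < ‖φ y‖ := hy
    exact norm_pos_iff.1 (ht.trans hy)
  have hkm : Measurable fun y : Eucl (D + 1) => ENNReal.ofReal
      (Ω ^ (D + 1) * (1 + Ω * ‖x - y‖) ^ (-(α + D / 2 + 1))) := by fun_prop
  have key : ∫⁻ y, ENNReal.ofReal ‖φ y * 𝓕 g y‖ ≤
      ENNReal.ofReal ((C₀ + 1) * C₁ * P * ∫ t in Ioi (0 : ℝ), m t) := by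
    calc ∫⁻ y, ENNReal.ofReal ‖φ y * 𝓕 g y‖
        ≤ ∫⁻ y, ENNReal.ofReal (C₀ + 1) * (ENNReal.ofReal ‖φ y‖ * ENNReal.ofReal
            (Ω ^ (D + 1) * (1 + Ω * ‖x - y‖) ^ (-(α + D / 2 + 1)))) := by
          refine lintegral_mono fun y => ?_
          rw [← ENNReal.ofReal_mul (norm_nonneg _), ← ENNReal.ofReal_mul (by positivity)]
          refine ENNReal.ofReal_le_ofReal ?_
          rw [norm_mul, hg, norm_fourier_modulated_rieszWeight hα1 hΩ]
          have h1 := hK Ω hΩ (x - y)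
          have h2 : 0 ≤ Ω ^ (D + 1) * (1 + Ω * ‖x - y‖) ^ (-(α + D / 2 + 1)) := by positivity
          calc _ ≤ ‖φ y‖ * ((C₀ + 1) * (Ω ^ (D + 1) * (1 + Ω * ‖x - y‖) ^ (-(α + D / 2 + 1)))) := by
                gcongr; nlinarith
            _ = _ := by ring
      _ = ENNReal.ofReal (C₀ + 1) * ∫⁻ t in Ioi (0 : ℝ), ∫⁻ y in {y | t < ‖φ y‖}, ENNReal.ofReal
            (Ω ^ (D + 1) * (1 + Ω * ‖x - y‖) ^ (-(α + D / 2 + 1))) := by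
          rw [lintegral_const_mul' _ _ ENNReal.ofReal_ne_top, lintegral_norm_mul_eq hφ.aemeasurable hkm]
      _ ≤ ENNReal.ofReal (C₀ + 1) * ∫⁻ t in Ioi (0 : ℝ), ENNReal.ofReal (C₁ * P * m t) := by
          gcongr 1
          refine setLIntegral_mono' measurableSet_Ioi fun t ht => ?_
          refine (hE Ω hΩ x _ (hφ.measure_norm_gt_lt_top ht)).trans (ENNReal.ofReal_le_ofReal ?_)
          refine mul_le_mul_of_nonneg_right (mul_le_mul_of_nonneg_left ?_ hC₁.le) (hm0 t)
          exact growth_mono _ _ (mul_nonneg (by positivity) (distr_nonneg φ t))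
            (mul_le_mul_of_nonneg_left (hdS t ht) (by positivity))
      _ = _ := by
          rw [← ofReal_integral_eq_lintegral_ofReal (hmint.const_mul _)
            (Filter.Eventually.of_forall fun t => mul_nonneg (by positivity) (hm0 t)),
            ← ENNReal.ofReal_mul (by positivity), integral_const_mul]
          congr 1; ring
  have hJ : 0 ≤ ∫ t in Ioi (0 : ℝ), m t := integral_nonneg hm0
  have h1 : ENNReal.ofReal ‖∫ y, φ y * 𝓕 g y‖ ≤
      ENNReal.ofReal ((C₀ + 1) * C₁ * P * ∫ t in Ioi (0 : ℝ), m t) := by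
    refine le_trans ?_ key
    simp only [ofReal_norm]
    exact enorm_integral_le_lintegral_enorm _
  exact (ENNReal.ofReal_le_ofReal_iff (by positivity)).1 h1

/-- The Bochner-Riesz inequality for a rearrangement by centred balls of `V`. -/
theorem exists_rieszIntegrand_le_rearrIntegrand {V : Type*} [NormedAddCommGroup V]
    [InnerProductSpace ℝ V] [FiniteDimensional ℝ V] [MeasurableSpace V] [BorelSpace V] {D n : ℕ}
    (hV : Module.finrank ℝ V = n + 1) {star : Set (Eucl (D + 1)) → Set V} (hs : IsBallStar star)
    {α β : ℝ} (hα : -1 / 2 < α) (hβ : 0 ≤ β) (hβ' : ((n : ℝ) + 1) / 2 - 1 ≤ β) :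
    ∃ C : ℝ, ∀ S Ω R : ℝ, 0 < S → 0 < Ω → 0 < R → R ^ (n + 1) = Ω ^ (D + 1) →
      ∀ φ : Eucl (D + 1) → ℂ, Integrable φ volume →
        volume (Function.support φ) ≤ ENNReal.ofReal S →
        Integrable (layerCake star φ) volume ∧
        Integrable (rearrIntegrand (layerCake star φ) β R) volume ∧
        (∫ ξ : V, rearrIntegrand (layerCake star φ) β R ξ).im = 0 ∧
        ∀ a x : Eucl (D + 1), Integrable (rieszIntegrand φ α Ω a x) volume ∧
          ‖∫ ξ, rieszIntegrand φ α Ω a x ξ‖ ≤ C * growth (D + 1) α (Ω ^ (D + 1) * S) *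
            (∫ ξ : V, rearrIntegrand (layerCake star φ) β R ξ).re := by
  have : Nontrivial V := Module.nontrivial_of_finrank_pos (R := ℝ) (by omega)
  have hβ1 : -1 < β := by linarith
  obtain ⟨C, hC, hup⟩ := exists_norm_integral_rieszIntegrand_le D hα
  obtain ⟨c, hc, hlow⟩ := exists_le_integral_ball_rieszKernel hV hβ hβ'
  obtain ⟨C₀, hC₀, hK⟩ := exists_abs_rieszKernel_le hV hβ1
  set ω := volume.real (Metric.ball (0 : V) 1) with hω
  have hω0 : 0 < ω := volume_real_ball_one_pos V
  -- With `v = Ω^(D+1) distr φ t` the ball at level `t` has `(R r)^(n+1) = v / ω`; passing from `min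
  -- (v/ω) 1` to `min v 1` costs the factor `min (1/ω) 1`.
  set c₁ : ℝ := c * min (1 / ω) 1 with hc₁
  have hc₁0 : 0 < c₁ := mul_pos hc (lt_min (by positivity) one_pos)
  refine ⟨C / c₁, fun S Ω R hS hΩ hR hRΩ φ hφ hsupp => ?_⟩
  have hae := layerCake_ae_eq hs φ
  have hui : Integrable (layerCake star φ) volume := (integrable_layerCake_ballStar hφ).congr hae.symm
  have hwi : Integrable (fun ξ : V => (rieszWeight β R ξ : ℂ)) volume :=
    (rieszWeight_integrable hβ1 hR).ofReal
  have hri : rearrIntegrand (layerCake star φ) β R =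
      fun ξ => 𝓕 (fun t => (layerCake star φ t : ℂ)) ξ * (rieszWeight β R ξ : ℂ) := by
    ext ξ; rw [rearrIntegrand, mul_comm]
  have hKb : ∀ t : V, |rieszKernel β R t| ≤ C₀ * R ^ (n + 1) := by
    intro t
    refine (hK R hR t).trans (mul_le_mul_of_nonneg_left ?_ hC₀)
    refine mul_le_of_le_one_right (by positivity) (Real.rpow_le_one_of_one_le_of_nonpos ?_ ?_)
    · have : 0 ≤ R * ‖t‖ := by positivity
      linarith
    · have : (0 : ℝ) ≤ n / 2 := by positivity
      linarith
  obtain ⟨hLi, hL⟩ := integral_layerCake_mul hφ (continuous_rieszKernel hV hβ1 hR) hKb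
  have hval : ∫ ξ : V, rearrIntegrand (layerCake star φ) β R ξ =
      ((∫ t in Ioi (0 : ℝ), ∫ x in Metric.ball (0 : V) (ballRadius V (distr φ t)),
        rieszKernel β R x : ℝ) : ℂ) := by
    rw [← hL, hri, ← integral_complex_ofReal]
    refine (integral_fourier_mul_eq hui.ofReal hwi).trans (integral_congr_ae ?_)
    filter_upwards [hae] with t ht
    rw [fourier_rieszWeight hβ1 hR, ht, Complex.ofReal_mul]
    rfl
  refine ⟨hui, ?_, ?_, fun a x => ?_⟩
  · rw [hri]
    exact integrable_fourier_mul hui.ofReal hwi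
  · rw [hval, Complex.ofReal_im]
  · obtain ⟨h1, h2⟩ := hup S Ω hS hΩ φ hφ hsupp a x
    refine ⟨h1, h2.trans ?_⟩
    rw [hval, Complex.ofReal_re]
    have hP : 0 ≤ growth (D + 1) α (Ω ^ (D + 1) * S) :=
      zero_le_one.trans (one_le_growth _ _ (by positivity))
    have hJ : c₁ * ∫ t in Ioi (0 : ℝ), min (Ω ^ (D + 1) * distr φ t) 1 ≤
        ∫ t in Ioi (0 : ℝ), ∫ x in Metric.ball (0 : V) (ballRadius V (distr φ t)),
          rieszKernel β R x := by
      rw [← integral_const_mul]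
      refine integral_mono_of_nonneg (Filter.Eventually.of_forall fun t => ?_) hLi
        (Filter.Eventually.of_forall fun t => ?_)
      · exact mul_nonneg hc₁0.le
          (le_min (mul_nonneg (by positivity) (distr_nonneg φ t)) zero_le_one)
      · refine le_trans ?_ (hlow R hR _ (ballRadius_nonneg V _ (distr_nonneg φ t)))
        have hpow : (R * ballRadius V (distr φ t)) ^ (n + 1) = Ω ^ (D + 1) * distr φ t * (1 / ω) := by
          rw [mul_pow, hRΩ, ← hV, ballRadius_pow V (distr_nonneg φ t)]
          ring
        rw [hpow]
        dsimp only
        rw [hc₁, mul_assoc]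
        refine mul_le_mul_of_nonneg_left ?_ hc.le
        have hu : 0 ≤ Ω ^ (D + 1) * distr φ t := mul_nonneg (by positivity) (distr_nonneg φ t)
        have hi0 : 0 < min (1 / ω) 1 := lt_min (by positivity) one_pos
        refine le_min ?_ ?_
        · calc _ ≤ (1 / ω) * (Ω ^ (D + 1) * distr φ t) :=
              mul_le_mul (min_le_left _ _) (min_le_left _ _) (le_min hu zero_le_one) (by positivity)
            _ = _ := mul_comm _ _
        · exact mul_le_one₀ (min_le_right _ _) (le_min hu zero_le_one) (min_le_right _ _)
    calc _ = C / c₁ * growth (D + 1) α (Ω ^ (D + 1) * S) *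
          (c₁ * ∫ t in Ioi (0 : ℝ), min (Ω ^ (D + 1) * distr φ t) 1) := by
          field_simp
      _ ≤ _ := by gcongr

/-! ### The Fourier transform on `L²`. -/

section Plancherel

variable {V : Type*} [NormedAddCommGroup V] [InnerProductSpace ℝ V] [FiniteDimensional ℝ V]
  [MeasurableSpace V] [BorelSpace V]

open SchwartzMap in
/-- On `L¹ ∩ L²` the Fourier transform on `L²` is given by the Fourier integral. -/
lemma fourier_toLp_ae_eq {f : V → ℂ} (h1 : Integrable f volume) (h2 : MemLp f 2 volume) :
    (𝓕 (h2.toLp f) : Lp ℂ 2 (volume : Measure V)) =ᵐ[volume] 𝓕 f := by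
  -- Both sides are tested on smooth compactly supported functions: the `L²` transform agrees with
  -- that of tempered distributions, and the Fourier integral obeys the multiplication formula.
  refine ae_eq_of_integral_contDiff_smul_eq ((Lp.memLp _).locallyIntegrable (by norm_num))
    (continuous_fourier h1).locallyIntegrable fun g hg hgc => ?_
  have hgc' : HasCompactSupport fun x => (g x : ℂ) :=
    hgc.comp_left (g := fun r : ℝ => (r : ℂ)) Complex.ofReal_zero
  have hg' : ContDiff ℝ (⊤ : ℕ∞) fun x => (g x : ℂ) := Complex.ofRealCLM.contDiff.comp hg
  set G : 𝓢(V, ℂ) := hgc'.toSchwartzMap hg' with hG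
  have hGapp : ∀ x, G x = (g x : ℂ) := fun x => rfl
  have h := congrArg (fun T => T G) (Lp.fourier_toTemperedDistribution_eq (h2.toLp f))
  simp only [TemperedDistribution.fourier_apply, Lp.toTemperedDistribution_apply, hGapp] at h
  have e1 : ∫ x, (𝓕 G) x • (h2.toLp f : V → ℂ) x = ∫ x, f x * 𝓕 (G : V → ℂ) x := by
    refine integral_congr_ae ?_
    filter_upwards [h2.coeFn_toLp] with x hx
    rw [hx, SchwartzMap.fourier_coe, smul_eq_mul, mul_comm]
  rw [e1, ← integral_fourier_mul_eq h1 G.integrable] at h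
  simp only [Complex.real_smul, smul_eq_mul] at h ⊢
  rw [← h]
  exact integral_congr_ae (Filter.Eventually.of_forall fun x => mul_comm _ _)

lemma Lp_norm_sq_eq_integral {X : Type*} [MeasurableSpace X] {μ : Measure X} (F : Lp ℂ 2 μ) :
    ‖F‖ ^ 2 = ∫ x, ‖F x‖ ^ 2 ∂μ := by
  have h := L2.inner_def (𝕜 := ℂ) F F
  simp only [inner_self_eq_norm_sq_to_K] at h
  have h2 : ∫ x, ((‖F x‖ : ℂ)) ^ 2 ∂μ = ((∫ x, ‖F x‖ ^ 2 ∂μ : ℝ) : ℂ) := by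
    rw [← integral_complex_ofReal]
    simp
  refine Complex.ofReal_injective ?_
  rw [← h2, Complex.ofReal_pow]
  exact h

lemma integrable_norm_sq_Lp {X : Type*} [MeasurableSpace X] {μ : Measure X} (F : Lp ℂ 2 μ) :
    Integrable (fun x => ‖F x‖ ^ 2) μ :=
  (memLp_two_iff_integrable_sq_norm (Lp.memLp F).1).1 (Lp.memLp F)

/-- The squared norm of the restriction to `B`. Its continuity carries the lower bounds from
truncations to all of `L²`. -/
lemma continuous_setIntegral_norm_sq (B : Set V) :
    Continuous fun F : Lp ℂ 2 (volume : Measure V) => ∫ x in B, ‖F x‖ ^ 2 := by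
  have h : (fun F : Lp ℂ 2 (volume : Measure V) => ∫ x in B, ‖F x‖ ^ 2) =
      fun F => ‖LpToLpRestrictCLM V ℂ ℂ volume 2 B F‖ ^ 2 := by
    ext F
    rw [Lp_norm_sq_eq_integral]
    refine integral_congr_ae ?_
    filter_upwards [LpToLpRestrictCLM_coeFn ℂ B F] with x hx
    rw [hx]
  rw [h]
  fun_prop

lemma norm_sq_fourier_toLp {f : V → ℂ} (hf : MemLp f 2 volume) :
    ∫ ξ, ‖(𝓕 (hf.toLp f) : Lp ℂ 2 (volume : Measure V)) ξ‖ ^ 2 = ∫ x, ‖f x‖ ^ 2 := by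
  rw [← Lp_norm_sq_eq_integral, Lp.norm_fourier_eq, Lp_norm_sq_eq_integral]
  refine integral_congr_ae ?_
  filter_upwards [hf.coeFn_toLp] with x hx
  rw [hx]

end Plancherel

/-! ### Lower bound for the low-frequency mass of an integrable function. -/

section LowerBound

variable {V : Type*} [NormedAddCommGroup V] [InnerProductSpace ℝ V] [FiniteDimensional ℝ V]
  [MeasurableSpace V] [BorelSpace V]

lemma integrable_mul_cos {u : V → ℝ} (hu : Integrable u volume) (ξ : V) :
    Integrable (fun s => u s * Real.cos (2 * Real.pi * inner ℝ s ξ)) volume :=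
  hu.mul_bdd (c := 1) (by fun_prop : Continuous _).aestronglyMeasurable
    (Filter.Eventually.of_forall fun _ => Real.abs_cos_le_one _)

lemma integrable_mul_sin {u : V → ℝ} (hu : Integrable u volume) (ξ : V) :
    Integrable (fun s => u s * Real.sin (2 * Real.pi * inner ℝ s ξ)) volume :=
  hu.mul_bdd (c := 1) (by fun_prop : Continuous _).aestronglyMeasurable
    (Filter.Eventually.of_forall fun _ => Real.abs_sin_le_one _)

lemma norm_sq_fourier_ofReal {u : V → ℝ} (hu : Integrable u volume) (ξ : V) :
    ‖𝓕 (fun t => (u t : ℂ)) ξ‖ ^ 2 =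
      ∫ p : V × V, u p.1 * u p.2 * Real.cos (2 * Real.pi * inner ℝ ξ (p.1 - p.2)) := by
  have hF : 𝓕 (fun t => (u t : ℂ)) ξ =
      ((∫ s, u s * Real.cos (2 * Real.pi * inner ℝ s ξ) : ℝ) : ℂ) -
        ((∫ s, u s * Real.sin (2 * Real.pi * inner ℝ s ξ) : ℝ) : ℂ) * Complex.I := by
    rw [Real.fourier_eq', ← integral_complex_ofReal, ← integral_complex_ofReal, ← integral_mul_const,
      ← integral_sub (integrable_mul_cos hu ξ).ofReal
        ((integrable_mul_sin hu ξ).ofReal.mul_const _)]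
    refine integral_congr_ae (Filter.Eventually.of_forall fun s => ?_)
    simp only [smul_eq_mul]
    rw [Complex.exp_mul_I, ← Complex.ofReal_cos, ← Complex.ofReal_sin]
    have e : -2 * Real.pi * inner ℝ s ξ = -(2 * Real.pi * inner ℝ s ξ) := by ring
    rw [e, Real.cos_neg, Real.sin_neg]
    push_cast
    ring
  have hsq : ‖𝓕 (fun t => (u t : ℂ)) ξ‖ ^ 2 =
      (∫ s, u s * Real.cos (2 * Real.pi * inner ℝ s ξ)) * (∫ s, u s * Real.cos (2 * Real.pi * inner ℝ s ξ)) +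
        (∫ s, u s * Real.sin (2 * Real.pi * inner ℝ s ξ)) *
          (∫ s, u s * Real.sin (2 * Real.pi * inner ℝ s ξ)) := by
    rw [hF, ← Complex.normSq_eq_norm_sq, Complex.normSq_apply]
    simp
  rw [hsq, ← integral_prod_mul, ← integral_prod_mul,
    ← integral_add ((integrable_mul_cos hu ξ).mul_prod (integrable_mul_cos hu ξ))
      ((integrable_mul_sin hu ξ).mul_prod (integrable_mul_sin hu ξ))]
  refine integral_congr_ae (Filter.Eventually.of_forall fun p => ?_)
  simp only
  rw [inner_sub_right, mul_sub, Real.cos_sub, real_inner_comm p.1 ξ, real_inner_comm p.2 ξ]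
  ring

/-- The cosine transform of the indicator function of a ball. -/
noncomputable def ballCos (r : ℝ) (x : V) : ℝ :=
  ∫ η in Metric.ball (0 : V) r, Real.cos (2 * Real.pi * inner ℝ η x)

lemma integrableOn_ball_of_continuous {f : V → ℝ} (hf : Continuous f) (r : ℝ) :
    IntegrableOn f (Metric.ball (0 : V) r) :=
  (hf.continuousOn.integrableOn_compact (isCompact_closedBall 0 r)).mono_set
    Metric.ball_subset_closedBall

/-- The double integral is the sum of the squares of a cosine and a sine integral, and the latter is
dropped. -/
lemma ballCos_sq_le (r : ℝ) (x : V) :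
    ballCos r x ^ 2 ≤ ∫ q, Real.cos (2 * Real.pi * inner ℝ (q.1 - q.2) x)
      ∂((volume.restrict (Metric.ball (0 : V) r)).prod (volume.restrict (Metric.ball (0 : V) r))) := by
  have hc : IntegrableOn (fun η => Real.cos (2 * Real.pi * inner ℝ η x)) (Metric.ball (0 : V) r) :=
    integrableOn_ball_of_continuous (by fun_prop) r
  have hs : IntegrableOn (fun η => Real.sin (2 * Real.pi * inner ℝ η x)) (Metric.ball (0 : V) r) :=
    integrableOn_ball_of_continuous (by fun_prop) r
  simp only [inner_sub_left, mul_sub, Real.cos_sub]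
  rw [integral_add (hc.mul_prod hc) (hs.mul_prod hs),
    integral_prod_mul (fun η => Real.cos (2 * Real.pi * inner ℝ η x))
      (fun η => Real.cos (2 * Real.pi * inner ℝ η x)),
    integral_prod_mul (fun η => Real.sin (2 * Real.pi * inner ℝ η x))
      (fun η => Real.sin (2 * Real.pi * inner ℝ η x)), ballCos, sq]
  exact le_add_of_nonneg_right (mul_self_nonneg _)

/-- The phase is at most `2π · (R/2) · 1/(3R) = π/3`, where the cosine is at least `1/2`. -/
lemma half_volume_le_ballCos {R : ℝ} (hR : 0 < R) {x : V} (hx : ‖x‖ ≤ 1 / (3 * R)) :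
    volume.real (Metric.ball (0 : V) (R / 2)) / 2 ≤ ballCos (R / 2) x := by
  have h : ∫ _ in Metric.ball (0 : V) (R / 2), (1 / 2 : ℝ) ≤ ballCos (R / 2) x := by
    refine setIntegral_mono_on (integrableOn_const measure_ball_lt_top.ne)
      (integrableOn_ball_of_continuous (by fun_prop) _) measurableSet_ball fun η hη => ?_
    rw [mem_ball_zero_iff] at hη
    rw [← Real.cos_pi_div_three, ← Real.cos_abs (2 * Real.pi * inner ℝ η x)]
    refine Real.cos_le_cos_of_nonneg_of_le_pi (abs_nonneg _) (by linarith [Real.pi_pos]) ?_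
    rw [abs_mul, abs_of_pos (by positivity : 0 < 2 * Real.pi)]
    have h1 : |inner ℝ η x| ≤ R / 2 * (1 / (3 * R)) :=
      (abs_real_inner_le_norm η x).trans (mul_le_mul hη.le hx (norm_nonneg _) (by positivity))
    have h2 : R / 2 * (1 / (3 * R)) = 1 / 6 := by field_simp; norm_num
    rw [h2] at h1
    nlinarith [Real.pi_pos]
  rw [setIntegral_const, smul_eq_mul] at h
  linarith

/-- A lower bound for the mass of the Fourier transform of a nonnegative function in a ball. -/
lemma integral_mul_ballCos_sq_le {u : V → ℝ} (hu : Integrable u volume) (hu0 : ∀ x, 0 ≤ u x) (R : ℝ) :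
    ∫ p : V × V, u p.1 * u p.2 * ballCos (R / 2) (p.1 - p.2) ^ 2 ≤
      volume.real (Metric.ball (0 : V) (R / 2)) *
        ∫ ξ in Metric.ball (0 : V) R, ‖𝓕 (fun t => (u t : ℂ)) ξ‖ ^ 2 := by
  set B : Set V := Metric.ball (0 : V) (R / 2) with hB
  set ν : Measure (V × V) := (volume.restrict B).prod (volume.restrict B) with hν
  have : IsFiniteMeasure (volume.restrict B) := ⟨by simpa using measure_ball_lt_top⟩
  set f : V → ℝ := fun ξ => ‖𝓕 (fun t => (u t : ℂ)) ξ‖ ^ 2 with hf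
  have hfc : Continuous f := (continuous_fourier hu.ofReal).norm.pow 2
  have hfb : ∀ ξ, ‖f ξ‖ ≤ (∫ x, ‖(u x : ℂ)‖) ^ 2 := fun ξ => by
    rw [hf, Real.norm_of_nonneg (by positivity)]
    exact pow_le_pow_left₀ (norm_nonneg _) (norm_fourier_le _ ξ) 2
  have huu : Integrable (fun p : V × V => u p.1 * u p.2) volume := hu.mul_prod hu
  have hint : Integrable (fun z : (V × V) × (V × V) => u z.1.1 * u z.1.2 *
      Real.cos (2 * Real.pi * inner ℝ (z.2.1 - z.2.2) (z.1.1 - z.1.2))) (volume.prod ν) := by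
    refine (huu.comp_fst ν).mul_bdd (c := 1) (by fun_prop : Continuous _).aestronglyMeasurable ?_
    exact Filter.Eventually.of_forall fun _ => Real.abs_cos_le_one _
  -- Averaging `|û|²` over differences of two points of `B(0, R/2)` leads to the nonnegative kernel
  -- `ballCos²`, which a sharp cut-off to `B(0, R)` would not give.
  have hswap : ∫ p : V × V, ∫ q, u p.1 * u p.2 *
      Real.cos (2 * Real.pi * inner ℝ (q.1 - q.2) (p.1 - p.2)) ∂ν = ∫ q, f (q.1 - q.2) ∂ν := by
    rw [integral_integral_swap hint]
    refine integral_congr_ae (Filter.Eventually.of_forall fun q => ?_)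
    exact (norm_sq_fourier_ofReal hu (q.1 - q.2)).symm
  have hle1 : ∫ p : V × V, u p.1 * u p.2 * ballCos (R / 2) (p.1 - p.2) ^ 2 ≤
      ∫ q, f (q.1 - q.2) ∂ν := by
    rw [← hswap]
    refine integral_mono_of_nonneg (Filter.Eventually.of_forall fun p =>
      mul_nonneg (mul_nonneg (hu0 _) (hu0 _)) (sq_nonneg _)) hint.integral_prod_left
      (Filter.Eventually.of_forall fun p => ?_)
    simp only
    rw [integral_const_mul]
    exact mul_le_mul_of_nonneg_left (ballCos_sq_le _ _) (mul_nonneg (hu0 _) (hu0 _))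
  refine hle1.trans ?_
  have hfi : Integrable (fun q : V × V => f (q.1 - q.2)) ν := by
    refine Integrable.of_bound (hfc.comp (by fun_prop)).aestronglyMeasurable _
      (Filter.Eventually.of_forall fun q => hfb _)
  rw [hν, integral_prod _ hfi]
  have hfR : Integrable ((Metric.ball (0 : V) R).indicator f) volume :=
    (integrable_indicator_iff measurableSet_ball).2 (integrableOn_ball_of_continuous hfc R)
  -- Differences of two points of `B(0, R/2)` stay in `B(0, R)`.
  have hin : ∀ η ∈ B, ∫ ζ in B, f (η - ζ) ≤ ∫ ξ in Metric.ball (0 : V) R, f ξ := by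
    intro η hη
    rw [← integral_indicator measurableSet_ball, ← integral_indicator measurableSet_ball,
      ← integral_sub_left_eq_self ((Metric.ball (0 : V) R).indicator f) volume η]
    refine integral_mono_of_nonneg (Filter.Eventually.of_forall fun ζ =>
      indicator_nonneg (fun _ _ => by positivity) _) (hfR.comp_sub_left η)
      (Filter.Eventually.of_forall fun ζ => ?_)
    by_cases hζ : ζ ∈ B
    · have hmem : η - ζ ∈ Metric.ball (0 : V) R := by
        rw [hB, mem_ball_zero_iff] at hη hζ
        rw [mem_ball_zero_iff]
        exact (norm_sub_le _ _).trans_lt (by linarith)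
      rw [indicator_of_mem hζ]
      change f (η - ζ) ≤ (Metric.ball (0 : V) R).indicator f (η - ζ)
      rw [indicator_of_mem hmem]
    · rw [indicator_of_notMem hζ]
      exact indicator_nonneg (fun _ _ => by positivity) _
  calc _ ≤ ∫ _ in B, ∫ ξ in Metric.ball (0 : V) R, f ξ :=
        setIntegral_mono_on hfi.integral_prod_left (integrableOn_const measure_ball_lt_top.ne)
          measurableSet_ball hin
    _ = _ := by rw [setIntegral_const, smul_eq_mul]

/-- The set of pairs of points at distance at most `1 / (3 R)`. -/
lemma integral_near_diagonal_le {u : V → ℝ} (hu : Integrable u volume) (hu0 : ∀ x, 0 ≤ u x) {R : ℝ}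
    (hR : 0 < R) :
    volume.real (Metric.ball (0 : V) (R / 2)) / 4 *
      ∫ p in {p : V × V | ‖p.1 - p.2‖ ≤ 1 / (3 * R)}, u p.1 * u p.2 ≤
        ∫ ξ in Metric.ball (0 : V) R, ‖𝓕 (fun t => (u t : ℂ)) ξ‖ ^ 2 := by
  have hb : 0 < volume.real (Metric.ball (0 : V) (R / 2)) :=
    ENNReal.toReal_pos (Metric.measure_ball_pos volume _ (by positivity)).ne' measure_ball_lt_top.ne
  set b := volume.real (Metric.ball (0 : V) (R / 2)) with hbdef
  have hG : MeasurableSet {p : V × V | ‖p.1 - p.2‖ ≤ 1 / (3 * R)} :=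
    (isClosed_le (by fun_prop) continuous_const).measurableSet
  have huu : Integrable (fun p : V × V => u p.1 * u p.2) volume := hu.mul_prod hu
  have hbc : ∀ x : V, |ballCos (R / 2) x| ≤ b := by
    intro x
    have := norm_setIntegral_le_of_norm_le_const (μ := volume) (s := Metric.ball (0 : V) (R / 2))
      (f := fun η => Real.cos (2 * Real.pi * inner ℝ η x)) measure_ball_lt_top
      (fun η _ => Real.abs_cos_le_one _)
    rw [one_mul] at this
    exact this
  have hcont : Continuous fun x : V => ballCos (R / 2) x := by
    refine continuous_of_dominated (F := fun x η => Real.cos (2 * Real.pi * inner ℝ η x))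
      (bound := fun _ => 1) (fun x => (by fun_prop : Continuous _).aestronglyMeasurable)
      (fun x => Filter.Eventually.of_forall fun _ => Real.abs_cos_le_one _)
      (integrableOn_const measure_ball_lt_top.ne) (Filter.Eventually.of_forall fun η => by fun_prop)
  have hint : Integrable (fun p : V × V => u p.1 * u p.2 * ballCos (R / 2) (p.1 - p.2) ^ 2) volume := by
    refine huu.mul_bdd (c := b ^ 2) (by fun_prop : Continuous _).aestronglyMeasurable
      (Filter.Eventually.of_forall fun p => ?_)
    rw [norm_pow, Real.norm_eq_abs]
    exact pow_le_pow_left₀ (abs_nonneg _) (hbc _) 2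
  have h := integral_mul_ballCos_sq_le hu hu0 R
  have h2 : b ^ 2 / 4 * ∫ p in {p : V × V | ‖p.1 - p.2‖ ≤ 1 / (3 * R)}, u p.1 * u p.2 ≤
      ∫ p : V × V, u p.1 * u p.2 * ballCos (R / 2) (p.1 - p.2) ^ 2 := by
    rw [← integral_const_mul]
    refine (setIntegral_mono_on (huu.integrableOn.const_mul _) hint.integrableOn hG
      fun p hp => ?_).trans (setIntegral_le_integral hint
        (Filter.Eventually.of_forall fun p => mul_nonneg (mul_nonneg (hu0 _) (hu0 _)) (sq_nonneg _)))
    have h3 := half_volume_le_ballCos hR hp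
    have h4 : b ^ 2 / 4 ≤ ballCos (R / 2) (p.1 - p.2) ^ 2 := by
      have := pow_le_pow_left₀ (by positivity) h3 2
      linarith [this, (by ring : (b / 2) ^ 2 = b ^ 2 / 4)]
    rw [mul_comm]
    exact mul_le_mul_of_nonneg_left h4 (mul_nonneg (hu0 _) (hu0 _))
  have h5 := h2.trans h
  refine le_of_mul_le_mul_left ?_ hb
  calc _ = b ^ 2 / 4 * ∫ p in {p : V × V | ‖p.1 - p.2‖ ≤ 1 / (3 * R)}, u p.1 * u p.2 := by ring
    _ ≤ _ := h5

/-- Two points of the ball of radius `1/(6R)` are at distance at most `1/(3R)`, so this ball squared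
lies near the diagonal. -/
lemma sq_integral_ball_le_fourier {u : V → ℝ} (hu : Integrable u volume) (hu0 : ∀ x, 0 ≤ u x) {R : ℝ}
    (hR : 0 < R) :
    volume.real (Metric.ball (0 : V) (R / 2)) / 4 *
      (∫ t in Metric.ball (0 : V) (1 / (6 * R)), u t) ^ 2 ≤
        ∫ ξ in Metric.ball (0 : V) R, ‖𝓕 (fun t => (u t : ℂ)) ξ‖ ^ 2 := by
  refine le_trans (mul_le_mul_of_nonneg_left ?_ (by positivity)) (integral_near_diagonal_le hu hu0 hR)
  have huu : Integrable (fun p : V × V => u p.1 * u p.2) volume := hu.mul_prod hu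
  rw [sq, ← setIntegral_prod_mul]
  refine setIntegral_mono_set huu.integrableOn
    (Filter.Eventually.of_forall fun p => mul_nonneg (hu0 _) (hu0 _))
    (LE.le.eventuallyLE fun p hp => ?_)
  have h1 := mem_ball_zero_iff.1 hp.1
  have h2 := mem_ball_zero_iff.1 hp.2
  have h3 : 1 / (6 * R) + 1 / (6 * R) = 1 / (3 * R) := by field_simp; norm_num
  exact (norm_sub_le _ _).trans (by linarith)

/-- With `r = 1/(6R)`, each `s` outside `B(0, r)` has a full ball of radius `r` of points `t` with
`‖t‖ ≤ ‖s‖` and `‖s - t‖ ≤ 2r`. There `u t ≥ u s` for almost every `t`, so integrating `u s * u t`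
near the diagonal yields `|B(0, r)| u(s)²`. -/
lemma integral_sq_compl_ball_le_fourier [Nontrivial V] {u : V → ℝ} (hu : Integrable u volume)
    (hm : Measurable u) (hu2 : Integrable (fun x => u x ^ 2) volume) (hu0 : ∀ x, 0 ≤ u x)
    (hanti : ∀ x y, y ≠ 0 → ‖y‖ ≤ ‖x‖ → u x ≤ u y) {R : ℝ} (hR : 0 < R) :
    volume.real (Metric.ball (0 : V) (R / 2)) / 4 * (volume.real (Metric.ball (0 : V) (1 / (6 * R))) *
      ∫ t in (Metric.ball (0 : V) (1 / (6 * R)))ᶜ, u t ^ 2) ≤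
        ∫ ξ in Metric.ball (0 : V) R, ‖𝓕 (fun t => (u t : ℂ)) ξ‖ ^ 2 := by
  refine le_trans (mul_le_mul_of_nonneg_left ?_ (by positivity)) (integral_near_diagonal_le hu hu0 hR)
  set r := 1 / (6 * R) with hr
  have hr0 : 0 < r := by positivity
  have h2r : 1 / (3 * R) = 2 * r := by rw [hr]; field_simp; norm_num
  rw [h2r]
  set G : Set (V × V) := {p : V × V | ‖p.1 - p.2‖ ≤ 2 * r} with hGdef
  have hG : MeasurableSet G := (isClosed_le (by fun_prop) continuous_const).measurableSet
  have huu : Integrable (fun p : V × V => u p.1 * u p.2) volume := hu.mul_prod hu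
  refine (ENNReal.ofReal_le_ofReal_iff (integral_nonneg fun p => mul_nonneg (hu0 _) (hu0 _))).1 ?_
  rw [ENNReal.ofReal_mul measureReal_nonneg, ofReal_integral_eq_lintegral_ofReal hu2.integrableOn
      (Filter.Eventually.of_forall fun x => sq_nonneg _),
    ofReal_integral_eq_lintegral_ofReal huu.integrableOn
      (Filter.Eventually.of_forall fun p => mul_nonneg (hu0 _) (hu0 _)), Measure.real,
    ENNReal.ofReal_toReal measure_ball_lt_top.ne, ← lintegral_const_mul' _ _ measure_ball_lt_top.ne,
    ← lintegral_indicator hG, Measure.volume_eq_prod, lintegral_prod _ (by fun_prop)]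
  refine le_trans (setLIntegral_mono' measurableSet_ball.compl fun s hs => ?_)
    (setLIntegral_le_lintegral (Metric.ball (0 : V) r)ᶜ _)
  have hs : r ≤ ‖s‖ := by simpa using hs
  have hs0 : 0 < ‖s‖ := hr0.trans_le hs
  -- The point `s` moved by `r` towards the origin, so that `B(c, r)` stays inside `‖t‖ ≤ ‖s‖`.
  set c : V := (1 - r / ‖s‖) • s with hc
  have hcs : ‖s - c‖ = r := by
    have : s - c = (r / ‖s‖) • s := by rw [hc]; module
    rw [this, norm_smul, Real.norm_of_nonneg (by positivity)]
    field_simp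
  have hcn : ‖c‖ = ‖s‖ - r := by
    have : 0 ≤ 1 - r / ‖s‖ := by rw [sub_nonneg, div_le_one hs0]; exact hs
    rw [hc, norm_smul, Real.norm_of_nonneg this]
    field_simp
  calc volume (Metric.ball (0 : V) r) * ENNReal.ofReal (u s ^ 2)
      = ∫⁻ _ in Metric.ball c r, ENNReal.ofReal (u s ^ 2) := by
        rw [setLIntegral_const, Measure.addHaar_ball_center volume c r, mul_comm]
    _ ≤ ∫⁻ t in Metric.ball c r, G.indicator (fun p => ENNReal.ofReal (u p.1 * u p.2)) (s, t) := by
        refine setLIntegral_mono_ae' measurableSet_ball ?_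
        have h0 : ∀ᵐ t : V, t ≠ 0 := by simp [ae_iff]
        filter_upwards [h0] with t ht htc
        have htc : ‖t - c‖ < r := by simpa [dist_eq_norm] using htc
        have hmem : (s, t) ∈ G := by
          change ‖s - t‖ ≤ 2 * r
          have e : s - t = (s - c) - (t - c) := by abel
          rw [e]
          exact (norm_sub_le _ _).trans (by linarith)
        have hts : ‖t‖ ≤ ‖s‖ := by
          have e : t = (t - c) + c := by abel
          rw [e]
          exact (norm_add_le _ _).trans (by linarith)
        rw [indicator_of_mem hmem]
        refine ENNReal.ofReal_le_ofReal ?_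
        rw [sq]
        exact mul_le_mul_of_nonneg_left (hanti s t ht hts) (hu0 s)
    _ ≤ _ := setLIntegral_le_lintegral _ _

end LowerBound

/-! ### Extension of the lower bounds to `L²` by truncation in space. -/

section LowerBoundL2

variable {V : Type*} [NormedAddCommGroup V] [InnerProductSpace ℝ V] [FiniteDimensional ℝ V]
  [MeasurableSpace V] [BorelSpace V]

open Filter Topology

lemma tendsto_indicator_ball_natCast {V E : Type*} [NormedAddCommGroup V] [Zero E]
    [TopologicalSpace E] (g : V → E) (x : V) :
    Tendsto (fun n : ℕ => (Metric.ball (0 : V) n).indicator g x) atTop (𝓝 (g x)) := by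
  obtain ⟨N, hN⟩ := exists_nat_gt ‖x‖
  refine tendsto_const_nhds.congr' ((eventually_ge_atTop N).mono fun n hn => ?_)
  have : x ∈ Metric.ball (0 : V) n := mem_ball_zero_iff.2 (hN.trans_le (Nat.cast_le.2 hn))
  exact (indicator_of_mem this g).symm

lemma tendsto_toLp_indicator_ball {g : V → ℂ} (hg : MemLp g 2 volume) :
    Tendsto (fun n : ℕ => (hg.indicator measurableSet_ball :
      MemLp ((Metric.ball (0 : V) n).indicator g) 2 volume).toLp _) atTop (𝓝 (hg.toLp g)) := by
  have h2 : Integrable (fun x => ‖g x‖ ^ 2) volume := (memLp_two_iff_integrable_sq_norm hg.1).1 hg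
  rw [tendsto_iff_norm_sub_tendsto_zero]
  have hsq : Tendsto (fun n : ℕ => ‖(hg.indicator measurableSet_ball :
      MemLp ((Metric.ball (0 : V) n).indicator g) 2 volume).toLp _ - hg.toLp g‖ ^ 2) atTop (𝓝 0) := by
    have e : ∀ n : ℕ, ‖(hg.indicator measurableSet_ball :
        MemLp ((Metric.ball (0 : V) n).indicator g) 2 volume).toLp _ - hg.toLp g‖ ^ 2 =
        ∫ x, ‖(Metric.ball (0 : V) n).indicator g x - g x‖ ^ 2 := fun n => by
      rw [← MemLp.toLp_sub, Lp_norm_sq_eq_integral]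
      refine integral_congr_ae ?_
      filter_upwards [MemLp.coeFn_toLp (((hg.indicator measurableSet_ball :
        MemLp ((Metric.ball (0 : V) n).indicator g) 2 volume)).sub hg)] with x hx
      rw [hx]; rfl
    simp_rw [e]
    rw [← integral_zero V ℝ (μ := volume)]
    refine tendsto_integral_of_dominated_convergence (fun x => ‖g x‖ ^ 2) (fun n =>
      ((hg.1.indicator measurableSet_ball).sub hg.1).norm.pow 2) h2 (fun n => ?_) ?_
    · refine Eventually.of_forall fun x => ?_
      rw [Real.norm_of_nonneg (by positivity)]
      by_cases hx : x ∈ Metric.ball (0 : V) n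
      · rw [indicator_of_mem hx]; simp
      · rw [indicator_of_notMem hx]; simp
    · refine Eventually.of_forall fun x => ?_
      have := ((tendsto_indicator_ball_natCast g x).sub_const (g x)).norm.pow 2
      simpa using this
  have := hsq.sqrt
  simpa [Real.sqrt_sq] using this

lemma continuous_fourier_Lp :
    Continuous fun F : Lp ℂ 2 (volume : Measure V) => (𝓕 F : Lp ℂ 2 (volume : Measure V)) :=
  (Lp.fourierTransformₗᵢ V ℂ).continuous

variable {u : V → ℝ}

lemma indicator_ball_ofReal {V : Type*} [NormedAddCommGroup V] {u : V → ℝ} (r : ℝ) :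
    (Metric.ball (0 : V) r).indicator (fun t => (u t : ℂ)) =
      fun t => (((Metric.ball (0 : V) r).indicator u t : ℝ) : ℂ) := by
  ext t
  by_cases ht : t ∈ Metric.ball (0 : V) r
  · rw [indicator_of_mem ht, indicator_of_mem ht]
  · rw [indicator_of_notMem ht, indicator_of_notMem ht, Complex.ofReal_zero]

lemma integrableOn_ball_of_memLp (hu : MemLp (fun t => (u t : ℂ)) 2 volume) (r : ℝ) :
    IntegrableOn u (Metric.ball (0 : V) r) := by
  have : IsFiniteMeasure (volume.restrict (Metric.ball (0 : V) r)) :=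
    ⟨by simpa using measure_ball_lt_top⟩
  exact ((hu.restrict (Metric.ball (0 : V) r)).integrable (by norm_num)).re

lemma integrable_sq_of_memLp_ofReal (hu : MemLp (fun t => (u t : ℂ)) 2 volume) :
    Integrable (fun x => u x ^ 2) volume := by
  have := (memLp_two_iff_integrable_sq_norm hu.1).1 hu
  simpa using this

/-- Truncating a square integrable function perturbs the mass of its Fourier transform little. -/
lemma tendsto_setIntegral_fourier_truncation (hu : MemLp (fun t => (u t : ℂ)) 2 volume) (B : Set V) :
    Tendsto (fun n : ℕ => ∫ ξ in B,
        ‖𝓕 (fun t => (((Metric.ball (0 : V) n).indicator u t : ℝ) : ℂ)) ξ‖ ^ 2) atTop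
      (𝓝 (∫ ξ in B, ‖(𝓕 (hu.toLp _) : Lp ℂ 2 (volume : Measure V)) ξ‖ ^ 2)) := by
  refine (((continuous_setIntegral_norm_sq B).comp continuous_fourier_Lp).continuousAt.tendsto.comp
    (tendsto_toLp_indicator_ball hu)).congr fun n => ?_
  have h1 : Integrable ((Metric.ball (0 : V) n).indicator fun t => (u t : ℂ)) volume := by
    rw [indicator_ball_ofReal]
    exact ((integrable_indicator_iff measurableSet_ball).2 (integrableOn_ball_of_memLp hu n)).ofReal
  refine integral_congr_ae (ae_restrict_of_ae ?_)
  filter_upwards [fourier_toLp_ae_eq h1 (hu.indicator measurableSet_ball)] with ξ hξ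
  rw [← indicator_ball_ofReal]
  exact congrArg (fun z : ℂ => ‖z‖ ^ 2) hξ

lemma sq_integral_ball_le_fourier_toLp (hu : MemLp (fun t => (u t : ℂ)) 2 volume)
    (hu0 : ∀ x, 0 ≤ u x) {R : ℝ} (hR : 0 < R) :
    volume.real (Metric.ball (0 : V) (R / 2)) / 4 *
      (∫ t in Metric.ball (0 : V) (1 / (6 * R)), u t) ^ 2 ≤
        ∫ ξ in Metric.ball (0 : V) R, ‖(𝓕 (hu.toLp _) : Lp ℂ 2 (volume : Measure V)) ξ‖ ^ 2 := by
  refine ge_of_tendsto (tendsto_setIntegral_fourier_truncation hu _) ?_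
  -- Beyond this index the truncation no longer affects the ball of radius `1/(6R)`.
  obtain ⟨N, hN⟩ := exists_nat_gt (1 / (6 * R))
  filter_upwards [eventually_ge_atTop N] with n hn
  have h := sq_integral_ball_le_fourier ((integrable_indicator_iff measurableSet_ball).2
    (integrableOn_ball_of_memLp hu n)) (fun x => indicator_nonneg (fun x _ => hu0 x) x) hR
  rwa [setIntegral_indicator measurableSet_ball, inter_eq_left.2
    (Metric.ball_subset_ball (hN.le.trans (Nat.cast_le.2 hn)))] at h

lemma integral_sq_compl_ball_le_fourier_toLp [Nontrivial V] (hu : MemLp (fun t => (u t : ℂ)) 2 volume)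
    (hm : Measurable u) (hu0 : ∀ x, 0 ≤ u x) (hanti : ∀ x y, y ≠ 0 → ‖y‖ ≤ ‖x‖ → u x ≤ u y)
    {R : ℝ} (hR : 0 < R) :
    volume.real (Metric.ball (0 : V) (R / 2)) / 4 * (volume.real (Metric.ball (0 : V) (1 / (6 * R))) *
      ∫ t in (Metric.ball (0 : V) (1 / (6 * R)))ᶜ, u t ^ 2) ≤
        ∫ ξ in Metric.ball (0 : V) R, ‖(𝓕 (hu.toLp _) : Lp ℂ 2 (volume : Measure V)) ξ‖ ^ 2 := by
  have hu2 := integrable_sq_of_memLp_ofReal hu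
  have hle : ∀ (n : ℕ) x, (Metric.ball (0 : V) n).indicator u x ^ 2 ≤ u x ^ 2 := fun n x =>
    pow_le_pow_left₀ (indicator_nonneg (fun x _ => hu0 x) x)
      (indicator_le_self' (fun x _ => hu0 x) x) 2
  have hmn : ∀ n : ℕ, Measurable ((Metric.ball (0 : V) n).indicator u) := fun n =>
    hm.indicator measurableSet_ball
  have hlim : Tendsto (fun n : ℕ => ∫ t in (Metric.ball (0 : V) (1 / (6 * R)))ᶜ,
      (Metric.ball (0 : V) n).indicator u t ^ 2) atTop
      (𝓝 (∫ t in (Metric.ball (0 : V) (1 / (6 * R)))ᶜ, u t ^ 2)) := by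
    refine tendsto_integral_of_dominated_convergence (fun x => u x ^ 2)
      (fun n => ((hmn n).pow_const 2).aestronglyMeasurable) hu2.integrableOn (fun n => ?_) ?_
    · refine Eventually.of_forall fun x => ?_
      rw [Real.norm_of_nonneg (sq_nonneg _)]
      exact hle n x
    · exact Eventually.of_forall fun x => (tendsto_indicator_ball_natCast u x).pow 2
  refine le_of_tendsto_of_tendsto' ((hlim.const_mul _).const_mul _)
    (tendsto_setIntegral_fourier_truncation hu _) fun n => ?_
  refine integral_sq_compl_ball_le_fourier ((integrable_indicator_iff measurableSet_ball).2
    (integrableOn_ball_of_memLp hu n)) (hmn n) ?_ (fun x => indicator_nonneg (fun x _ => hu0 x) x) ?_ hR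
  · refine hu2.mono ((hmn n).pow_const 2).aestronglyMeasurable (Eventually.of_forall fun x => ?_)
    rw [Real.norm_of_nonneg (sq_nonneg _), Real.norm_of_nonneg (sq_nonneg _)]
    exact hle n x
  · intro x y hy hyx
    by_cases hx : x ∈ Metric.ball (0 : V) n
    · have hy' : y ∈ Metric.ball (0 : V) n := by
        rw [mem_ball_zero_iff] at hx ⊢
        exact hyx.trans_lt hx
      rw [indicator_of_mem hx, indicator_of_mem hy']
      exact hanti x y hy hyx
    · rw [indicator_of_notMem hx]
      exact indicator_nonneg (fun x _ => hu0 x) y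

end LowerBoundL2

/-! ### Truncation in height and the upper bound. -/

section Truncation

/-- The radial truncation of a complex number at height `τ`. -/
noncomputable def radialTrunc (τ : ℝ) (z : ℂ) : ℂ := ((min ‖z‖ τ / ‖z‖ : ℝ) : ℂ) * z

lemma measurable_radialTrunc (τ : ℝ) : Measurable (radialTrunc τ) := by
  unfold radialTrunc
  fun_prop

lemma norm_radialTrunc {τ : ℝ} (hτ : 0 ≤ τ) (z : ℂ) : ‖radialTrunc τ z‖ = min ‖z‖ τ := by
  have h0 : 0 ≤ min ‖z‖ τ := le_min (norm_nonneg z) hτ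
  rw [radialTrunc, norm_mul, Complex.norm_real, Real.norm_of_nonneg (div_nonneg h0 (norm_nonneg z))]
  -- At `z = 0` the quotient in `radialTrunc` is `0 / 0 = 0`, which is harmless.
  by_cases hz : ‖z‖ = 0
  · rw [hz, mul_zero, min_eq_left hτ]
  · exact div_mul_cancel₀ _ hz

lemma norm_sub_radialTrunc {τ : ℝ} (hτ : 0 ≤ τ) (z : ℂ) :
    ‖z - radialTrunc τ z‖ = max (‖z‖ - τ) 0 := by
  by_cases hz : ‖z‖ = 0
  · have : z = 0 := norm_eq_zero.1 hz
    simp [this, radialTrunc, hτ]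
  · have hp : 0 < ‖z‖ := lt_of_le_of_ne (norm_nonneg z) (Ne.symm hz)
    have e : z - radialTrunc τ z = (((‖z‖ - min ‖z‖ τ) / ‖z‖ : ℝ) : ℂ) * z := by
      have hz' : (‖z‖ : ℂ) ≠ 0 := by exact_mod_cast hz
      rw [radialTrunc]
      push_cast
      field_simp
    rw [e, norm_mul, Complex.norm_real,
      Real.norm_of_nonneg (div_nonneg (sub_nonneg.2 (min_le_left _ _)) hp.le), div_mul_cancel₀ _ hz]
    rcases le_total ‖z‖ τ with h | h
    · rw [min_eq_left h, max_eq_right (by linarith), sub_self]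
    · rw [min_eq_right h, max_eq_left (by linarith)]

end Truncation

section UpperBound

variable {W : Type*} [NormedAddCommGroup W] [InnerProductSpace ℝ W] [FiniteDimensional ℝ W]
  [MeasurableSpace W] [BorelSpace W]

/-- The mass of a Fourier transform in a set of finite measure, from a decomposition `L¹ + L²`. -/
lemma setIntegral_norm_sq_fourier_add_le {f g : W → ℂ} (hf1 : Integrable f volume)
    (hf : MemLp f 2 volume) (hg : MemLp g 2 volume) {E : Set W} (hEfin : volume E < ⊤) :
    ∫ ξ in E, ‖(𝓕 ((hf.add hg).toLp (f + g)) : Lp ℂ 2 (volume : Measure W)) ξ‖ ^ 2 ≤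
      2 * (volume.real E * (∫ x, ‖f x‖) ^ 2) + 2 * ∫ x, ‖g x‖ ^ 2 := by
  have hF : (𝓕 ((hf.add hg).toLp (f + g)) : Lp ℂ 2 (volume : Measure W)) =
      𝓕 (hf.toLp f) + 𝓕 (hg.toLp g) := by
    rw [MemLp.toLp_add]
    exact (Lp.fourierTransformₗᵢ W ℂ).map_add _ _
  set G : Lp ℂ 2 (volume : Measure W) := 𝓕 (hg.toLp g) with hG
  have hGi := integrable_norm_sq_Lp G
  have hle : ∫ ξ in E, ‖(𝓕 ((hf.add hg).toLp (f + g)) : Lp ℂ 2 (volume : Measure W)) ξ‖ ^ 2 ≤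
      ∫ ξ in E, (2 * (∫ x, ‖f x‖) ^ 2 + 2 * ‖G ξ‖ ^ 2) := by
    refine integral_mono_ae (integrable_norm_sq_Lp _).integrableOn
      ((integrableOn_const hEfin.ne).add (hGi.integrableOn.const_mul 2)) (ae_restrict_of_ae ?_)
    rw [hF]
    filter_upwards [Lp.coeFn_add (𝓕 (hf.toLp f) : Lp ℂ 2 (volume : Measure W)) G,
      fourier_toLp_ae_eq hf1 hf] with ξ h1 h2
    rw [h1, Pi.add_apply, h2]
    have h3 := norm_add_le (𝓕 f ξ) (G ξ)
    have h4 : ‖𝓕 f ξ‖ ≤ ∫ x, ‖f x‖ := norm_fourier_le f ξ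
    have h5 := norm_nonneg (𝓕 f ξ)
    have h6 : ‖𝓕 f ξ‖ ^ 2 ≤ (∫ x, ‖f x‖) ^ 2 := pow_le_pow_left₀ h5 h4 2
    have h7 := pow_le_pow_left₀ (norm_nonneg _) h3 2
    nlinarith [sq_nonneg (‖𝓕 f ξ‖ - ‖G ξ‖)]
  refine hle.trans ?_
  have hconst : Integrable (fun _ => 2 * (∫ x, ‖f x‖) ^ 2) (volume.restrict E) :=
    integrableOn_const hEfin.ne
  rw [integral_add hconst (hGi.integrableOn.const_mul 2), setIntegral_const, integral_const_mul,
    smul_eq_mul]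
  have h8 : ∫ ξ in E, ‖G ξ‖ ^ 2 ≤ ∫ x, ‖g x‖ ^ 2 := by
    rw [← norm_sq_fourier_toLp hg]
    exact setIntegral_le_integral hGi (Filter.Eventually.of_forall fun _ => sq_nonneg _)
  linarith

end UpperBound

/-! ### The `L²` comparison. -/

section Rearrangement

variable {d : ℕ} {V : Type*} [NormedAddCommGroup V] [InnerProductSpace ℝ V] [FiniteDimensional ℝ V]
  [MeasurableSpace V] [BorelSpace V] {φ : Eucl d → ℂ}

lemma volume_lt_norm_lt_top_of_memLp (hφ : MemLp φ 2 volume) (t : ℝ) (ht : 0 < t) :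
    volume {y | t < ‖φ y‖} < ⊤ := by
  have h := ((memLp_two_iff_integrable_sq_norm hφ.1).1 hφ).measure_gt_lt_top (pow_pos ht 2)
  refine lt_of_le_of_lt (measure_mono fun y (hy : t < ‖φ y‖) => ?_) h
  exact pow_lt_pow_left₀ hy ht.le two_ne_zero

lemma memLp_layerCake_ballStar [Nontrivial V] (hφ : MemLp φ 2 volume) :
    MemLp (fun t : V => (layerCake (ballStar V) φ t : ℂ)) 2 volume := by
  have hm : Measurable (layerCake (ballStar V) φ) := measurable_layerCake_ballStar φ
  refine (memLp_two_iff_integrable_sq_norm (by fun_prop)).2 ?_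
  have hfin := volume_lt_norm_lt_top_of_memLp hφ
  have h := lintegral_rpow_eq_of_equimeasurable (layerCake_nonneg (ballStar V) φ)
    (fun y => norm_nonneg (φ y)) hm.aemeasurable hφ.1.aemeasurable.norm
    (fun t ht => volume_lt_layerCake_ballStar hφ.1.aemeasurable hfin ht) two_pos
  simp only [Real.rpow_two] at h
  have h2 := (memLp_two_iff_integrable_sq_norm hφ.1).1 hφ
  simp only [Complex.norm_real, Real.norm_eq_abs, sq_abs]
  refine ⟨(hm.pow_const 2).aestronglyMeasurable, ?_⟩
  rw [hasFiniteIntegral_iff_ofReal (Filter.Eventually.of_forall fun _ => sq_nonneg _), h,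
    ← hasFiniteIntegral_iff_ofReal (Filter.Eventually.of_forall fun _ => sq_nonneg _)]
  exact h2.2

/-- The `L¹` norm of the part of `φ` above the height `τ`. -/
lemma lintegral_norm_sub_radialTrunc [Nontrivial V] (hφ : MemLp φ 2 volume) {τ : ℝ} (hτ : 0 ≤ τ) :
    ∫⁻ y, ENNReal.ofReal ‖φ y - radialTrunc τ (φ y)‖ =
      ∫⁻ x : V, ENNReal.ofReal (max (layerCake (ballStar V) φ x - τ) 0) := by
  have hm : Measurable (layerCake (ballStar V) φ) := measurable_layerCake_ballStar φ
  have hφm := hφ.1.aemeasurable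
  have key : ∀ t a : ℝ, 0 < t → (t < max (a - τ) 0 ↔ t + τ < a) := fun t a ht => by
    rw [lt_max_iff, lt_sub_iff_add_lt, or_iff_left (not_lt.2 ht.le)]
  have h := lintegral_rpow_eq_of_equimeasurable (μ := (volume : Measure (Eucl d)))
    (ν := (volume : Measure V)) (fun y => norm_nonneg (φ y - radialTrunc τ (φ y)))
    (fun x => le_max_right (layerCake (ballStar V) φ x - τ) 0)
    (hφm.sub ((measurable_radialTrunc τ).comp_aemeasurable hφm)).norm (by fun_prop) (fun t ht => by
      simp only [norm_sub_radialTrunc hτ, key t _ ht]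
      exact (volume_lt_layerCake_ballStar hφm (volume_lt_norm_lt_top_of_memLp hφ)
        (add_pos_of_pos_of_nonneg ht hτ)).symm) one_pos
  simpa only [Real.rpow_one] using h

/-- The `L²` norm of the truncation of `φ` at the height `τ`. -/
lemma lintegral_norm_radialTrunc_sq [Nontrivial V] (hφ : MemLp φ 2 volume) {τ : ℝ} (hτ : 0 ≤ τ) :
    ∫⁻ y, ENNReal.ofReal (‖radialTrunc τ (φ y)‖ ^ 2) =
      ∫⁻ x : V, ENNReal.ofReal (min (layerCake (ballStar V) φ x) τ ^ 2) := by
  have hm : Measurable (layerCake (ballStar V) φ) := measurable_layerCake_ballStar φ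
  have hφm := hφ.1.aemeasurable
  have h := lintegral_rpow_eq_of_equimeasurable (μ := (volume : Measure (Eucl d)))
    (ν := (volume : Measure V)) (fun y => norm_nonneg (radialTrunc τ (φ y)))
    (fun x => le_min (layerCake_nonneg (ballStar V) φ x) hτ)
    ((measurable_radialTrunc τ).comp_aemeasurable hφm).norm (by fun_prop) (fun t ht => by
      simp only [norm_radialTrunc hτ, lt_min_iff]
      by_cases htτ : t < τ
      · simp only [htτ, and_true]
        exact (volume_lt_layerCake_ballStar hφm (volume_lt_norm_lt_top_of_memLp hφ) ht).symm
      · simp [htτ]) two_pos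
  simpa only [Real.rpow_two] using h

/-- The upper bound for the mass of `φ̂` in a set of finite measure, in terms of the
rearrangement of `φ`. -/
lemma setIntegral_norm_sq_fourier_le [Nontrivial V] (hφ : MemLp φ 2 volume) {E : Set (Eucl d)}
    (hEfin : volume E < ⊤) {r : ℝ} (hr : 0 < r) :
    ∫ ξ in E, ‖(𝓕 (hφ.toLp φ) : Lp ℂ 2 (volume : Measure (Eucl d))) ξ‖ ^ 2 ≤
      2 * (volume.real E * (∫ x in Metric.ball (0 : V) r, layerCake (ballStar V) φ x) ^ 2) +
      2 * ((∫ x in Metric.ball (0 : V) r, layerCake (ballStar V) φ x) ^ 2 /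
          volume.real (Metric.ball (0 : V) r) +
        ∫ x in (Metric.ball (0 : V) r)ᶜ, layerCake (ballStar V) φ x ^ 2) := by
  have hφm := hφ.1.aemeasurable
  have hfin := volume_lt_norm_lt_top_of_memLp hφ
  have hm : Measurable (layerCake (ballStar V) φ) := measurable_layerCake_ballStar φ
  have hu := memLp_layerCake_ballStar (V := V) hφ
  have hub := integrableOn_ball_of_memLp hu r
  have hu2 := integrable_sq_of_memLp_ofReal hu
  have hu0 : ∀ x : V, 0 ≤ layerCake (ballStar V) φ x := layerCake_nonneg _ φ
  have hanti : ∀ x y : V, y ≠ 0 → ‖y‖ ≤ ‖x‖ →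
      layerCake (ballStar V) φ x ≤ layerCake (ballStar V) φ y :=
    fun x y hy h => layerCake_ballStar_anti hφm hfin hy h
  set u : V → ℝ := layerCake (ballStar V) φ with hudef
  set B : Set V := Metric.ball 0 r with hB
  set v := volume.real B with hv
  have hv0 : 0 < v :=
    ENNReal.toReal_pos (Metric.measure_ball_pos volume _ hr).ne' measure_ball_lt_top.ne
  set a := ∫ x in B, u x with ha
  set b := ∫ x in Bᶜ, u x ^ 2 with hb
  obtain ⟨x₀, hx₀⟩ := exists_norm_eq V hr.le
  have hx₀' : x₀ ≠ 0 := norm_pos_iff.1 (hx₀ ▸ hr)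
  -- The height of `u` on the sphere of radius `r`: `u ≤ τ` outside `B` and `u ≥ τ` almost
  -- everywhere in `B`. Hence the part of `φ` above `τ` has `L¹` norm at most `a`, and the part
  -- below has squared `L²` norm at most `τ² v + b`, where `τ v ≤ a`.
  set τ := u x₀ with hτdef
  have hτ : 0 ≤ τ := hu0 x₀
  have hout : ∀ x ∈ Bᶜ, u x ≤ τ := fun x hx => by
    refine hanti x x₀ hx₀' ?_
    rw [hx₀]
    simpa [hB] using hx
  have hτa : τ * v ≤ a := by
    have h : ∫ _ in B, τ ≤ a := by
      refine setIntegral_mono_on_ae (integrableOn_const measure_ball_lt_top.ne) hub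
        measurableSet_ball ?_
      have h0 : ∀ᵐ x : V, x ≠ 0 := by simp [ae_iff]
      filter_upwards [h0] with x hx hxB
      refine hanti x₀ x hx ?_
      rw [hx₀]
      exact (mem_ball_zero_iff.1 hxB).le
    rw [setIntegral_const, smul_eq_mul] at h
    linarith
  have ha0 : 0 ≤ a := integral_nonneg hu0
  set f : Eucl d → ℂ := fun y => φ y - radialTrunc τ (φ y) with hfdef
  set g : Eucl d → ℂ := fun y => radialTrunc τ (φ y) with hgdef
  have hgm : AEStronglyMeasurable g volume :=
    ((measurable_radialTrunc τ).comp_aemeasurable hφm).aestronglyMeasurable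
  have hg : MemLp g 2 volume := hφ.mono hgm (Filter.Eventually.of_forall fun y => by
    rw [hgdef, norm_radialTrunc hτ]
    exact min_le_left _ _)
  have hf : MemLp f 2 volume := hφ.sub hg
  have hfle : ∫⁻ y, ENNReal.ofReal ‖f y‖ ≤ ENNReal.ofReal a := by
    rw [hfdef, lintegral_norm_sub_radialTrunc (V := V) hφ hτ, ha,
      ofReal_integral_eq_lintegral_ofReal hub (Filter.Eventually.of_forall hu0),
      ← lintegral_indicator measurableSet_ball]
    refine lintegral_mono fun x => ?_
    by_cases hx : x ∈ B
    · rw [indicator_of_mem hx]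
      exact ENNReal.ofReal_le_ofReal (max_le (by linarith) (hu0 x))
    · rw [indicator_of_notMem hx, max_eq_right (sub_nonpos.2 (hout x hx)), ENNReal.ofReal_zero]
  have hf1 : Integrable f volume := by
    refine ⟨hf.1, ?_⟩
    rw [hasFiniteIntegral_iff_norm]
    exact hfle.trans_lt ENNReal.ofReal_lt_top
  have hfa : ∫ y, ‖f y‖ ≤ a := by
    rw [integral_eq_lintegral_of_nonneg_ae (Filter.Eventually.of_forall fun _ => norm_nonneg _)
      hf.1.norm]
    exact ENNReal.toReal_le_of_le_ofReal ha0 hfle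
  have hgb : ∫ y, ‖g y‖ ^ 2 ≤ τ ^ 2 * v + b := by
    have hmin : ∀ x, min (u x) τ ^ 2 ≤ u x ^ 2 := fun x =>
      pow_le_pow_left₀ (le_min (hu0 x) hτ) (min_le_left _ _) 2
    have hmi : Integrable (fun x => min (u x) τ ^ 2) volume :=
      hu2.mono (by fun_prop) (Filter.Eventually.of_forall fun x => by
        rw [Real.norm_of_nonneg (sq_nonneg _), Real.norm_of_nonneg (sq_nonneg _)]
        exact hmin x)
    have e : ∫ y, ‖g y‖ ^ 2 = ∫ x, min (u x) τ ^ 2 := by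
      rw [integral_eq_lintegral_of_nonneg_ae (Filter.Eventually.of_forall fun _ => sq_nonneg _)
        (hg.1.norm.pow 2), integral_eq_lintegral_of_nonneg_ae
        (Filter.Eventually.of_forall fun _ => sq_nonneg _) hmi.1,
        lintegral_norm_radialTrunc_sq (V := V) hφ hτ]
    rw [e, ← integral_add_compl measurableSet_ball hmi]
    refine add_le_add ?_ (setIntegral_mono hmi.integrableOn hu2.integrableOn hmin)
    have h : ∫ x in B, min (u x) τ ^ 2 ≤ ∫ _ in B, τ ^ 2 :=
      setIntegral_mono hmi.integrableOn (integrableOn_const measure_ball_lt_top.ne) fun x =>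
        pow_le_pow_left₀ (le_min (hu0 x) hτ) (min_le_right _ _) 2
    rwa [setIntegral_const, smul_eq_mul, mul_comm] at h
  have hfg : φ = f + g := by ext y; simp [hfdef, hgdef]
  have hto : hφ.toLp φ = (hf.add hg).toLp (f + g) :=
    MemLp.toLp_congr _ _ (Filter.Eventually.of_forall fun y => congrFun hfg y)
  rw [hto]
  refine (setIntegral_norm_sq_fourier_add_le hf1 hf hg hEfin).trans ?_
  have h1 : τ ^ 2 * v ≤ a ^ 2 / v := by
    rw [le_div_iff₀ hv0]
    have := pow_le_pow_left₀ (mul_nonneg hτ hv0.le) hτa 2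
    linarith [this, (by ring : (τ * v) ^ 2 = τ ^ 2 * v * v)]
  have h2 : (∫ y, ‖f y‖) ^ 2 ≤ a ^ 2 :=
    pow_le_pow_left₀ (integral_nonneg fun _ => norm_nonneg _) hfa 2
  have h3 : volume.real E * (∫ y, ‖f y‖) ^ 2 ≤ volume.real E * a ^ 2 :=
    mul_le_mul_of_nonneg_left h2 measureReal_nonneg
  linarith

/-- The mass of a Fourier transform in a set of finite measure is controlled by the mass of the
Fourier transform of the rearrangement in a ball of the same volume. -/
theorem exists_setIntegral_fourier_le_rearrangement (d : ℕ) [Nontrivial V]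
    {star : Set (Eucl d) → Set V} (hs : IsBallStar star) :
    ∃ κ : ℝ, ∀ E : Set (Eucl d), volume E < ⊤ → ∀ (φ : Eucl d → ℂ) (hφ : MemLp φ 2 volume),
      ∃ hstar : MemLp (fun t => (layerCake star φ t : ℂ)) 2 volume,
        ∫ ξ in E, ‖(𝓕 (hφ.toLp φ) : Lp ℂ 2 (volume : Measure (Eucl d))) ξ‖ ^ 2 ≤
          κ * ∫ ξ in ballStar V E,
            ‖(𝓕 (hstar.toLp fun t => (layerCake star φ t : ℂ)) :
              Lp ℂ 2 (volume : Measure V)) ξ‖ ^ 2 := by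
  set ω := volume.real (Metric.ball (0 : V) 1) with hω
  have hω0 : 0 < ω := volume_real_ball_one_pos V
  set k := Module.finrank ℝ V with hk
  -- With `A = |E|`, `ω R^k = A` and `r = 1/(6R)` one has `|B(0, R/2)| = A/2^k` and `|B(0, r)| =
  -- ω²/(6^k A)`. The lower bounds then cost `4·2^k` for `A a²` and `4·12^k/ω²` for each of
  -- `a²/|B(0, r)|` and `b`; the upper bound doubles all three.
  refine ⟨8 * 2 ^ k + 16 * 12 ^ k / ω ^ 2, fun E hEfin φ hφ => ?_⟩
  have hae := layerCake_ae_eq hs φ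
  have hu := memLp_layerCake_ballStar (V := V) hφ
  have haeC : (fun t => (layerCake star φ t : ℂ)) =ᵐ[volume]
      fun t => (layerCake (ballStar V) φ t : ℂ) := hae.mono fun t ht => by simp only [ht]
  have hstar : MemLp (fun t => (layerCake star φ t : ℂ)) 2 volume := (memLp_congr_ae haeC).2 hu
  refine ⟨hstar, ?_⟩
  rw [MemLp.toLp_congr hstar hu haeC]
  -- A null set would give `R = 0` and no usable radius `1/(6R)`.
  rcases eq_or_ne (volume E) 0 with hE | hE
  · rw [Measure.restrict_eq_zero.2 hE, integral_zero_measure]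
    exact mul_nonneg (by positivity) (integral_nonneg fun _ => sq_nonneg _)
  have hA : 0 < volume.real E := ENNReal.toReal_pos hE hEfin.ne
  have hRk := ballRadius_pow V hA.le
  rw [← hω, ← hk] at hRk
  rw [ballStar]
  set A := volume.real E with hAdef
  set R := ballRadius V A with hRdef
  have hR : 0 < R := Real.rpow_pos_of_pos (div_pos hA hω0) _
  have hfin := volume_lt_norm_lt_top_of_memLp hφ
  have hlow1 := sq_integral_ball_le_fourier_toLp hu (layerCake_nonneg _ φ) hR
  have hlow2 := integral_sq_compl_ball_le_fourier_toLp hu (measurable_layerCake_ballStar φ)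
    (layerCake_nonneg _ φ)
    (fun x y hy h => layerCake_ballStar_anti hφ.1.aemeasurable hfin hy h) hR
  have hup := setIntegral_norm_sq_fourier_le (V := V) hφ hEfin (by positivity : 0 < 1 / (6 * R))
  have hball : ∀ s : ℝ, 0 ≤ s → volume.real (Metric.ball (0 : V) s) = s ^ k * ω := fun s hs => by
    rw [Measure.real, Measure.addHaar_ball _ _ hs, ENNReal.toReal_mul,
      ENNReal.toReal_ofReal (pow_nonneg hs _)]
    rfl
  set I := ∫ ξ in Metric.ball (0 : V) R, ‖(𝓕 (hu.toLp fun t => (layerCake (ballStar V) φ t : ℂ)) :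
    Lp ℂ 2 (volume : Measure V)) ξ‖ ^ 2 with hI
  set a := ∫ x in Metric.ball (0 : V) (1 / (6 * R)), layerCake (ballStar V) φ x with ha
  set b := ∫ x in (Metric.ball (0 : V) (1 / (6 * R)))ᶜ, layerCake (ballStar V) φ x ^ 2 with hb
  have hw : volume.real (Metric.ball (0 : V) (R / 2)) = A / 2 ^ k := by
    rw [hball _ (by positivity), div_pow, hRk]
    field_simp
  have hv : volume.real (Metric.ball (0 : V) (1 / (6 * R))) = ω ^ 2 / (6 ^ k * A) := by
    rw [hball _ (by positivity), div_pow, mul_pow, hRk, one_pow]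
    field_simp
  rw [hw] at hlow1 hlow2
  rw [hv] at hlow2 hup
  rw [← hAdef] at hup
  have h1 : A * a ^ 2 ≤ 4 * 2 ^ k * I := by
    calc A * a ^ 2 = 4 * 2 ^ k * (A / 2 ^ k / 4 * a ^ 2) := by field_simp
      _ ≤ _ := mul_le_mul_of_nonneg_left hlow1 (by positivity)
  have h12 : (12 : ℝ) ^ k = 6 ^ k * 2 ^ k := by rw [← mul_pow]; norm_num
  have h2 : a ^ 2 / (ω ^ 2 / (6 ^ k * A)) ≤ 4 * 12 ^ k / ω ^ 2 * I := by
    calc a ^ 2 / (ω ^ 2 / (6 ^ k * A)) = 4 * 12 ^ k / ω ^ 2 * (A / 2 ^ k / 4 * a ^ 2) := by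
          rw [h12]; field_simp
      _ ≤ _ := mul_le_mul_of_nonneg_left hlow1 (by positivity)
  have h3 : b ≤ 4 * 12 ^ k / ω ^ 2 * I := by
    calc b = 4 * 12 ^ k / ω ^ 2 * (A / 2 ^ k / 4 * (ω ^ 2 / (6 ^ k * A) * b)) := by
          rw [h12]; field_simp
      _ ≤ _ := mul_le_mul_of_nonneg_left hlow2 (by positivity)
  calc _ ≤ _ := hup
    _ ≤ 2 * (4 * 2 ^ k * I) + 2 * (4 * 12 ^ k / ω ^ 2 * I + 4 * 12 ^ k / ω ^ 2 * I) := by gcongr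
    _ = _ := by ring

end Rearrangement

/-! ### The concrete rearrangements and the final assembly. -/

lemma ballRadius_real {a : ℝ} : ballRadius ℝ a = a / 2 := by
  simp [ballRadius, Measure.real, Real.volume_ball]

/-- Here the boundary is included, which is why `IsBallStar` admits anything between the open and
the closed ball. -/
lemma isBallStar_starInterval (d : ℕ) : IsBallStar (starInterval (d := d)) := by
  intro E
  rw [ballStar, ballRadius_real, starInterval, Real.ball_eq_Ioo, Real.closedBall_eq_Icc]
  simp only [zero_sub, zero_add]
  exact ⟨Ioo_subset_Icc_self, Subset.rfl⟩

lemma starBall_eq_ballStar (d k : ℕ) : starBall (d := d) k = ballStar (Eucl k) := by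
  ext1 E
  simp [starBall, ballStar, starRadius, ballRadius]

lemma isBallStar_starBall (d k : ℕ) : IsBallStar (starBall (d := d) k) := by
  rw [starBall_eq_ballStar]
  exact fun E => ⟨Subset.rfl, Metric.ball_subset_closedBall⟩

end SymmRearr

theorem mainTheorem10 (d : ℕ) (hd : 1 ≤ d) :
    -- one-dimensional rearrangement, integrable functions
    (∀ α β : ℝ, -1 / 2 < α → 0 ≤ β →
      ∃ C : ℝ, ∀ S Ω : ℝ, 0 < S → 0 < Ω →
        ∀ φ : SymmRearr.Eucl d → ℂ, Integrable φ volume →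
          volume (Function.support φ) ≤ ENNReal.ofReal S →
          Integrable (SymmRearr.rearrLine φ) volume ∧
          Integrable (SymmRearr.rearrIntegrand (SymmRearr.rearrLine φ) β (Ω ^ d)) volume ∧
          (∫ ξ : ℝ, SymmRearr.rearrIntegrand (SymmRearr.rearrLine φ) β (Ω ^ d) ξ).im = 0 ∧
          ∀ a x : SymmRearr.Eucl d,
            Integrable (SymmRearr.rieszIntegrand φ α Ω a x) volume ∧
            ‖∫ ξ : SymmRearr.Eucl d, SymmRearr.rieszIntegrand φ α Ω a x ξ‖ ≤
              C * SymmRearr.growth d α (Ω ^ d * S) *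
                (∫ ξ : ℝ, SymmRearr.rearrIntegrand (SymmRearr.rearrLine φ) β (Ω ^ d) ξ).re) ∧
    -- one-dimensional rearrangement, square integrable functions
    (∃ κ : ℝ, ∀ E : Set (SymmRearr.Eucl d), MeasurableSet E → volume E < ⊤ →
      ∀ (φ : SymmRearr.Eucl d → ℂ) (hφ : MemLp φ 2 volume),
        ∃ hstar : MemLp (fun t : ℝ => (SymmRearr.rearrLine φ t : ℂ)) 2 volume,
          ∫ ξ in E, ‖(𝓕 (hφ.toLp φ) : Lp ℂ 2 (volume : Measure (SymmRearr.Eucl d))) ξ‖ ^ 2 ≤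
            κ * ∫ ξ in (-(volume.real E / 2))..(volume.real E / 2),
              ‖(𝓕 (hstar.toLp (fun t : ℝ => (SymmRearr.rearrLine φ t : ℂ))) :
                Lp ℂ 2 (volume : Measure ℝ)) ξ‖ ^ 2) ∧
    -- `k`-dimensional rearrangement, integrable functions
    (∀ k : ℕ, 1 ≤ k → ∀ α β : ℝ, -1 / 2 < α → 0 ≤ β → (k : ℝ) / 2 - 1 ≤ β →
      ∃ C : ℝ, ∀ S Ω : ℝ, 0 < S → 0 < Ω →
        ∀ φ : SymmRearr.Eucl d → ℂ, Integrable φ volume →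
          volume (Function.support φ) ≤ ENNReal.ofReal S →
          Integrable (SymmRearr.rearrBall k φ) volume ∧
          Integrable (SymmRearr.rearrIntegrand (SymmRearr.rearrBall k φ) β
            (Ω ^ ((d : ℝ) / (k : ℝ)))) volume ∧
          (∫ ξ : SymmRearr.Eucl k, SymmRearr.rearrIntegrand (SymmRearr.rearrBall k φ) β
            (Ω ^ ((d : ℝ) / (k : ℝ))) ξ).im = 0 ∧
          ∀ a x : SymmRearr.Eucl d,
            Integrable (SymmRearr.rieszIntegrand φ α Ω a x) volume ∧
            ‖∫ ξ : SymmRearr.Eucl d, SymmRearr.rieszIntegrand φ α Ω a x ξ‖ ≤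
              C * SymmRearr.growth d α (Ω ^ d * S) *
                (∫ ξ : SymmRearr.Eucl k, SymmRearr.rearrIntegrand (SymmRearr.rearrBall k φ) β
                  (Ω ^ ((d : ℝ) / (k : ℝ))) ξ).re) ∧
    -- `k`-dimensional rearrangement, square integrable functions
    (∀ k : ℕ, 1 ≤ k →
      ∃ κ : ℝ, ∀ E : Set (SymmRearr.Eucl d), MeasurableSet E → volume E < ⊤ →
        ∀ (φ : SymmRearr.Eucl d → ℂ) (hφ : MemLp φ 2 volume),
          ∃ hstar : MemLp (fun t : SymmRearr.Eucl k => (SymmRearr.rearrBall k φ t : ℂ)) 2 volume,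
            ∫ ξ in E, ‖(𝓕 (hφ.toLp φ) : Lp ℂ 2 (volume : Measure (SymmRearr.Eucl d))) ξ‖ ^ 2 ≤
              κ * ∫ ξ in SymmRearr.starBall k E,
                ‖(𝓕 (hstar.toLp (fun t : SymmRearr.Eucl k => (SymmRearr.rearrBall k φ t : ℂ))) :
                  Lp ℂ 2 (volume : Measure (SymmRearr.Eucl k))) ξ‖ ^ 2) := by
  obtain ⟨D, rfl⟩ := Nat.exists_eq_add_of_le' hd
  refine ⟨fun α β hα hβ => ?_, ?_, fun k hk α β hα hβ hβ' => ?_, fun k hk => ?_⟩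
  -- On the line `n = 0`, so `R = Ω^d` and the condition `(n+1)/2 - 1 ≤ β` is just `-1/2 ≤ β`.
  · obtain ⟨C, hC⟩ := SymmRearr.exists_rieszIntegrand_le_rearrIntegrand (V := ℝ) (n := 0) (D := D)
      (Module.finrank_self ℝ) (SymmRearr.isBallStar_starInterval (D + 1)) hα hβ
      (by norm_num; linarith)
    exact ⟨C, fun S Ω hS hΩ φ hφ hsupp =>
      hC S Ω (Ω ^ (D + 1)) hS hΩ (by positivity) (pow_one _) φ hφ hsupp⟩
  · obtain ⟨κ, hκ⟩ := SymmRearr.exists_setIntegral_fourier_le_rearrangement (D + 1)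
      (SymmRearr.isBallStar_starInterval (D + 1))
    refine ⟨κ, fun E _ hE φ hφ => ?_⟩
    obtain ⟨hstar, h⟩ := hκ E hE φ hφ
    refine ⟨hstar, ?_⟩
    rw [intervalIntegral.integral_of_le (by linarith [measureReal_nonneg (μ := volume) (s := E)]),
      integral_Ioc_eq_integral_Ioo]
    rwa [SymmRearr.ballStar, SymmRearr.ballRadius_real, Real.ball_eq_Ioo, zero_sub, zero_add] at h
  · obtain ⟨n, rfl⟩ := Nat.exists_eq_add_of_le' hk
    obtain ⟨C, hC⟩ := SymmRearr.exists_rieszIntegrand_le_rearrIntegrand (V := SymmRearr.Eucl (n + 1))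
      (n := n) (D := D) finrank_euclideanSpace_fin (SymmRearr.isBallStar_starBall (D + 1) (n + 1))
      hα hβ (by push_cast at hβ'; exact hβ')
    refine ⟨C, fun S Ω hS hΩ φ hφ hsupp =>
      hC S Ω _ hS hΩ (Real.rpow_pos_of_pos hΩ _) ?_ φ hφ hsupp⟩
    rw [← Real.rpow_mul_natCast hΩ.le, div_mul_cancel₀ _ (by positivity), Real.rpow_natCast]
  · obtain ⟨n, rfl⟩ := Nat.exists_eq_add_of_le' hk
    obtain ⟨κ, hκ⟩ := SymmRearr.exists_setIntegral_fourier_le_rearrangement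
      (V := SymmRearr.Eucl (n + 1)) (D + 1) (SymmRearr.isBallStar_starBall (D + 1) (n + 1))
    refine ⟨κ, fun E _ hE φ hφ => ?_⟩
    obtain ⟨hstar, h⟩ := hκ E hE φ hφ
    refine ⟨hstar, ?_⟩
    rwa [← SymmRearr.starBall_eq_ballStar] at h
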